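/- Let $\mathbf{k}$ be a field of characteristic $0$, $\Omega$ a semigroup, $A$ and $V$ vector spaces over $\mathbf{k}$, and $\lambda\in\mathbf{k}$. For vector spaces $W,U$ and $n\ge 1$ let $\operatorname{Hom}_\Omega(W^{\otimes n},U)$ be the space of families $f=\{f_{\alpha_1,\dots,\alpha_n}\colon W^{\otimes n}\to U\}_{\alpha_1,\dots,\alpha_n\in\Omega}$ of linear maps. On $\bigoplus_{n\ge 1}\operatorname{Hom}_\Omega(W^{\otimes n},W)$, where $\operatorname{Hom}_\Omega(W^{\otimes n},W)$ has degree $n-1$, the $\Omega$-Gerstenhaber bracket of $f\in\operatorname{Hom}_\Omega(W^{\otimes m},W)$ and $g\in\operatorname{Hom}_\Omega(W^{\otimes n},W)$ is $$[f,g]_\Omega=\sum_{i=1}^m(-1)^{(i-1)(n-1)}f\circ_i g-(-1)^{(m-1)(n-1)}\sum_{i=1}^n(-1)^{(i-1)(m-1)}g\circ_i f,$$ where $$(f\circ_i g)_{\alpha_1,\dots,\alpha_{m+n-1}}(v_1,\dots,v_{m+n-1})=f_{\alpha_1,\dots,\alpha_{i-1},\,\alpha_i\cdots\alpha_{i+n-1},\,\alpha_{i+n},\dots,\alpha_{m+n-1}}\bigl(v_1,\dots,v_{i-1},g_{\alpha_i,\dots,\alpha_{i+n-1}}(v_i,\dots,v_{i+n-1}),v_{i+n},\dots,v_{m+n-1}\bigr).$$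 Let $\mathfrak{L}=\bigoplus_{n\ge1}\operatorname{Hom}_\Omega((A\oplus V)^{\otimes n},A\oplus V)$ with this bracket, let $\mathfrak{a}=\bigoplus_{n\ge1}\operatorname{Hom}_\Omega(V^{\otimes n},A)\subseteq\mathfrak{L}$ (extension by zero), and let $P$ be the projection of $\mathfrak{L}$ onto $\mathfrak{a}$ that restricts all arguments to $V$ and takes the $A$-component. Let $\mathfrak{L}'=\bigoplus_{n\ge1}\mathfrak{L}'(n)\subseteq\mathfrak{L}$ with $$\mathfrak{L}'(n)=\operatorname{Hom}_\Omega(A^{\otimes n},A)\oplus\bigoplus_{i=0}^{n-1}\operatorname{Hom}_\Omega(\mathcal{A}^{i,n-i},V),$$ where $\mathcal{A}^{p,q}\subseteq(A\oplus V)^{\otimes p+q}$ is the sum of the tensor products of copies of $A$ and $V$ in which $A$ occurs $p$ times and $V$ occurs $q$ times. On the graded vector space $s^{-1}\mathfrak{L}'\oplus\mathfrak{a}$ put $|s^{-1}f|=|f|-1$. An $L_\infty[1]$-algebra is a $\mathbb{Z}$-graded vector space with linear operations $l_n$ of $n$ arguments and degree $1$, $n\ge1$, such that for all $n\ge 1$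 and all homogeneous $x_1,\dots,x_n$, with $\varepsilon(\sigma)$ the Koszul sign and $\operatorname{Sh}(i,n-i)$ the set of $(i,n-i)$-shuffles, $l_n(x_{\sigma(1)},\dots,x_{\sigma(n)})=\varepsilon(\sigma)l_n(x_1,\dots,x_n)$ for all $\sigma\in\mathbb{S}_n$, and $$\sum_{i=1}^n\sum_{\sigma\in\operatorname{Sh}(i,n-i)}\varepsilon(\sigma)\,l_{n-i+1}\bigl(l_i(x_{\sigma(1)},\dots,x_{\sigma(i)}),x_{\sigma(i+1)},\dots,x_{\sigma(n)}\bigr)=0.$$ **Theorem.** There is a unique family of multilinear, graded symmetric operations $l'_i$, $i\ge1$, on $s^{-1}\mathfrak{L}'\oplus\mathfrak{a}$ such that \begin{align*} l'_1&=0,\\ l'_2(s^{-1}f,s^{-1}g)&=(-1)^{|f|}s^{-1}[f,g]_\Omega,\\ l'_i(s^{-1}f,\theta_1,\dots,\theta_{i-1})&=\lambda^{n-(i-1)}\,P\bigl[\dots\bigl[[f,\theta_1]_\Omega,\theta_2\bigr]_\Omega\dots,\theta_{i-1}\bigr]_\Omega,\qquad i\ge2, \end{align*} for $f\in\mathfrak{L}'(n)$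 (so $|f|=n-1$), $g\in\mathfrak{L}'$ and $\theta_1,\dots,\theta_{i-1}\in\mathfrak{a}$, and such that all other products of elements of $s^{-1}\mathfrak{L}'$ and elements of $\mathfrak{a}$, not obtained from these by permuting the arguments, vanish. With these operations $(s^{-1}\mathfrak{L}'\oplus\mathfrak{a},\{l'_i\}_{i\ge1})$ is an $L_\infty[1]$-algebra. (Here $\lambda^0=1$, also for $\lambda=0$; for $i-1>n$ the iterated bracket is $0$ and the right-hand side is read as $0$.) -/

import Mathlib

noncomputable section

namespace OmegaRB

/-! ### `L_∞[1]`-algebras -/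

section LInfty

/-- The Koszul sign `ε(σ; x₁, …, x_n)` of a permutation of homogeneous elements of degrees `d`, i.e.
the sign in `x₁ ⊙ ⋯ ⊙ x_n = ε(σ) x_{σ(1)} ⊙ ⋯ ⊙ x_{σ(n)}`: every pair of elements whose order is
reversed contributes `(-1)^{|x||y|}`. -/
def koszulSign {n : ℕ} (σ : Equiv.Perm (Fin n)) (d : Fin n → ℤ) : ℤˣ :=
  ∏ i : Fin n, ∏ j : Fin n,
    if i < j ∧ σ j < σ i then Int.negOnePow (d (σ i) * d (σ j)) else 1

/-- `σ` is a `(p, n - p)`-shuffle: it is increasing on the first `p` and on the last `n - p`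
positions. -/
def IsShuffle {n : ℕ} (p : ℕ) (σ : Equiv.Perm (Fin n)) : Prop :=
  (∀ a b : Fin n, a < b → (b : ℕ) < p → σ a < σ b) ∧
  (∀ a b : Fin n, a < b → p ≤ (a : ℕ) → σ a < σ b)

/-- A family of multilinear operations on `E`, one of each arity `≥ 1`; the entry `l n` is the
operation `l_{n+1}` with `n + 1` arguments. -/
abbrev Brackets (k : Type*) [Field k] (E : Type*) [AddCommGroup E] [Module k E] :=
  ∀ n : ℕ, MultilinearMap k (fun _ : Fin (n + 1) => E) E

variable {k : Type*} [Field k] {E : Type*} [AddCommGroup E] [Module k E]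

/-- Graded symmetry, `l_n(x_{σ(1)}, …, x_{σ(n)}) = ε(σ) l_n(x₁, …, x_n)` for homogeneous `x_i`. -/
def GradedSymmetric (𝒢 : ℤ → Submodule k E) (l : Brackets k E) : Prop :=
  ∀ (n : ℕ) (d : Fin (n + 1) → ℤ) (x : Fin (n + 1) → E), (∀ i, x i ∈ 𝒢 (d i)) →
    ∀ σ : Equiv.Perm (Fin (n + 1)), l n (fun i => x (σ i)) = koszulSign σ d • l n x

open Classical in
/-- The left-hand side of the generalised Jacobi identity for `n + 1` homogeneous arguments `x` of
degrees `d`. The summand with index `p : Fin (n + 1)` runs over the `(p + 1, n - p)`-shuffles: the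
inner operation is `l_{p+1}`, the outer one `l_{(n+1)-(p+1)+1} = l_{(n-p)+1}`. -/
def jacobiator (l : Brackets k E) (n : ℕ) (d : Fin (n + 1) → ℤ) (x : Fin (n + 1) → E) : E :=
  ∑ p : Fin (n + 1), ∑ σ : Equiv.Perm (Fin (n + 1)),
    if IsShuffle ((p : ℕ) + 1) σ then
      koszulSign σ d •
        l (n - p) (Fin.cons (α := fun _ => E)
          (l p (fun a : Fin ((p : ℕ) + 1) => x (σ ⟨a, by omega⟩)))
          (fun b : Fin (n - p) => x (σ ⟨(p : ℕ) + 1 + b, by omega⟩)))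
    else 0

/-- `(E, {l_n}_{n ≥ 1})`, with homogeneous components `𝒢 d`, is an `L_∞[1]`-algebra. -/
structure IsLInftyOneAlgebra (𝒢 : ℤ → Submodule k E) (l : Brackets k E) : Prop where
  /-- `E = ⨁_{d ∈ ℤ} 𝒢 d` -/
  grading : DirectSum.IsInternal 𝒢
  /-- every `l_n` has degree `1` -/
  degree_one : ∀ (n : ℕ) (d : Fin (n + 1) → ℤ) (x : Fin (n + 1) → E), (∀ i, x i ∈ 𝒢 (d i)) →
    l n x ∈ 𝒢 (∑ i, d i + 1)
  symm : GradedSymmetric 𝒢 l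
  jacobi : ∀ (n : ℕ) (d : Fin (n + 1) → ℤ) (x : Fin (n + 1) → E), (∀ i, x i ∈ 𝒢 (d i)) →
    jacobiator l n d x = 0

end LInfty

/-! ### `Ω`-indexed multilinear maps and the `Ω`-Gerstenhaber bracket -/

/-- `Hom_Ω(W^{⊗n}, U)`: families of `n`-linear maps labelled by `Ω^n`. -/
abbrev HomOmega (k Ω : Type*) [Field k] (n : ℕ) (W U : Type*) [AddCommGroup W] [Module k W]
    [AddCommGroup U] [Module k U] :=
  (Fin n → Ω) → MultilinearMap k (fun _ : Fin n => W) U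

/-- The product `α₀ α₁ ⋯ α_n` of a nonempty finite sequence in a semigroup. -/
def seqProd {Ω : Type*} [Semigroup Ω] : (n : ℕ) → (Fin (n + 1) → Ω) → Ω
  | 0, a => a 0
  | n + 1, a => a 0 * seqProd n (Fin.tail a)

/-- The entries `x_i, …, x_{i+n}` of a sequence of length `m + n + 1`. -/
def block {X : Type*} {m n : ℕ} (i : Fin (m + 1)) (x : Fin (m + n + 1) → X) : Fin (n + 1) → X :=
  fun j => x ⟨(i : ℕ) + j, by omega⟩

/-- The sequence `x₀, …, x_{i-1}, y, x_{i+n+1}, …, x_{m+n}` of length `m + 1`, in which the block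
`x_i, …, x_{i+n}` is replaced by the single entry `y`. -/
def replaceBlock {X : Type*} {m n : ℕ} (i : Fin (m + 1)) (x : Fin (m + n + 1) → X) (y : X) :
    Fin (m + 1) → X :=
  fun j => if j < i then x ⟨j, by omega⟩ else if j = i then y else x ⟨(j : ℕ) + n, by omega⟩

section Update

variable {X : Type*} {m n : ℕ}

theorem replaceBlock_eq_update (i : Fin (m + 1)) (x : Fin (m + n + 1) → X) (y z : X) :
    replaceBlock i x y = Function.update (replaceBlock i x z) i y := by
  funext j
  by_cases h : j = i
  · subst h; simp [replaceBlock]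
  · simp [replaceBlock, h]

theorem block_update_of_lt (i : Fin (m + 1)) (x : Fin (m + n + 1) → X) (p : Fin (m + n + 1)) (a : X)
    (h : (p : ℕ) < i ∨ (i : ℕ) + n < p) : block i (Function.update x p a) = block i x := by
  funext j
  simp only [block]
  rw [Function.update_of_ne]
  intro e
  have := congrArg Fin.val e
  simp only at this
  omega

theorem block_update (i : Fin (m + 1)) (x : Fin (m + n + 1) → X) (p : Fin (m + n + 1)) (a : X)
    (q : Fin (n + 1)) (h : (p : ℕ) = i + q) :
    block i (Function.update x p a) = Function.update (block i x) q a := by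
  funext j
  by_cases hj : j = q
  · subst hj
    have e : (⟨(i : ℕ) + j, by omega⟩ : Fin (m + n + 1)) = p := Fin.ext h.symm
    simp [block, e]
  · rw [Function.update_of_ne hj]
    simp only [block]
    rw [Function.update_of_ne]
    intro e
    have := congrArg Fin.val e
    simp only at this
    exact hj (Fin.ext (by omega))

theorem replaceBlock_update_block (i : Fin (m + 1)) (x : Fin (m + n + 1) → X) (p : Fin (m + n + 1))
    (a y : X) (h : (i : ℕ) ≤ p) (h' : (p : ℕ) ≤ i + n) :
    replaceBlock i (Function.update x p a) y = replaceBlock i x y := by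
  funext j
  simp only [replaceBlock]
  split_ifs with h1 h2
  · rw [Function.update_of_ne]
    intro e
    have := congrArg Fin.val e
    have h1' : (j : ℕ) < i := h1
    simp only at this
    omega
  · rfl
  · rw [Function.update_of_ne]
    intro e
    have := congrArg Fin.val e
    have h1' : ¬ (j : ℕ) < i := h1
    have h2' : ¬ (j : ℕ) = i := fun e => h2 (Fin.ext e)
    simp only at this
    omega

theorem replaceBlock_update (i : Fin (m + 1)) (x : Fin (m + n + 1) → X) (p : Fin (m + n + 1))
    (a y : X) (q : Fin (m + 1))
    (h : ((p : ℕ) = q ∧ q < i) ∨ ((p : ℕ) = q + n ∧ i < q)) :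
    replaceBlock i (Function.update x p a) y = Function.update (replaceBlock i x y) q a := by
  funext j
  by_cases hj : j = q
  · subst hj
    rw [Function.update_self]
    simp only [replaceBlock]
    rcases h with ⟨h, h1⟩ | ⟨h, h1⟩
    · have e : (⟨(j : ℕ), by omega⟩ : Fin (m + n + 1)) = p := Fin.ext h.symm
      simp [h1, e]
    · have e : (⟨(j : ℕ) + n, by omega⟩ : Fin (m + n + 1)) = p := Fin.ext h.symm
      simp [h1.not_gt, h1.ne', e]
  · rw [Function.update_of_ne hj]
    simp only [replaceBlock]
    have hj' : ¬ (j : ℕ) = q := fun e => hj (Fin.ext e)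
    have hl : ∀ a b : Fin (m + 1), a < b ↔ (a : ℕ) < b := fun a b => Iff.rfl
    simp only [hl] at h
    split_ifs with h1 h2
    · rw [hl] at h1
      rw [Function.update_of_ne]
      intro e
      have := congrArg Fin.val e
      simp only at this
      omega
    · rfl
    · rw [hl] at h1
      have h2' : ¬ (j : ℕ) = i := fun e => h2 (Fin.ext e)
      rw [Function.update_of_ne]
      intro e
      have := congrArg Fin.val e
      simp only at this
      omega

theorem update_cases (i : Fin (m + 1)) (p : Fin (m + n + 1)) :
    (∃ q : Fin (n + 1), (p : ℕ) = i + q) ∨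
    (((p : ℕ) < i ∨ (i : ℕ) + n < p) ∧
      ∃ q : Fin (m + 1), ((p : ℕ) = q ∧ q < i) ∨ ((p : ℕ) = q + n ∧ i < q)) := by
  have hl : ∀ a b : Fin (m + 1), a < b ↔ (a : ℕ) < b := fun a b => Iff.rfl
  simp only [hl]
  by_cases h1 : (p : ℕ) < i
  · exact Or.inr ⟨Or.inl h1, ⟨⟨p, by omega⟩, Or.inl ⟨rfl, h1⟩⟩⟩
  by_cases h2 : (p : ℕ) ≤ i + n
  · exact Or.inl ⟨⟨(p : ℕ) - i, by omega⟩, by simp only; omega⟩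
  · exact Or.inr ⟨Or.inr (by omega), ⟨⟨(p : ℕ) - n, by omega⟩, Or.inr (by simp only; omega)⟩⟩

end Update

section Gerstenhaber

variable {k Ω : Type*} [Field k] [Semigroup Ω] {W : Type*} [AddCommGroup W] [Module k W]

/-- The partial composition `f ∘_i g` (with `i` counted from `0`) of `f` with `m + 1` and `g` with
`n + 1` arguments:
`(f ∘_i g)_α(v) = f_{α₀,…,α_i⋯α_{i+n},…}(v₀, …, g_{α_i,…,α_{i+n}}(v_i, …, v_{i+n}), …)`. -/
def circ {m n : ℕ} (i : Fin (m + 1)) (f : HomOmega k Ω (m + 1) W W)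
    (g : HomOmega k Ω (n + 1) W W) : HomOmega k Ω (m + n + 1) W W := fun α =>
  { toFun := fun v =>
      f (replaceBlock i α (seqProd n (block i α)))
        (replaceBlock i v (g (block i α) (block i v)))
    map_update_add' := by
      intro hdec v p a b
      have hd : hdec = instDecidableEqFin _ := Subsingleton.elim _ _
      subst hd
      rcases update_cases i p with ⟨q, hq⟩ | ⟨hb, q, hq⟩
      · simp only [block_update i v p _ q hq]
        rw [replaceBlock_update_block i v p _ _ (by omega) (by omega),
          replaceBlock_update_block i v p _ _ (by omega) (by omega),
          replaceBlock_update_block i v p _ _ (by omega) (by omega),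
          MultilinearMap.map_update_add, replaceBlock_eq_update i v _ 0,
          MultilinearMap.map_update_add, ← replaceBlock_eq_update, ← replaceBlock_eq_update]
      · simp only [block_update_of_lt i v p _ hb, replaceBlock_update i v p _ _ q hq,
          MultilinearMap.map_update_add]
    map_update_smul' := by
      intro hdec v p c a
      have hd : hdec = instDecidableEqFin _ := Subsingleton.elim _ _
      subst hd
      rcases update_cases i p with ⟨q, hq⟩ | ⟨hb, q, hq⟩
      · simp only [block_update i v p _ q hq]
        rw [replaceBlock_update_block i v p _ _ (by omega) (by omega),
          replaceBlock_update_block i v p _ _ (by omega) (by omega),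
          MultilinearMap.map_update_smul, replaceBlock_eq_update i v _ 0,
          MultilinearMap.map_update_smul, ← replaceBlock_eq_update]
      · simp only [block_update_of_lt i v p _ hb, replaceBlock_update i v p _ _ q hq,
          MultilinearMap.map_update_smul] }

theorem circ_add_left {m n : ℕ} (i : Fin (m + 1)) (f f' : HomOmega k Ω (m + 1) W W)
    (g : HomOmega k Ω (n + 1) W W) : circ i (f + f') g = circ i f g + circ i f' g := rfl

theorem circ_smul_left {m n : ℕ} (i : Fin (m + 1)) (c : k) (f : HomOmega k Ω (m + 1) W W)
    (g : HomOmega k Ω (n + 1) W W) : circ i (c • f) g = c • circ i f g := rfl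

theorem circ_add_right {m n : ℕ} (i : Fin (m + 1)) (f : HomOmega k Ω (m + 1) W W)
    (g g' : HomOmega k Ω (n + 1) W W) : circ i f (g + g') = circ i f g + circ i f g' := by
  funext α
  ext v
  simp only [circ, MultilinearMap.coe_mk, Pi.add_apply, add_apply]
  rw [replaceBlock_eq_update i v _ 0, MultilinearMap.map_update_add, ← replaceBlock_eq_update,
    ← replaceBlock_eq_update]

theorem circ_smul_right {m n : ℕ} (i : Fin (m + 1)) (c : k) (f : HomOmega k Ω (m + 1) W W)
    (g : HomOmega k Ω (n + 1) W W) : circ i f (c • g) = c • circ i f g := by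
  funext α
  ext v
  simp only [circ, MultilinearMap.coe_mk, Pi.smul_apply, smul_apply]
  rw [replaceBlock_eq_update i v _ 0, MultilinearMap.map_update_smul, ← replaceBlock_eq_update]

variable (k Ω W) in
/-- `⨁_{n ≥ 0} Hom_Ω(W^{⊗ n+1}, W)`; the summand with index `n` has degree `n`. -/
abbrev Cochains := DirectSum ℕ (fun n => HomOmega k Ω (n + 1) W W)

/-- The `Ω`-Gerstenhaber bracket of `f ∈ Hom_Ω(W^{⊗ m+1}, W)` and `g ∈ Hom_Ω(W^{⊗ n+1}, W)`. -/
def gerstenhaberHom (m n : ℕ) (f : HomOmega k Ω (m + 1) W W) (g : HomOmega k Ω (n + 1) W W) :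
    Cochains k Ω W :=
  ∑ i : Fin (m + 1), (-1 : k) ^ ((i : ℕ) * n) •
      DirectSum.lof k ℕ (fun n => HomOmega k Ω (n + 1) W W) (m + n) (circ i f g)
    - (-1 : k) ^ (m * n) • ∑ i : Fin (n + 1), (-1 : k) ^ ((i : ℕ) * m) •
      DirectSum.lof k ℕ (fun n => HomOmega k Ω (n + 1) W W) (n + m) (circ i g f)

variable (k Ω W) in
/-- The `Ω`-Gerstenhaber bracket `[-, -]_Ω`, extended bilinearly. -/
def gerstenhaber : Cochains k Ω W →ₗ[k] Cochains k Ω W →ₗ[k] Cochains k Ω W :=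
  DirectSum.toModule k ℕ _ fun m => LinearMap.flip <| DirectSum.toModule k ℕ _ fun n =>
    LinearMap.flip <| LinearMap.mk₂ k (gerstenhaberHom m n)
      (by
        intro f f' g
        simp only [gerstenhaberHom, circ_add_left, circ_add_right, map_add, smul_add,
          Finset.sum_add_distrib]
        abel)
      (by
        intro c f g
        simp only [gerstenhaberHom, circ_smul_left, circ_smul_right, map_smul, smul_sub,
          Finset.smul_sum, smul_comm c])
      (by
        intro f g g'
        simp only [gerstenhaberHom, circ_add_left, circ_add_right, map_add, smul_add,
          Finset.sum_add_distrib]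
        abel)
      (by
        intro c f g
        simp only [gerstenhaberHom, circ_smul_left, circ_smul_right, map_smul, smul_sub,
          Finset.smul_sum, smul_comm c])

end Gerstenhaber

/-! ### The graded space `s⁻¹𝔏' ⊕ 𝔞` and the modified brackets -/

section Modified

variable (k Ω A V : Type*) [Field k] [AddCommGroup A] [Module k A] [AddCommGroup V] [Module k V]

/-- `𝔏 = ⨁_{n ≥ 0} Hom_Ω((A ⊕ V)^{⊗ n+1}, A ⊕ V)`. -/
abbrev BigL := Cochains k Ω (A × V)

/-- `𝔏'(n) = Hom_Ω(A^{⊗ n}, A) ⊕ ⨁_{i<n} Hom_Ω(𝒜^{i,n-i}, V)` inside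
`Hom_Ω((A ⊕ V)^{⊗ n}, A ⊕ V)`: the `A`-valued part vanishes as soon as one argument lies in `V`,
and the `V`-valued part vanishes when all arguments lie in `A`. -/
def LPrimeHom (n : ℕ) : Submodule k (HomOmega k Ω n (A × V) (A × V)) where
  carrier := {f | ∀ (α : Fin n → Ω) (w : Fin n → A × V),
    ((∃ j, (w j).1 = 0) → (f α w).1 = 0) ∧ ((∀ j, (w j).2 = 0) → (f α w).2 = 0)}
  zero_mem' := by intro α w; simp
  add_mem' := by
    intro f g hf hg α w
    refine ⟨fun h => ?_, fun h => ?_⟩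
    · simp [(hf α w).1 h, (hg α w).1 h]
    · simp [(hf α w).2 h, (hg α w).2 h]
  smul_mem' := by
    intro c f hf α w
    refine ⟨fun h => ?_, fun h => ?_⟩
    · simp [(hf α w).1 h]
    · simp [(hf α w).2 h]

/-- `𝔏' = ⨁_{n ≥ 0} 𝔏'(n+1)`, a graded subspace of `𝔏`. -/
def LPrime : Submodule k (BigL k Ω A V) where
  carrier := {f | ∀ n, f n ∈ LPrimeHom k Ω A V (n + 1)}
  zero_mem' := fun _ => Submodule.zero_mem _
  add_mem' := fun hf hg n => Submodule.add_mem _ (hf n) (hg n)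
  smul_mem' := fun c _ hf n => Submodule.smul_mem _ c (hf n)

/-- `𝔞 = ⨁_{n ≥ 0} Hom_Ω(V^{⊗ n+1}, A)`. -/
abbrev Frak := DirectSum ℕ (fun n => HomOmega k Ω (n + 1) V A)

/-- The inclusion `𝔞 ⊆ 𝔏` (extension by zero). -/
def inclA : Frak k Ω A V →ₗ[k] BigL k Ω A V :=
  DirectSum.lmap fun n =>
    { toFun := fun θ α =>
        (LinearMap.inl k A V).compMultilinearMap
          ((θ α).compLinearMap fun _ : Fin (n + 1) => LinearMap.snd k A V)
      map_add' := by intro θ θ'; funext α; ext w <;> simp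
      map_smul' := by intro c θ; funext α; ext w <;> simp }

/-- The projection `P` of `𝔏` onto `𝔞`: restrict all arguments to `V` and take the component in
`A`. -/
def projA : BigL k Ω A V →ₗ[k] Frak k Ω A V :=
  DirectSum.lmap fun n =>
    { toFun := fun f α =>
        (LinearMap.fst k A V).compMultilinearMap
          ((f α).compLinearMap fun _ : Fin (n + 1) => LinearMap.inr k A V)
      map_add' := by intro θ θ'; funext α; ext w; simp
      map_smul' := by intro c θ; funext α; ext w; simp }

/-- The underlying vector space of `s⁻¹𝔏' ⊕ 𝔞`; the pair `(f, θ)` stands for `s⁻¹f + θ`. -/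
abbrev Total := LPrime k Ω A V × Frak k Ω A V

/-- The degree `d` part of `s⁻¹𝔏' ⊕ 𝔞`, where `|s⁻¹f| = |f| - 1` and maps with `n + 1` arguments
have degree `n` in `𝔏` and in `𝔞`. -/
def totalGrading (d : ℤ) : Submodule k (Total k Ω A V) where
  carrier := {x | (∀ n : ℕ, (n : ℤ) - 1 ≠ d → (x.1 : BigL k Ω A V) n = 0) ∧
    (∀ n : ℕ, (n : ℤ) ≠ d → x.2 n = 0)}
  zero_mem' := ⟨fun _ _ => rfl, fun _ _ => rfl⟩
  add_mem' := by
    rintro x y ⟨hx, hx'⟩ ⟨hy, hy'⟩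
    refine ⟨fun n h => ?_, fun n h => ?_⟩
    · simp [DirectSum.add_apply, hx n h, hy n h]
    · simp [DirectSum.add_apply, hx' n h, hy' n h]
  smul_mem' := by
    rintro c x ⟨hx, hx'⟩
    refine ⟨fun n h => ?_, fun n h => ?_⟩
    · simp [DirectSum.smul_apply, hx n h]
    · simp [DirectSum.smul_apply, hx' n h]

variable {k Ω A V} [Semigroup Ω]

/-- The iterated bracket `[…[[f, θ₁]_Ω, θ₂]_Ω …, θ_n]_Ω` in `𝔏`. -/
def iteratedBracket {n : ℕ} (f : BigL k Ω A V) (θ : Fin n → Frak k Ω A V) : BigL k Ω A V :=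
  (List.ofFn θ).foldl (fun x t => gerstenhaber k Ω (A × V) x (inclA k Ω A V t)) f

/-- `l` is the family of brackets `l'_1, l'_2, …` of weight `lam` on `s⁻¹𝔏' ⊕ 𝔞`: it is given by
the formulas below, extended to all arguments by multilinearity and graded symmetry. (`l n` is
`l'_{n+1}`.) -/
structure IsModifiedBrackets (lam : k) (l : Brackets k (Total k Ω A V)) : Prop where
  symm : GradedSymmetric (totalGrading k Ω A V) l
  /-- `l'_1 = 0` -/
  one : l 0 = 0
  /-- `l'_2(s⁻¹f, s⁻¹g) = (-1)^{|f|} s⁻¹[f, g]_Ω`, where `|f| = m` -/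
  two : ∀ (m : ℕ) (f g : LPrime k Ω A V), (∀ j, j ≠ m → (f : BigL k Ω A V) j = 0) →
    ((l 1 ![(f, 0), (g, 0)]).1 : BigL k Ω A V) =
        (-1 : k) ^ m • gerstenhaber k Ω (A × V) (f : BigL k Ω A V) (g : BigL k Ω A V) ∧
      (l 1 ![(f, 0), (g, 0)]).2 = 0
  /-- `l'_{n+1}(s⁻¹f, θ₁, …, θ_n) = λ^{(m+1)-n} P[…[[f, θ₁]_Ω, θ₂]_Ω …, θ_n]_Ω` for
  `f ∈ 𝔏'(m+1)` and `n ≥ 1`. The iterated bracket is `0` for `n > m + 1`, so that a negative power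
  of `λ` always multiplies `0`. -/
  mixed : ∀ (m n : ℕ) (f : LPrime k Ω A V) (θ : Fin n → Frak k Ω A V), 1 ≤ n →
    (∀ j, j ≠ m → (f : BigL k Ω A V) j = 0) →
    l n (Fin.cons (α := fun _ => Total k Ω A V) (f, 0) (fun j => (0, θ j))) =
      (0, lam ^ (((m + 1 : ℕ) : ℤ) - (n : ℤ)) •
        projA k Ω A V (iteratedBracket (f : BigL k Ω A V) θ))
  /-- Products of elements of `s⁻¹𝔏'` (in the positions `S`) and of elements of `𝔞` (in the other
  positions) vanish unless exactly one factor is from `s⁻¹𝔏'`, or there are exactly two factors,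
  both from `s⁻¹𝔏'`. -/
  vanish : ∀ (n : ℕ) (x : Fin (n + 1) → Total k Ω A V) (S : Finset (Fin (n + 1))),
    (∀ j ∈ S, (x j).2 = 0) → (∀ j ∉ S, (x j).1 = 0) →
    S.card ≠ 1 → ¬ (S.card = 2 ∧ n = 1) → l n x = 0

end Modified

end OmegaRB

end

/-! The operations are higher derived brackets in the sense of Voronov, twisted by powers of `lam`.
The algebraic input is as follows. Partial compositions satisfy the sequential and the parallel
operad axiom; the labels in `Ω` obey the same rules because multiplication is associative. Hence the
signed sum of all `f ∘_i g` is a graded pre-Lie product (`preLie_assoc`), and its commutator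
satisfies the graded Jacobi identity (`gerstenhaber_lof_jacobi`). In this graded Lie algebra `𝔞` is
abelian, the kernel of `P` is a subalgebra containing the subalgebra `𝔏'`, and therefore `P[x, y] =
P[Px, y] + P[x, Py]` (`projA_gerstenhaber`). `DerivedData` collects these facts, and the `L_∞[1]`
identities are derived from them alone.

By additivity and graded symmetry (`jacSum_add`, `jacSum_perm`) the Jacobi identity need only be
checked on factors from `s⁻¹𝔏'` followed by factors from `𝔞`. An operation with exactly one factor
from `s⁻¹𝔏'` lands in `𝔞`, the binary operation on two such factors lands in `s⁻¹𝔏'`, and everything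
else is zero. So a nested term can survive only for three factors, all from `s⁻¹𝔏'`, or for two such
factors and any number from `𝔞`. The former case is the Jacobi identity of `𝔏'`. In the latter,
bracketing with `θ` is a graded derivation, so `[…[[f, g], θ₁]…, θ_n]` expands into signed brackets
`[F, G]`, where `F` and `G` arise from `f` and `g` by distributing the `θ`s. Applying `P` to `[F,
G]` gives `P[PF, G] + P[F, PG]`, which are the nested terms with `f` inside and with `g` inside
(`IsModified.jacSum_two_sub`).

The powers of `lam` match because exponents add: for `f`, `g` of degrees `a`, `b`, with `p` and `q`
of the `θ`s given to them, `(a + 1 - p) + (b + 1 - (q + 1)) = (a + b + 1) - p - q`. For `lam = 0`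
this needs both exponents to be nonnegative. If one is negative, the projected iterated bracket is
already zero by a weight count: give an input from `A` weight `1` and an output in `A` weight `-1`.
A map in `𝔏'(n)` has weight at most `n - 1`, each bracket with `𝔞` lowers the bound by one, and no
nonzero map has weight below `-1` (`iterBr_eq_zero`).

Uniqueness holds because homogeneous elements span and every homogeneous argument list reduces to a
sorted one, where the formulas prescribe the value. For existence, `mixedOp` sums over the entry
that contributes its `𝔏'`-component while the others contribute their `𝔞`-components, with the
Koszul sign for moving that entry to the front. -/

noncomputable section

namespace OmegaRB

set_option linter.unusedSectionVars false

/-! ### Evaluation of cochains on infinite sequences and the operad identities -/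

section Sequences

variable {X : Type*}

/-- The sequence `x` with the entries `x_i, …, x_{i+n}` replaced by the single entry `y`. -/
def substBlock (i n : ℕ) (x : ℕ → X) (y : X) : ℕ → X :=
  fun j => if j < i then x j else if j = i then y else x (j + n)

/-- The sequence `x_i, x_{i+1}, …`. -/
def shiftSeq (i : ℕ) (x : ℕ → X) : ℕ → X := fun j => x (i + j)

/-- The product `x₀ ⋯ x_n` of the first entries of a sequence. -/
def prefixProd [Semigroup X] (n : ℕ) (x : ℕ → X) : X := seqProd n fun j : Fin (n + 1) => x j

theorem prefixProd_zero [Semigroup X] (x : ℕ → X) : prefixProd 0 x = x 0 := rfl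

theorem prefixProd_succ [Semigroup X] (n : ℕ) (x : ℕ → X) :
    prefixProd (n + 1) x = x 0 * prefixProd n (shiftSeq 1 x) := by
  simp only [prefixProd, seqProd, shiftSeq]
  congr 2
  funext j
  simp [Fin.tail, add_comm]

theorem prefixProd_congr [Semigroup X] (n : ℕ) (x y : ℕ → X) (h : ∀ j ≤ n, x j = y j) :
    prefixProd n x = prefixProd n y := by
  unfold prefixProd
  congr 1
  funext j
  exact h _ (by omega)

theorem shiftSeq_zero (x : ℕ → X) : shiftSeq 0 x = x := by funext j; simp [shiftSeq]

theorem shiftSeq_shiftSeq (i j : ℕ) (x : ℕ → X) :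
    shiftSeq j (shiftSeq i x) = shiftSeq (i + j) x := by
  funext t; simp only [shiftSeq]; congr 1; omega

theorem shiftSeq_substBlock_add (i j p : ℕ) (x : ℕ → X) (y : X) :
    shiftSeq i (substBlock (i + j) p x y) = substBlock j p (shiftSeq i x) y := by
  funext t
  simp only [shiftSeq, substBlock]
  split_ifs <;> first | rfl | omega | (congr 1; omega)

theorem shiftSeq_substBlock_of_lt {i j : ℕ} (h : j < i) (p : ℕ) (x : ℕ → X) (y : X) :
    shiftSeq i (substBlock j p x y) = shiftSeq (i + p) x := by
  funext t
  simp only [shiftSeq, substBlock]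
  split_ifs <;> first | rfl | omega | (congr 1; omega)

theorem shiftSeq_substBlock_of_gt {i j : ℕ} (h : j < i) (n p : ℕ) (x : ℕ → X) (y : X) :
    ∀ t ≤ p, shiftSeq j x t = shiftSeq j (substBlock (i + p) n x y) t := by
  intro t ht
  simp only [shiftSeq, substBlock]
  rw [if_pos (by omega)]

theorem substBlock_substBlock_nested {j n : ℕ} (h : j ≤ n) (i p : ℕ) (x : ℕ → X) (y z : X) :
    substBlock i n (substBlock (i + j) p x y) z = substBlock i (n + p) x z := by
  funext t
  simp only [substBlock]
  split_ifs <;> first | rfl | omega | (congr 1; omega)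

theorem substBlock_substBlock_parallel {i j : ℕ} (h : j < i) (n p : ℕ) (x : ℕ → X) (y z : X) :
    substBlock i n (substBlock j p x y) z = substBlock j p (substBlock (i + p) n x z) y := by
  funext t
  simp only [substBlock]
  split_ifs <;> first | rfl | omega | (congr 1; omega)

/-- Associativity of the product of labels: multiplying a sub-block first does not change the total
product. This is the label half of the sequential operad axiom. -/
theorem prefixProd_substBlock [Semigroup X] (n p : ℕ) (j : ℕ) (h : j ≤ n) (x : ℕ → X) :
    prefixProd n (substBlock j p x (prefixProd p (shiftSeq j x))) = prefixProd (n + p) x := by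
  induction n generalizing j x with
  | zero =>
    obtain rfl : j = 0 := by omega
    simp [prefixProd_zero, substBlock, shiftSeq_zero]
  | succ n ih =>
    rw [prefixProd_succ]
    rcases Nat.eq_zero_or_pos j with rfl | hj
    · have e : shiftSeq 1 (substBlock 0 p x (prefixProd p (shiftSeq 0 x))) =
          shiftSeq (1 + p) x := shiftSeq_substBlock_of_lt (by omega) _ _ _
      rw [e]
      simp only [substBlock, lt_irrefl, if_false, if_true, shiftSeq_zero]
      clear e h ih
      induction p generalizing x with
      | zero => rw [prefixProd_zero, add_zero, add_zero, prefixProd_succ]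
      | succ p ih =>
        rw [prefixProd_succ p, mul_assoc]
        have := ih (shiftSeq 1 x)
        rw [shiftSeq_shiftSeq] at this
        rw [show 1 + (p + 1) = 1 + (1 + p) by omega, this,
          show n + 1 + (p + 1) = (n + 1 + p) + 1 by omega, prefixProd_succ (n + 1 + p)]
    · obtain ⟨j, rfl⟩ : ∃ j', j = 1 + j' := ⟨j - 1, by omega⟩
      rw [shiftSeq_substBlock_add, ← shiftSeq_shiftSeq, ih j (by omega),
        show n + 1 + p = (n + p) + 1 by omega, prefixProd_succ (n + p)]
      simp [substBlock]

end Sequences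

/-! ### Values of cochains on sequences and the two operad axioms. -/

section Evaluation

variable {k Ω : Type*} [Field k] {W U : Type*} [AddCommGroup W] [Module k W]
  [AddCommGroup U] [Module k U]

/-- The value of a family of multilinear maps on the first entries of infinite sequences. -/
def evalSeq (n : ℕ) (f : HomOmega k Ω (n + 1) W U) (α : ℕ → Ω) (v : ℕ → W) : U :=
  f (fun i => α i) (fun i => v i)

theorem evalSeq_congr (n : ℕ) (f : HomOmega k Ω (n + 1) W U) {α β : ℕ → Ω} {v w : ℕ → W}
    (h : ∀ j ≤ n, α j = β j) (h' : ∀ j ≤ n, v j = w j) :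
    evalSeq n f α v = evalSeq n f β w := by
  unfold evalSeq
  have e : (fun i : Fin (n + 1) => α i) = fun i : Fin (n + 1) => β i :=
    funext fun i => h _ (by omega)
  have e' : (fun i : Fin (n + 1) => v i) = fun i : Fin (n + 1) => w i :=
    funext fun i => h' _ (by omega)
  rw [e, e']

/-- The last entry is repeated forever; it exists because the length is `n + 1`, so `X` need not be
known to be inhabited. -/
theorem exists_seq_extension {X : Type*} {n : ℕ} (x : Fin (n + 1) → X) :
    ∃ y : ℕ → X, (fun i : Fin (n + 1) => y i) = x :=
  ⟨fun j => x ⟨min j n, by omega⟩, funext fun i => congrArg x (Fin.ext (by simp; omega))⟩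

theorem ext_evalSeq {n : ℕ} {f g : HomOmega k Ω (n + 1) W U}
    (h : ∀ α v, evalSeq n f α v = evalSeq n g α v) : f = g := by
  funext α
  ext v
  obtain ⟨β, rfl⟩ := exists_seq_extension α
  obtain ⟨w, rfl⟩ := exists_seq_extension v
  exact h β w

/-- Composites such as `m + n + p` and `m + (n + p)` index different summands of the direct sum.
Comparing values on infinite sequences replaces transport along the equality of arities. -/
theorem lof_eq_lof {m n : ℕ} (e : m = n) {f : HomOmega k Ω (m + 1) W U}
    {g : HomOmega k Ω (n + 1) W U} (h : ∀ α v, evalSeq m f α v = evalSeq n g α v) :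
    DirectSum.lof k ℕ (fun n => HomOmega k Ω (n + 1) W U) m f =
      DirectSum.lof k ℕ (fun n => HomOmega k Ω (n + 1) W U) n g := by
  subst e
  rw [ext_evalSeq h]

variable [Semigroup Ω]

theorem replaceBlock_comp_val {X : Type*} {m n : ℕ} (i : Fin (m + 1)) (x : ℕ → X) (y : X) :
    replaceBlock i (fun t : Fin (m + n + 1) => x t) y =
      fun j : Fin (m + 1) => substBlock i n x y j := by
  funext j
  simp only [replaceBlock, substBlock, Fin.lt_def, Fin.ext_iff]

theorem evalSeq_circ {m n : ℕ} (i : Fin (m + 1)) (f : HomOmega k Ω (m + 1) W W)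
    (g : HomOmega k Ω (n + 1) W W) (α : ℕ → Ω) (v : ℕ → W) :
    evalSeq (m + n) (circ i f g) α v =
      evalSeq m f (substBlock i n α (prefixProd n (shiftSeq i α)))
        (substBlock i n v (evalSeq n g (shiftSeq i α) (shiftSeq i v))) := by
  simp only [evalSeq, circ, MultilinearMap.coe_mk]
  rw [replaceBlock_comp_val, replaceBlock_comp_val]
  rfl

/-- Sequential operad axiom: `h` is inserted into an input of `f ∘_i g` that belongs to `g`. -/
theorem evalSeq_circ_circ_nested {m n p : ℕ} (i : Fin (m + 1)) (j : Fin (n + 1)) (t : Fin (m + n + 1))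
    (ht : (t : ℕ) = i + j) (f : HomOmega k Ω (m + 1) W W) (g : HomOmega k Ω (n + 1) W W)
    (h : HomOmega k Ω (p + 1) W W) (α : ℕ → Ω) (v : ℕ → W) :
    evalSeq (m + n + p) (circ t (circ i f g) h) α v =
      evalSeq (m + (n + p)) (circ i f (circ j g h)) α v := by
  simp only [evalSeq_circ, ht, shiftSeq_substBlock_add, shiftSeq_shiftSeq]
  rw [substBlock_substBlock_nested (by omega), substBlock_substBlock_nested (by omega),
    ← prefixProd_substBlock n p j (by omega) (shiftSeq i α), shiftSeq_shiftSeq]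

/-- Parallel operad axiom: insertions at two different inputs of `f` commute. Inserting `h` at the
earlier position `j` first moves the later position from `i` to `i + p`. -/
theorem evalSeq_circ_circ_parallel {m n p : ℕ} (i j : Fin (m + 1)) (hij : j < i)
    (j' : Fin (m + n + 1)) (i' : Fin (m + p + 1))
    (hj : (j' : ℕ) = j) (hi : (i' : ℕ) = i + p)
    (f : HomOmega k Ω (m + 1) W W) (g : HomOmega k Ω (n + 1) W W)
    (h : HomOmega k Ω (p + 1) W W) (α : ℕ → Ω) (v : ℕ → W) :
    evalSeq (m + n + p) (circ j' (circ i f g) h) α v =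
      evalSeq (m + p + n) (circ i' (circ j f h) g) α v := by
  have hij' : (j : ℕ) < i := hij
  simp only [evalSeq_circ, hi, hj, shiftSeq_substBlock_of_lt hij']
  rw [substBlock_substBlock_parallel hij', substBlock_substBlock_parallel hij',
    prefixProd_congr p _ _ (shiftSeq_substBlock_of_gt hij' n p α _),
    evalSeq_congr p h (shiftSeq_substBlock_of_gt hij' n p α _)
      (shiftSeq_substBlock_of_gt hij' n p v _)]

end Evaluation

/-! ### The pre-Lie product -/

section PreLie

variable {k Ω : Type*} [Field k] [Semigroup Ω] {W : Type*} [AddCommGroup W] [Module k W]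

/-- The pre-Lie product `∑ᵢ (-1)^{i n} f ∘ᵢ g` of homogeneous cochains. -/
def preLieHom (m n : ℕ) (f : HomOmega k Ω (m + 1) W W) (g : HomOmega k Ω (n + 1) W W) :
    Cochains k Ω W :=
  ∑ i : Fin (m + 1), (-1 : k) ^ ((i : ℕ) * n) •
      DirectSum.lof k ℕ (fun n => HomOmega k Ω (n + 1) W W) (m + n) (circ i f g)

variable (k Ω W) in
/-- The pre-Lie product underlying the `Ω`-Gerstenhaber bracket. -/
def preLie : Cochains k Ω W →ₗ[k] Cochains k Ω W →ₗ[k] Cochains k Ω W :=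
  DirectSum.toModule k ℕ _ fun m => LinearMap.flip <| DirectSum.toModule k ℕ _ fun n =>
    LinearMap.flip <| LinearMap.mk₂ k (preLieHom m n)
      (by
        intro f f' g
        simp only [preLieHom, circ_add_left, map_add, smul_add, Finset.sum_add_distrib])
      (by
        intro c f g
        simp only [preLieHom, circ_smul_left, map_smul, Finset.smul_sum, smul_comm c])
      (by
        intro f g g'
        simp only [preLieHom, circ_add_right, map_add, smul_add, Finset.sum_add_distrib])
      (by
        intro c f g
        simp only [preLieHom, circ_smul_right, map_smul, Finset.smul_sum, smul_comm c])

local notation "ι" => DirectSum.lof k ℕ (fun n => HomOmega k Ω (n + 1) W W)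

theorem preLie_lof (m n : ℕ) (f : HomOmega k Ω (m + 1) W W) (g : HomOmega k Ω (n + 1) W W) :
    preLie k Ω W (ι m f) (ι n g) = preLieHom m n f g := by
  simp only [preLie, DirectSum.toModule_lof, LinearMap.flip_apply]
  rfl

theorem gerstenhaber_lof (m n : ℕ) (f : HomOmega k Ω (m + 1) W W)
    (g : HomOmega k Ω (n + 1) W W) :
    gerstenhaber k Ω W (ι m f) (ι n g) =
      preLie k Ω W (ι m f) (ι n g) - (-1 : k) ^ (m * n) • preLie k Ω W (ι n g) (ι m f) := by
  simp only [gerstenhaber, preLie_lof, DirectSum.toModule_lof, LinearMap.flip_apply,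
    LinearMap.mk₂_apply]
  rfl

/-- The sum over the pairs of disjoint insertions in which the second argument is inserted to the
right of the third one. -/
def insertTwo (m n p : ℕ) (f : HomOmega k Ω (m + 1) W W) (g : HomOmega k Ω (n + 1) W W)
    (h : HomOmega k Ω (p + 1) W W) : Cochains k Ω W :=
  ∑ i : Fin (m + 1), ∑ j : Fin (m + 1), if j < i then
    (-1 : k) ^ ((i : ℕ) * n + j * p) • ι (m + n + p) (circ (⟨j, by omega⟩ : Fin (m + n + 1)) (circ i f g) h)
    else 0

/-- The inputs of `f ∘_i g` are those of `f` to the left of `i`, those of `g`, and those of `f` to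
the right of `i`, the latter shifted by `n`. -/
theorem sum_fin_split {M : Type*} [AddCommMonoid M] (m n : ℕ) (i : Fin (m + 1))
    (F : Fin (m + n + 1) → M) :
    ∑ t, F t = (∑ j : Fin (m + 1), if j < i then F ⟨j, by omega⟩ else 0) +
      (∑ j : Fin (n + 1), F ⟨i + j, by omega⟩) +
      ∑ j : Fin (m + 1), if i < j then F ⟨j + n, by omega⟩ else 0 := by
  have hF : ∀ t : Fin (m + n + 1), F t = (fun s : ℕ => if h : s < m + n + 1 then F ⟨s, h⟩ else 0) t := by
    intro t; simp [t.2]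
  set G : ℕ → M := fun s : ℕ => if h : s < m + n + 1 then F ⟨s, h⟩ else 0 with hG
  have e1 : (∑ j : Fin (m + 1), if j < i then F ⟨j, by omega⟩ else 0) =
      ∑ j ∈ Finset.range i, G j := by
    rw [Finset.sum_congr rfl (fun j _ => by rw [hF ⟨j, by omega⟩])]
    rw [← Finset.sum_filter]
    refine Finset.sum_bij (fun j _ => (j : ℕ)) ?_ ?_ ?_ ?_
    · intro j hj; exact Finset.mem_range.2 (Finset.mem_filter.1 hj).2
    · intro a _ b _ h; exact Fin.ext h
    · intro b hb
      have := Finset.mem_range.1 hb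
      exact ⟨⟨b, by omega⟩, Finset.mem_filter.2 ⟨Finset.mem_univ _, this⟩, rfl⟩
    · intro j _; rfl
  have e2 : (∑ j : Fin (n + 1), F ⟨i + j, by omega⟩) = ∑ j ∈ Finset.range (n + 1), G (i + j) := by
    rw [Finset.sum_range]
    exact Finset.sum_congr rfl (fun j _ => by rw [hF ⟨i + j, by omega⟩])
  have e3 : (∑ j : Fin (m + 1), if i < j then F ⟨j + n, by omega⟩ else 0) =
      ∑ j ∈ Finset.range (m - i), G (i + (n + 1) + j) := by
    rw [Finset.sum_congr rfl (fun j _ => by rw [hF ⟨j + n, by omega⟩])]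
    rw [← Finset.sum_filter]
    refine Finset.sum_bij (fun j _ => (j : ℕ) - i - 1) ?_ ?_ ?_ ?_
    · intro j hj
      have : (i : ℕ) < j := (Finset.mem_filter.1 hj).2
      simp only [Finset.mem_range]; omega
    · intro a ha b hb h
      have h1 : (i : ℕ) < a := (Finset.mem_filter.1 ha).2
      have h2 : (i : ℕ) < b := (Finset.mem_filter.1 hb).2
      exact Fin.ext (by omega)
    · intro b hb
      have := Finset.mem_range.1 hb
      exact ⟨⟨b + i + 1, by omega⟩, Finset.mem_filter.2 ⟨Finset.mem_univ _, by
        rw [Fin.lt_def]; simp only; omega⟩, by simp only; omega⟩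
    · intro j hj
      have : (i : ℕ) < j := (Finset.mem_filter.1 hj).2
      congr 1
      simp only
      omega
  rw [e1, e2, e3, ← Finset.sum_range_add, ← Finset.sum_range_add, Finset.sum_congr rfl (fun t _ => hF t),
    ← Finset.sum_range G]
  congr 2
  omega

/-- The pre-Lie identity. Insertions of `h` into an input of `g` make up `f ∘ (g ∘ h)`; the others
put `g` and `h` into different inputs of `f`. The associator is thus a sum of disjoint insertions,
symmetric in `g` and `h` up to the sign `(-1)^{np}`. -/
theorem preLie_assoc (m n p : ℕ) (f : HomOmega k Ω (m + 1) W W) (g : HomOmega k Ω (n + 1) W W)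
    (h : HomOmega k Ω (p + 1) W W) :
    preLie k Ω W (preLie k Ω W (ι m f) (ι n g)) (ι p h) =
      preLie k Ω W (ι m f) (preLie k Ω W (ι n g) (ι p h)) + insertTwo m n p f g h +
        (-1 : k) ^ (n * p) • insertTwo m p n f h g := by
  have e : preLie k Ω W (preLie k Ω W (ι m f) (ι n g)) (ι p h) =
      ∑ i : Fin (m + 1), ∑ t : Fin (m + n + 1), (-1 : k) ^ ((i : ℕ) * n + t * p) •
        ι (m + n + p) (circ t (circ i f g) h) := by
    rw [preLie_lof, preLieHom]
    simp only [map_sum, map_smul, LinearMap.sum_apply, LinearMap.smul_apply, preLie_lof, preLieHom,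
      Finset.smul_sum, smul_smul, pow_add]
  have e' : preLie k Ω W (ι m f) (preLie k Ω W (ι n g) (ι p h)) =
      ∑ i : Fin (m + 1), ∑ j : Fin (n + 1), (-1 : k) ^ ((i : ℕ) * n + (i + j) * p) •
        ι (m + n + p) (circ (⟨i + j, by omega⟩ : Fin (m + n + 1)) (circ i f g) h) := by
    rw [preLie_lof n p, preLieHom]
    simp only [map_sum, map_smul, preLie_lof, preLieHom, Finset.smul_sum, smul_smul]
    rw [Finset.sum_comm]
    refine Finset.sum_congr rfl fun i _ => Finset.sum_congr rfl fun j _ => ?_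
    rw [← pow_add]
    congr 1
    · congr 1; ring
    · refine lof_eq_lof (by omega) fun α v => ?_
      exact (evalSeq_circ_circ_nested i j _ rfl f g h α v).symm
  -- The insertions with `h` to the right of `g`: by the parallel axiom they are those of
  -- `insertTwo` with the roles of `g` and `h` exchanged.
  have e'' : (-1 : k) ^ (n * p) • insertTwo m p n f h g =
      ∑ i : Fin (m + 1), ∑ j : Fin (m + 1), if i < j then
        (-1 : k) ^ ((i : ℕ) * n + (j + n) * p) •
        ι (m + n + p) (circ (⟨j + n, by omega⟩ : Fin (m + n + 1)) (circ i f g) h) else 0 := by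
    rw [insertTwo, Finset.sum_comm]
    simp only [Finset.smul_sum, smul_ite, smul_zero, smul_smul]
    refine Finset.sum_congr rfl fun i _ => Finset.sum_congr rfl fun j _ => ?_
    split_ifs with hij
    · rw [← pow_add]
      congr 1
      · congr 1; ring
      · refine lof_eq_lof (by omega) fun α v => ?_
        exact evalSeq_circ_circ_parallel j i hij _ _ rfl rfl f h g α v
    · rfl
  rw [e, e', e'', insertTwo, ← Finset.sum_add_distrib, ← Finset.sum_add_distrib]
  refine Finset.sum_congr rfl fun i _ => ?_
  rw [sum_fin_split m n i]
  abel

theorem gerstenhaber_lof_symm (m n : ℕ) (f : HomOmega k Ω (m + 1) W W)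
    (g : HomOmega k Ω (n + 1) W W) :
    gerstenhaber k Ω W (ι m f) (ι n g) =
      -((-1 : k) ^ (m * n) • gerstenhaber k Ω W (ι n g) (ι m f)) := by
  rw [gerstenhaber_lof, gerstenhaber_lof, mul_comm n m]
  rcases neg_one_pow_eq_or k (m * n) with e | e <;> rw [e] <;> module

theorem gerstenhaber_lof_right (m : ℕ) (x : Cochains k Ω W) (n : ℕ) (f : HomOmega k Ω (m + 1) W W)
    (hx : ∃ g, x = ι n g) :
    gerstenhaber k Ω W x (ι m f) =
      preLie k Ω W x (ι m f) - (-1 : k) ^ (n * m) • preLie k Ω W (ι m f) x := by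
  obtain ⟨g, rfl⟩ := hx
  exact gerstenhaber_lof n m g f

theorem preLieHom_mem (m n : ℕ) (f : HomOmega k Ω (m + 1) W W) (g : HomOmega k Ω (n + 1) W W) :
    ∃ h, preLieHom m n f g = ι (m + n) h :=
  ⟨∑ i : Fin (m + 1), (-1 : k) ^ ((i : ℕ) * n) • circ i f g, by simp [preLieHom]⟩

theorem gerstenhaber_lof_mem (m n : ℕ) (f : HomOmega k Ω (m + 1) W W)
    (g : HomOmega k Ω (n + 1) W W) :
    ∃ h, gerstenhaber k Ω W (ι m f) (ι n g) = ι (m + n) h := by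
  obtain ⟨a, ha⟩ := preLieHom_mem m n f g
  obtain ⟨b, hb⟩ := preLieHom_mem n m g f
  rw [gerstenhaber_lof, preLie_lof, preLie_lof, ha, hb]
  have : ∀ q, q = m + n → ∀ b : HomOmega k Ω (q + 1) W W, ∃ c : HomOmega k Ω (m + n + 1) W W,
      ι q b = ι (m + n) c := by
    rintro q rfl b; exact ⟨b, rfl⟩
  obtain ⟨c, hc⟩ := this _ (add_comm n m) b
  exact ⟨a - (-1 : k) ^ (m * n) • c, by rw [hc, map_sub, map_smul]⟩

/-- The commutator of a graded pre-Lie product is a graded Lie bracket. Expanding the brackets and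
using `preLie_assoc` for the six orders of the arguments, the nested compositions and the disjoint
insertions cancel separately. -/
theorem gerstenhaber_lof_jacobi (m n p : ℕ) (f : HomOmega k Ω (m + 1) W W)
    (g : HomOmega k Ω (n + 1) W W) (h : HomOmega k Ω (p + 1) W W) :
    gerstenhaber k Ω W (gerstenhaber k Ω W (ι m f) (ι n g)) (ι p h) =
      gerstenhaber k Ω W (ι m f) (gerstenhaber k Ω W (ι n g) (ι p h)) +
      (-1 : k) ^ (n * p) •
        gerstenhaber k Ω W (gerstenhaber k Ω W (ι m f) (ι p h)) (ι n g) := by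
  rw [gerstenhaber_lof_right p _ (m + n) h (gerstenhaber_lof_mem m n f g),
    gerstenhaber_lof_right n _ (m + p) g (gerstenhaber_lof_mem m p f h)]
  obtain ⟨c, hc⟩ := gerstenhaber_lof_mem n p g h
  rw [hc, gerstenhaber_lof m (n + p), ← hc]
  simp only [gerstenhaber_lof, map_sub, map_smul, LinearMap.sub_apply, LinearMap.smul_apply]
  rw [preLie_assoc m n p f g h, preLie_assoc n m p g f h, preLie_assoc m p n f h g,
    preLie_assoc p m n h f g, preLie_assoc n p m g h f, preLie_assoc p n m h g f]
  -- Every sign becomes a monomial in `(-1)^{mn}`, `(-1)^{mp}` and `(-1)^{np}`, so eight cases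
  -- remain.
  simp only [add_mul, mul_add, pow_add, mul_comm n m, mul_comm p m, mul_comm p n]
  rcases neg_one_pow_eq_or k (m * n) with e | e <;>
  rcases neg_one_pow_eq_or k (m * p) with e' | e' <;>
  rcases neg_one_pow_eq_or k (n * p) with e'' | e'' <;>
  rw [e, e', e''] <;> module

end PreLie

/-! ### Signs -/

section Sign

variable (k : Type*) [Field k]

/-- The sign `(-1)^d` as a scalar. -/
def sg (d : ℤ) : k := ((Int.negOnePow d : ℤˣ) : ℤ)

theorem sg_add (a b : ℤ) : sg k (a + b) = sg k a * sg k b := by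
  simp [sg, Int.negOnePow_add]

theorem sg_even {a : ℤ} (h : Even a) : sg k a = 1 := by
  simp [sg, Int.negOnePow_even a h]

theorem sg_odd {a : ℤ} (h : Odd a) : sg k a = -1 := by
  simp [sg, Int.negOnePow_odd a h]

/-- Most sign comparisons below go through this: the witness supplied there is half the difference
of the two exponents. -/
theorem sg_congr {a b : ℤ} (h : Even (a - b)) : sg k a = sg k b := by
  rw [show a = (a - b) + b by ring, sg_add, sg_even k h, one_mul]

@[simp] theorem sg_zero : sg k 0 = 1 := sg_even k Even.zero

theorem sg_mul_self (a : ℤ) : sg k a * sg k a = 1 := by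
  rw [← sg_add]; exact sg_even k (Even.add_self a)

theorem neg_eq_sg_add_one (a : ℤ) : -sg k a = sg k (a + 1) := by
  rw [sg_add, sg_odd k (a := 1) (by decide)]; ring

theorem sg_natCast (n : ℕ) : sg k n = (-1 : k) ^ n := by
  rcases Nat.even_or_odd n with h | h
  · rw [sg_even k (by exact_mod_cast h), h.neg_one_pow]
  · rw [sg_odd k (by exact_mod_cast h), h.neg_one_pow]

end Sign

/-! ### Graded submodules of direct sums -/

section DirectSumSubmodule

variable {k : Type*} [Field k] {M : ℕ → Type*} [∀ n, AddCommGroup (M n)] [∀ n, Module k (M n)]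

/-- The elements of `⨁ M n` all of whose components lie in the given submodules. -/
def componentwise (S : ∀ n, Submodule k (M n)) : Submodule k (DirectSum ℕ M) where
  carrier := {x | ∀ n, x n ∈ S n}
  zero_mem' := fun n => (S n).zero_mem
  add_mem' := fun hx hy n => (S n).add_mem (hx n) (hy n)
  smul_mem' := fun c _ hx n => (S n).smul_mem c (hx n)

theorem lof_mem_componentwise {S : ∀ n, Submodule k (M n)} {n : ℕ} {f : M n} (hf : f ∈ S n) :
    DirectSum.lof k ℕ M n f ∈ componentwise S := by
  intro j
  rcases eq_or_ne n j with rfl | h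
  · rw [DirectSum.lof_apply]; exact hf
  · rw [DirectSum.lof_eq_of, DirectSum.of_eq_of_ne _ _ _ h.symm]; exact (S j).zero_mem

theorem componentwise_induction {S : ∀ n, Submodule k (M n)} (N : Submodule k (DirectSum ℕ M))
    (h : ∀ n, ∀ f ∈ S n, DirectSum.lof k ℕ M n f ∈ N) : componentwise S ≤ N := by
  classical
  intro x hx
  rw [← DirectSum.sum_support_of x]
  exact N.sum_mem fun n _ => h n _ (hx n)

variable (k M) in
/-- The homogeneous elements of degree `d` of `⨁ M n`. -/
def homogeneous (d : ℤ) : Submodule k (DirectSum ℕ M) where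
  carrier := {x | ∀ n : ℕ, (n : ℤ) ≠ d → x n = 0}
  zero_mem' := fun _ _ => rfl
  add_mem' := fun hx hy n h => by simp [DirectSum.add_apply, hx n h, hy n h]
  smul_mem' := fun c x hx n h => by simp [DirectSum.smul_apply, hx n h]

theorem lof_mem_homogeneous (n : ℕ) (f : M n) : DirectSum.lof k ℕ M n f ∈ homogeneous k M n := by
  intro j h
  rw [DirectSum.lof_eq_of, DirectSum.of_eq_of_ne _ _ _ (fun e => h (by rw [e]))]

theorem mem_homogeneous_iff {d : ℤ} {x : DirectSum ℕ M} (hx : x ∈ homogeneous k M d) :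
    x = 0 ∨ ∃ (n : ℕ) (f : M n), (n : ℤ) = d ∧ x = DirectSum.lof k ℕ M n f := by
  by_cases h : ∃ n : ℕ, (n : ℤ) = d
  · obtain ⟨n, rfl⟩ := h
    refine Or.inr ⟨n, x n, rfl, ?_⟩
    ext j : 1
    rcases eq_or_ne n j with rfl | h
    · rw [DirectSum.lof_apply]
    · rw [DirectSum.lof_eq_of, DirectSum.of_eq_of_ne _ _ _ h.symm]
      exact hx j (fun e => h (by exact_mod_cast e.symm))
  · refine Or.inl ?_
    ext j : 1
    exact hx j (fun e => h ⟨j, e⟩)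

/-- The operator that multiplies the component of degree `n` by `c n`. -/
def scaleSum (c : ℤ → k) : DirectSum ℕ M →ₗ[k] DirectSum ℕ M :=
  DirectSum.lmap fun n => c n • LinearMap.id

theorem scaleSum_apply (c : ℤ → k) (x : DirectSum ℕ M) (n : ℕ) : scaleSum c x n = c n • x n := by
  simp [scaleSum, DirectSum.lmap_apply]

theorem scaleSum_of_mem (c : ℤ → k) {d : ℤ} {x : DirectSum ℕ M} (hx : x ∈ homogeneous k M d) :
    scaleSum c x = c d • x := by
  rcases mem_homogeneous_iff hx with rfl | ⟨n, f, rfl, rfl⟩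
  · simp
  · simp [scaleSum]

end DirectSumSubmodule

/-! ### The graded Lie algebra of cochains -/

section Lie

variable {k Ω : Type*} [Field k] [Semigroup Ω] {W : Type*} [AddCommGroup W] [Module k W]

variable (k Ω W) in
/-- The cochains of degree `d`. -/
abbrev cochainsOfDegree (d : ℤ) : Submodule k (Cochains k Ω W) :=
  homogeneous k (fun n => HomOmega k Ω (n + 1) W W) d

/-- Reduces each closure property of the bracket used below (weights, `𝔏'`, the kernel of `P`,
commutativity of `𝔞`) to single partial compositions in both orders. -/
theorem gerstenhaber_mem_componentwise {S T R : ∀ n, Submodule k (HomOmega k Ω (n + 1) W W)}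
    (h : ∀ m n (i : Fin (m + 1)), ∀ f ∈ S m, ∀ g ∈ T n, circ i f g ∈ R (m + n))
    (h' : ∀ m n (i : Fin (m + 1)), ∀ f ∈ T m, ∀ g ∈ S n, circ i f g ∈ R (m + n))
    {x y : Cochains k Ω W} (hx : x ∈ componentwise S) (hy : y ∈ componentwise T) :
    gerstenhaber k Ω W x y ∈ componentwise R := by
  refine componentwise_induction ((componentwise R).comap
    ((gerstenhaber k Ω W).flip y)) (fun m f hf => ?_) hx
  refine componentwise_induction ((componentwise R).comap
    (gerstenhaber k Ω W (DirectSum.lof k ℕ _ m f))) (fun n g hg => ?_) hy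
  rw [Submodule.mem_comap, gerstenhaber_lof, preLie_lof, preLie_lof, preLieHom, preLieHom]
  refine Submodule.sub_mem _ (Submodule.sum_mem _ fun i _ => ?_)
    (Submodule.smul_mem _ _ (Submodule.sum_mem _ fun i _ => ?_))
  · exact Submodule.smul_mem _ _ (lof_mem_componentwise (h m n i f hf g hg))
  · exact Submodule.smul_mem _ _ (lof_mem_componentwise (h' n m i g hg f hf))

theorem gerstenhaber_mem_homogeneous {p q : ℤ} {x y : Cochains k Ω W}
    (hx : x ∈ cochainsOfDegree k Ω W p) (hy : y ∈ cochainsOfDegree k Ω W q) :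
    gerstenhaber k Ω W x y ∈ cochainsOfDegree k Ω W (p + q) := by
  rcases mem_homogeneous_iff hx with rfl | ⟨m, f, rfl, rfl⟩
  · simp
  rcases mem_homogeneous_iff hy with rfl | ⟨n, g, rfl, rfl⟩
  · simp
  obtain ⟨h, e⟩ := gerstenhaber_lof_mem m n f g
  rw [e, ← Nat.cast_add]
  exact lof_mem_homogeneous (M := fun n => HomOmega k Ω (n + 1) W W) (m + n) h

theorem gerstenhaber_symm {p q : ℤ} {x y : Cochains k Ω W}
    (hx : x ∈ cochainsOfDegree k Ω W p) (hy : y ∈ cochainsOfDegree k Ω W q) :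
    gerstenhaber k Ω W x y = -(sg k (p * q) • gerstenhaber k Ω W y x) := by
  rcases mem_homogeneous_iff hx with rfl | ⟨m, f, rfl, rfl⟩
  · simp
  rcases mem_homogeneous_iff hy with rfl | ⟨n, g, rfl, rfl⟩
  · simp
  rw [← Nat.cast_mul, sg_natCast, gerstenhaber_lof_symm]

theorem gerstenhaber_jacobi {p q r : ℤ} {x y z : Cochains k Ω W}
    (hx : x ∈ cochainsOfDegree k Ω W p) (hy : y ∈ cochainsOfDegree k Ω W q)
    (hz : z ∈ cochainsOfDegree k Ω W r) :
    gerstenhaber k Ω W (gerstenhaber k Ω W x y) z =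
      gerstenhaber k Ω W x (gerstenhaber k Ω W y z) +
        sg k (q * r) • gerstenhaber k Ω W (gerstenhaber k Ω W x z) y := by
  rcases mem_homogeneous_iff hx with rfl | ⟨m, f, rfl, rfl⟩
  · simp
  rcases mem_homogeneous_iff hy with rfl | ⟨n, g, rfl, rfl⟩
  · simp
  rcases mem_homogeneous_iff hz with rfl | ⟨p, h, rfl, rfl⟩
  · simp
  rw [← Nat.cast_mul, sg_natCast, gerstenhaber_lof_jacobi]

end Lie

/-! ### The subspaces `𝔏'` and `𝔞` -/

section Split

variable {k Ω A V : Type*} [Field k] [AddCommGroup A] [Module k A] [AddCommGroup V] [Module k V]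

theorem projA_apply (x : BigL k Ω A V) (n : ℕ) (α : Fin (n + 1) → Ω) (v : Fin (n + 1) → V) :
    projA k Ω A V x n α v = (x n α fun i => (0, v i)).1 := by
  simp only [projA, DirectSum.lmap_apply]
  rfl

theorem inclA_apply (θ : Frak k Ω A V) (n : ℕ) (α : Fin (n + 1) → Ω) (w : Fin (n + 1) → A × V) :
    inclA k Ω A V θ n α w = (θ n α fun i => (w i).2, 0) := by
  simp only [inclA, DirectSum.lmap_apply]
  rfl

theorem projA_inclA (θ : Frak k Ω A V) : projA k Ω A V (inclA k Ω A V θ) = θ := by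
  ext n α v
  rw [projA_apply, inclA_apply]

theorem inclA_mem {d : ℤ} {θ : Frak k Ω A V}
    (h : θ ∈ homogeneous k (fun n => HomOmega k Ω (n + 1) V A) d) :
    inclA k Ω A V θ ∈ cochainsOfDegree k Ω (A × V) d := by
  intro n hn
  funext α
  ext w <;> simp [inclA_apply, h n hn]

theorem projA_mem {d : ℤ} {x : BigL k Ω A V} (h : x ∈ cochainsOfDegree k Ω (A × V) d) :
    projA k Ω A V x ∈ homogeneous k (fun n => HomOmega k Ω (n + 1) V A) d := by
  intro n hn
  funext α
  ext w
  simp [projA_apply, h n hn]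

variable (k Ω A V) in
/-- The families of maps whose restriction to arguments from `V` takes values in `V`. -/
def kerPHom (n : ℕ) : Submodule k (HomOmega k Ω n (A × V) (A × V)) where
  carrier := {f | ∀ (α : Fin n → Ω) (w : Fin n → A × V), (∀ j, (w j).1 = 0) → (f α w).1 = 0}
  zero_mem' := by intro α w; simp
  add_mem' := by intro f g hf hg α w h; simp [hf α w h, hg α w h]
  smul_mem' := by intro c f hf α w h; simp [hf α w h]

theorem projA_eq_zero_iff {x : BigL k Ω A V} :
    projA k Ω A V x = 0 ↔ x ∈ componentwise fun n => kerPHom k Ω A V (n + 1) := by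
  constructor
  · intro h n α w hw
    have e : w = fun i => ((0 : A), (w i).2) := funext fun i => Prod.ext (hw i) rfl
    rw [e, ← projA_apply, h]
    rfl
  · intro h
    ext n α v
    rw [projA_apply]
    exact h n α _ fun _ => rfl

/-- The number of entries of `w` that lie in `A`. -/
def countA {n : ℕ} (w : Fin n → A × V) : ℕ :=
  open Classical in ∑ j, if (w j).2 = 0 then 1 else 0

variable (k Ω A V) in
/-- The families of maps of weight at most `p`, where an input from `A` has weight `1` and an output
in `A` has weight `-1`. -/
def weightHom (p : ℤ) (n : ℕ) : Submodule k (HomOmega k Ω n (A × V) (A × V)) where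
  carrier := {f | ∀ (α : Fin n → Ω) (w : Fin n → A × V),
    (p < countA w → (f α w).2 = 0) ∧ (p + 1 < countA w → (f α w).1 = 0)}
  zero_mem' := by intro α w; simp
  add_mem' := by
    intro f g hf hg α w
    refine ⟨fun h => ?_, fun h => ?_⟩
    · simp [(hf α w).1 h, (hg α w).1 h]
    · simp [(hf α w).2 h, (hg α w).2 h]
  smul_mem' := by
    intro c f hf α w
    refine ⟨fun h => ?_, fun h => ?_⟩
    · simp [(hf α w).1 h]
    · simp [(hf α w).2 h]

-- The inputs of the outer and inner map together are the original inputs and the inserted value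
-- `y`, which counts once if it lies in `A`.
open Classical in
theorem countA_replaceBlock {m n : ℕ} (i : Fin (m + 1)) (w : Fin (m + n + 1) → A × V) (y : A × V) :
    countA (replaceBlock i w y) + countA (block i w) = countA w + if y.2 = 0 then 1 else 0 := by
  have e : ∀ j : Fin (m + 1), (if (replaceBlock i w y j).2 = 0 then 1 else 0) =
      (if j < i then (if (w ⟨j, by omega⟩).2 = 0 then 1 else 0) else 0) +
      (if j = i then (if y.2 = 0 then 1 else 0) else 0) +
      (if i < j then (if (w ⟨j + n, by omega⟩).2 = 0 then 1 else 0) else 0) := by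
    intro j
    simp only [replaceBlock]
    rcases lt_trichotomy j i with h | h | h
    · simp only [h, if_true, h.ne, h.not_gt, if_false, add_zero]
    · subst h; simp
    · simp only [h, if_true, h.ne', h.not_gt, if_false, zero_add]
  have e1 : countA (replaceBlock i w y) = ∑ j, (if (replaceBlock i w y j).2 = 0 then 1 else 0) := rfl
  have e2 : countA w = ∑ j, if (w j).2 = 0 then 1 else 0 := rfl
  have e3 : countA (block i w) =
    ∑ j : Fin (n + 1), if (w ⟨i + j, by omega⟩).2 = 0 then 1 else 0 := rfl
  rw [e1, e2, e3, Finset.sum_congr rfl fun j _ => e j, Finset.sum_add_distrib,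
    Finset.sum_add_distrib, sum_fin_split m n i, Finset.sum_ite_eq' Finset.univ i,
    if_pos (Finset.mem_univ i)]
  omega

variable [Semigroup Ω]

theorem circ_apply {m n : ℕ} (i : Fin (m + 1)) (f : HomOmega k Ω (m + 1) (A × V) (A × V))
    (g : HomOmega k Ω (n + 1) (A × V) (A × V)) (α : Fin (m + n + 1) → Ω)
    (w : Fin (m + n + 1) → A × V) :
    circ i f g α w = f (replaceBlock i α (seqProd n (block i α)))
        (replaceBlock i w (g (block i α) (block i w))) := rfl

/-- Weights add under composition: when `g` has its output in `A`, the weight `-1` of that output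
cancels the weight `1` of the input of `f` which it fills. -/
theorem circ_mem_weightHom {p q : ℤ} {m n : ℕ} (i : Fin (m + 1))
    {f : HomOmega k Ω (m + 1) (A × V) (A × V)} {g : HomOmega k Ω (n + 1) (A × V) (A × V)}
    (hf : f ∈ weightHom k Ω A V p (m + 1)) (hg : g ∈ weightHom k Ω A V q (n + 1)) :
    circ i f g ∈ weightHom k Ω A V (p + q) (m + n + 1) := by
  classical
  intro α w
  rw [circ_apply]
  set y := g (block i α) (block i w) with hy
  have hc := countA_replaceBlock i w y
  have hg' := hg (block i α) (block i w)
  rw [← hy] at hg'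
  have hf' := hf (replaceBlock i α (seqProd n (block i α))) (replaceBlock i w y)
  -- The zero vector counts as an entry from `A` but gives no bound on the inputs of `g`. It is
  -- treated apart, where `f` vanishes by multilinearity.
  by_cases h0 : y = 0
  · have : f (replaceBlock i α (seqProd n (block i α))) (replaceBlock i w y) = 0 := by
      refine MultilinearMap.map_coord_zero _ i ?_
      simp [replaceBlock, h0]
    rw [this]; simp
  · by_cases h2 : y.2 = 0
    · rw [if_pos h2] at hc
      have h1 : ¬ (q + 1 < countA (block i w)) := fun h => h0 (Prod.ext (hg'.2 h) h2)
      exact ⟨fun h => hf'.1 (by omega), fun h => hf'.2 (by omega)⟩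
    · rw [if_neg h2] at hc
      have h1 : ¬ (q < countA (block i w)) := fun h => h2 (hg'.1 h)
      exact ⟨fun h => hf'.1 (by omega), fun h => hf'.2 (by omega)⟩

theorem countA_le {n : ℕ} (w : Fin n → A × V) : countA w ≤ n := by
  classical
  unfold countA
  calc _ ≤ ∑ _j : Fin n, 1 := Finset.sum_le_sum fun j _ => by split_ifs <;> omega
    _ = n := by simp

theorem forall_of_countA {n : ℕ} (w : Fin n → A × V) (h : n ≤ countA w) : ∀ j, (w j).2 = 0 := by
  classical
  intro j
  by_contra hj
  have : countA w < ∑ _j : Fin n, 1 := by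
    unfold countA
    refine Finset.sum_lt_sum (fun j _ => by split_ifs <;> omega) ⟨j, Finset.mem_univ j, ?_⟩
    rw [if_neg hj]; omega
  simp at this
  omega

theorem exists_of_countA {n : ℕ} (w : Fin n → A × V) (h : 0 < countA w) : ∃ j, (w j).2 = 0 := by
  classical
  by_contra hj
  push Not at hj
  simp [countA, hj] at h

theorem inclA_mem_weight (θ : Frak k Ω A V) :
    inclA k Ω A V θ ∈ componentwise fun n => weightHom k Ω A V (-1) (n + 1) := by
  intro n α w
  rw [inclA_apply]
  refine ⟨fun _ => rfl, fun h => ?_⟩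
  obtain ⟨j, hj⟩ := exists_of_countA w (by omega)
  exact MultilinearMap.map_coord_zero _ j hj

/-- A map with `m + 1` inputs has at most `m + 1` of them in `A`, which bounds the `A`-valued part
by weight `m`; the `V`-valued part vanishes when all inputs are in `A`, so it also has weight at
most `m`. -/
theorem LPrime_mem_weight {m : ℤ} {f : BigL k Ω A V} (hf : f ∈ LPrime k Ω A V)
    (hm : f ∈ cochainsOfDegree k Ω (A × V) m) :
    f ∈ componentwise fun n => weightHom k Ω A V m (n + 1) := by
  intro n
  by_cases hn : (n : ℤ) = m
  · intro α w
    refine ⟨fun h => (hf n α w).2 (forall_of_countA w (by omega)), fun h => ?_⟩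
    have := countA_le w
    omega
  · rw [hm n hn]
    exact Submodule.zero_mem _

theorem eq_zero_of_weight {p : ℤ} (hp : p + 1 < 0) {x : BigL k Ω A V}
    (hx : x ∈ componentwise fun n => weightHom k Ω A V p (n + 1)) : x = 0 := by
  ext n : 1
  funext α
  refine MultilinearMap.ext fun w => Prod.ext ?_ ?_
  · exact (hx n α w).2 (by omega)
  · exact (hx n α w).1 (by omega)

/-- Iterated brackets with elements of `𝔞`. -/
def iterBr (f : BigL k Ω A V) (ts : List (Frak k Ω A V)) : BigL k Ω A V :=
  ts.foldl (fun x t => gerstenhaber k Ω (A × V) x (inclA k Ω A V t)) f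

theorem iterBr_mem_weight {p : ℤ} {f : BigL k Ω A V} (ts : List (Frak k Ω A V))
    (hf : f ∈ componentwise fun n => weightHom k Ω A V p (n + 1)) :
    iterBr f ts ∈ componentwise fun n => weightHom k Ω A V (p - ts.length) (n + 1) := by
  induction ts generalizing f p with
  | nil => simpa [iterBr] using hf
  | cons t ts ih =>
    have := ih (p := p + -1) (f := gerstenhaber k Ω (A × V) f (inclA k Ω A V t))
      (gerstenhaber_mem_componentwise (fun m n i f hf g hg => circ_mem_weightHom i hf hg)
        (fun m n i f hf g hg => by rw [add_comm p]; exact circ_mem_weightHom i hf hg) hf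
        (inclA_mem_weight t))
    rw [show p + -1 - (ts.length : ℤ) = p - (t :: ts).length by simp; ring] at this
    exact this

/-- Elements of `𝔞` have weight `-1`, so the bound `m` for `f` drops to `m - ts.length`, which is
below `-1`. Even the smallest weight, that of a map without inputs from `A` and with output in `A`,
is excluded. -/
theorem iterBr_eq_zero {m : ℤ} {f : BigL k Ω A V} (hf : f ∈ LPrime k Ω A V)
    (hm : f ∈ cochainsOfDegree k Ω (A × V) m) (ts : List (Frak k Ω A V))
    (h : m + 1 < ts.length) : iterBr f ts = 0 :=
  eq_zero_of_weight (p := m - ts.length) (by omega) (iterBr_mem_weight ts (LPrime_mem_weight hf hm))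

theorem projA_LPrime {f : BigL k Ω A V} (hf : f ∈ LPrime k Ω A V) : projA k Ω A V f = 0 :=
  projA_eq_zero_iff.2 fun n α w hw => (hf n α w).1 ⟨0, hw 0⟩

/-- If an input in `V` belongs to `g`, then `g` has its value in `V`, so `f` receives an input from
`V` in any case. If all inputs lie in `A`, then so does the value of `g`. -/
theorem circ_mem_LPrimeHom {m n : ℕ} (i : Fin (m + 1))
    {f : HomOmega k Ω (m + 1) (A × V) (A × V)} {g : HomOmega k Ω (n + 1) (A × V) (A × V)}
    (hf : f ∈ LPrimeHom k Ω A V (m + 1)) (hg : g ∈ LPrimeHom k Ω A V (n + 1)) :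
    circ i f g ∈ LPrimeHom k Ω A V (m + n + 1) := by
  intro α w
  rw [circ_apply]
  have hg' := hg (block i α) (block i w)
  have hf' := hf (replaceBlock i α (seqProd n (block i α)))
    (replaceBlock i w (g (block i α) (block i w)))
  refine ⟨?_, ?_⟩
  · rintro ⟨p, hp⟩
    refine hf'.1 ?_
    rcases update_cases i p with ⟨q, hq⟩ | ⟨-, q, hq⟩
    · refine ⟨i, ?_⟩
      have e : block i w q = w p := congrArg w (Fin.ext hq.symm)
      simp only [replaceBlock, lt_irrefl, if_false, if_true]
      exact hg'.1 ⟨q, by rw [e]; exact hp⟩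
    · refine ⟨q, ?_⟩
      rcases hq with ⟨h, h1⟩ | ⟨h, h1⟩
      · have e : (⟨(q : ℕ), by omega⟩ : Fin (m + n + 1)) = p := Fin.ext h.symm
        simp [replaceBlock, h1, e, hp]
      · have e : (⟨(q : ℕ) + n, by omega⟩ : Fin (m + n + 1)) = p := Fin.ext h.symm
        simp [replaceBlock, h1.not_gt, h1.ne', e, hp]
  · intro h
    refine hf'.2 fun j => ?_
    simp only [replaceBlock]
    split_ifs
    · exact h _
    · exact hg'.2 fun j => h _
    · exact h _

theorem gerstenhaber_mem_LPrime {f g : BigL k Ω A V} (hf : f ∈ LPrime k Ω A V)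
    (hg : g ∈ LPrime k Ω A V) : gerstenhaber k Ω (A × V) f g ∈ LPrime k Ω A V :=
  gerstenhaber_mem_componentwise (S := fun n => LPrimeHom k Ω A V (n + 1))
    (T := fun n => LPrimeHom k Ω A V (n + 1)) (R := fun n => LPrimeHom k Ω A V (n + 1))
    (fun _ _ i _ hf _ hg => circ_mem_LPrimeHom i hf hg)
    (fun _ _ i _ hf _ hg => circ_mem_LPrimeHom i hf hg) hf hg

theorem circ_mem_kerPHom {m n : ℕ} (i : Fin (m + 1))
    {f : HomOmega k Ω (m + 1) (A × V) (A × V)} {g : HomOmega k Ω (n + 1) (A × V) (A × V)}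
    (hf : f ∈ kerPHom k Ω A V (m + 1)) (hg : g ∈ kerPHom k Ω A V (n + 1)) :
    circ i f g ∈ kerPHom k Ω A V (m + n + 1) := by
  intro α w h
  rw [circ_apply]
  refine hf _ _ fun j => ?_
  simp only [replaceBlock]
  split_ifs
  · exact h _
  · exact hg _ _ fun j => h _
  · exact h _

/-- Maps that send arguments from `V` into `V` are closed under composition. -/
theorem projA_gerstenhaber_of_projA_eq_zero {x y : BigL k Ω A V} (hx : projA k Ω A V x = 0)
    (hy : projA k Ω A V y = 0) : projA k Ω A V (gerstenhaber k Ω (A × V) x y) = 0 := by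
  rw [projA_eq_zero_iff] at *
  exact gerstenhaber_mem_componentwise
    (fun _ _ i _ hf _ hg => circ_mem_kerPHom i hf hg)
    (fun _ _ i _ hf _ hg => circ_mem_kerPHom i hf hg) hx hy

variable (k Ω A V) in
/-- The families of maps that vanish if an argument lies in `A` and take values in `A`. -/
def fromVtoA (n : ℕ) : Submodule k (HomOmega k Ω n (A × V) (A × V)) where
  carrier := {f | ∀ (α : Fin n → Ω) (w : Fin n → A × V),
    (f α w).2 = 0 ∧ ((∃ j, (w j).2 = 0) → f α w = 0)}
  zero_mem' := by intro α w; simp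
  add_mem' := by
    intro f g hf hg α w
    refine ⟨?_, fun h => ?_⟩
    · simp [(hf α w).1, (hg α w).1]
    · simp [(hf α w).2 h, (hg α w).2 h]
  smul_mem' := by
    intro c f hf α w
    refine ⟨?_, fun h => ?_⟩
    · simp [(hf α w).1]
    · simp [(hf α w).2 h]

/-- Elements of `𝔞` take values in `A` and vanish on every argument from `A`, so every composite of
two of them is zero. -/
theorem gerstenhaber_inclA_inclA (s t : Frak k Ω A V) :
    gerstenhaber k Ω (A × V) (inclA k Ω A V s) (inclA k Ω A V t) = 0 := by
  have hi : ∀ t, inclA k Ω A V t ∈ componentwise fun n => fromVtoA k Ω A V (n + 1) := by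
    intro t n α w
    rw [inclA_apply]
    refine ⟨rfl, ?_⟩
    rintro ⟨j, hj⟩
    exact Prod.ext (MultilinearMap.map_coord_zero _ j hj) rfl
  have hc : ∀ m n (i : Fin (m + 1)), ∀ f ∈ fromVtoA k Ω A V (m + 1),
      ∀ g ∈ fromVtoA k Ω A V (n + 1),
      circ i f g ∈ (⊥ : Submodule k (HomOmega k Ω (m + n + 1) (A × V) (A × V))) := by
    intro m n i f hf g hg
    rw [Submodule.mem_bot]
    funext α
    refine MultilinearMap.ext fun w => ?_
    rw [circ_apply]
    refine (hf _ _).2 ⟨i, ?_⟩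
    simp only [replaceBlock, lt_irrefl, if_false, if_true]
    exact (hg _ _).1
  have := gerstenhaber_mem_componentwise (R := fun _ => ⊥) hc hc (hi s) (hi t)
  ext n : 1
  exact this n

/-- Both `x - Px` and `y - Py` lie in the kernel of `P`, a subalgebra. Expanding the bracket of
these two, the term `[Px, Py]` drops out because `𝔞` is abelian. -/
theorem projA_gerstenhaber (x y : BigL k Ω A V) :
    projA k Ω A V (gerstenhaber k Ω (A × V) x y) =
      projA k Ω A V (gerstenhaber k Ω (A × V) (inclA k Ω A V (projA k Ω A V x)) y) +
      projA k Ω A V (gerstenhaber k Ω (A × V) x (inclA k Ω A V (projA k Ω A V y))) := by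
  have h := projA_gerstenhaber_of_projA_eq_zero
    (x := x - inclA k Ω A V (projA k Ω A V x)) (y := y - inclA k Ω A V (projA k Ω A V y))
    (by rw [map_sub, projA_inclA, sub_self]) (by rw [map_sub, projA_inclA, sub_self])
  simp only [map_sub, LinearMap.sub_apply, gerstenhaber_inclA_inclA, sub_zero] at h
  rw [← sub_eq_zero, ← h]
  abel

end Split

/-! ### Koszul signs -/

section Koszul

theorem prod_prod_eq_prod_lt {n : ℕ} {M : Type*} [CommMonoid M] (F : Fin n → Fin n → M)
    (h : ∀ a, F a a = 1) :
    ∏ a, ∏ b, F a b = ∏ a, ∏ b, if a < b then F a b * F b a else 1 := by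
  have e : ∀ a b, F a b = (if a < b then F a b else 1) * (if b < a then F a b else 1) := by
    intro a b
    rcases lt_trichotomy a b with hab | rfl | hab
    · rw [if_pos hab, if_neg hab.not_gt, mul_one]
    · simp [h]
    · rw [if_neg hab.not_gt, if_pos hab, one_mul]
  have e' : ∀ a b, (if a < b then F a b * F b a else 1) =
      (if a < b then F a b else 1) * (if a < b then F b a else 1) := by
    intro a b; split_ifs <;> simp
  calc ∏ a, ∏ b, F a b
      = (∏ a, ∏ b, if a < b then F a b else 1) * ∏ a, ∏ b, if b < a then F a b else 1 := by
        simp only [← Finset.prod_mul_distrib, ← e]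
    _ = (∏ a, ∏ b, if a < b then F a b else 1) * ∏ a, ∏ b, if a < b then F b a else 1 := by
        rw [Finset.prod_comm (f := fun a b => if b < a then F a b else 1)]
    _ = _ := by simp only [← Finset.prod_mul_distrib, ← e']

/-- Inversions are indexed by the elements exchanged instead of by positions; in this form the signs
of `σ` and `σ * τ` can be compared pair by pair. -/
theorem koszulSign_eq {n : ℕ} (σ : Equiv.Perm (Fin n)) (d : Fin n → ℤ) :
    koszulSign σ d = ∏ a : Fin n, ∏ b : Fin n,
      if a < b ∧ σ.symm b < σ.symm a then Int.negOnePow (d a * d b) else 1 := by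
  rw [koszulSign, Finset.prod_comm]
  rw [← Equiv.prod_comp σ (fun a => ∏ b : Fin n,
    if a < b ∧ σ.symm b < σ.symm a then Int.negOnePow (d a * d b) else 1)]
  refine Finset.prod_congr rfl fun j _ => ?_
  rw [← Equiv.prod_comp σ (fun b => if σ j < b ∧ σ.symm b < σ.symm (σ j)
    then Int.negOnePow (d (σ j) * d b) else 1)]
  refine Finset.prod_congr rfl fun i _ => ?_
  simp only [Equiv.symm_apply_apply, and_comm, mul_comm]

/-- Cocycle property. A pair is inverted by the composite exactly when one of the two steps, but not
both, inverts it, and signs square to one. -/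
theorem koszulSign_mul {n : ℕ} (σ τ : Equiv.Perm (Fin n)) (d : Fin n → ℤ) :
    koszulSign (σ * τ) d = koszulSign σ d * koszulSign τ (fun i => d (σ i)) := by
  have e : koszulSign τ (fun i => d (σ i)) = ∏ a : Fin n, ∏ b : Fin n,
      if σ.symm a < σ.symm b ∧ τ.symm (σ.symm b) < τ.symm (σ.symm a) then Int.negOnePow (d a * d b) else 1 := by
    rw [koszulSign_eq]
    rw [← Equiv.prod_comp σ (fun a => ∏ b : Fin n,
      if σ.symm a < σ.symm b ∧ τ.symm (σ.symm b) < τ.symm (σ.symm a) then Int.negOnePow (d a * d b) else 1)]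
    refine Finset.prod_congr rfl fun j _ => ?_
    rw [← Equiv.prod_comp σ (fun b => if σ.symm (σ j) < σ.symm b ∧ τ.symm (σ.symm b) < τ.symm (σ.symm (σ j))
      then Int.negOnePow (d (σ j) * d b) else 1)]
    simp only [Equiv.symm_apply_apply]
  rw [e, prod_prod_eq_prod_lt _ (fun a => by simp), koszulSign_eq, koszulSign_eq,
    ← Finset.prod_mul_distrib]
  refine Finset.prod_congr rfl fun a _ => ?_
  rw [← Finset.prod_mul_distrib]
  refine Finset.prod_congr rfl fun b _ => ?_
  by_cases hab : a < b
  · have h1 : σ.symm a ≠ σ.symm b := fun h => hab.ne (σ.symm.injective h)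
    have h2 : τ.symm (σ.symm a) ≠ τ.symm (σ.symm b) := fun h => h1 (τ.symm.injective h)
    have h3 : d b * d a = d a * d b := mul_comm _ _
    have h4 : ∀ c, (σ * τ).symm c = τ.symm (σ.symm c) := fun _ => rfl
    simp only [hab, true_and, if_true, h4, h3]
    rcases lt_or_gt_of_ne h1 with h1 | h1 <;> rcases lt_or_gt_of_ne h2 with h2 | h2 <;>
      simp [h1, h2, h1.not_gt, h2.not_gt, Int.units_mul_self]
  · simp [hab]

theorem koszulSign_one {n : ℕ} (d : Fin n → ℤ) : koszulSign 1 d = 1 := by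
  refine Finset.prod_eq_one fun i _ => Finset.prod_eq_one fun j _ => ?_
  rw [if_neg]
  rintro ⟨h, h'⟩
  exact h.not_gt h'

theorem swap_lt_swap_iff {n : ℕ} (i : Fin n) (a b : Fin (n + 1)) :
    (a < b ∧ Equiv.swap i.castSucc i.succ b < Equiv.swap i.castSucc i.succ a) ↔
      a = i.castSucc ∧ b = i.succ := by
  constructor
  · rintro ⟨h, h'⟩
    simp only [Equiv.swap_apply_def] at h'
    simp only [Fin.ext_iff, Fin.lt_def] at *
    split_ifs at h' <;> simp_all <;> omega
  · rintro ⟨rfl, rfl⟩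
    simp

theorem koszulSign_swap {n : ℕ} (i : Fin n) (d : Fin (n + 1) → ℤ) :
    koszulSign (Equiv.swap i.castSucc i.succ) d =
      Int.negOnePow (d i.castSucc * d i.succ) := by
  simp only [koszulSign, swap_lt_swap_iff]
  rw [Finset.prod_eq_single i.castSucc, Finset.prod_eq_single i.succ]
  · simp [mul_comm]
  · intro b _ hb; simp [hb]
  · simp
  · intro b _ hb; simp [hb]
  · simp

end Koszul

/-! ### Graded symmetry from adjacent transpositions, and operations on lists. -/

section GradedSymm

variable {k : Type*} [Field k] {E : Type*} [AddCommGroup E] [Module k E]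

/-- Adjacent transpositions generate the symmetric group and the Koszul sign is a cocycle, so it
suffices to test them; each inverts a single pair. -/
theorem gradedSymmetric_iff_swap {𝒢 : ℤ → Submodule k E} {l : Brackets k E} :
    GradedSymmetric 𝒢 l ↔ ∀ (n : ℕ) (d : Fin (n + 1) → ℤ) (x : Fin (n + 1) → E),
      (∀ i, x i ∈ 𝒢 (d i)) → ∀ i : Fin n,
      l n (fun j => x (Equiv.swap i.castSucc i.succ j)) =
        Int.negOnePow (d i.castSucc * d i.succ) • l n x := by
  constructor
  · intro h n d x hx i
    rw [h n d x hx, koszulSign_swap]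
  · intro h n d x hx σ
    have hσ : σ ∈ Submonoid.closure (Set.range fun i : Fin n => Equiv.swap i.castSucc i.succ) := by
      rw [Equiv.Perm.mclosure_swap_castSucc_succ]; trivial
    induction hσ using Submonoid.closure_induction generalizing d x with
    | mem σ hσ =>
      obtain ⟨i, rfl⟩ := hσ
      rw [h n d x hx, koszulSign_swap]
    | one => simp [koszulSign_one]
    | mul σ τ _ _ hσ hτ =>
      rw [koszulSign_mul, mul_comm, mul_smul, ← hσ d x hx,
        ← hτ (fun i => d (σ i)) (fun i => x (σ i)) fun i => hx _]
      rfl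

/-! ### Operations on lists -/

/-- The operations `l_n` as a single operation on lists. -/
def listOp (l : Brackets k E) : List E → E
  | [] => 0
  | x :: t => l t.length fun i => (x :: t).get i

@[simp] theorem listOp_nil (l : Brackets k E) : listOp l [] = 0 := rfl

theorem listOp_eq (l : Brackets k E) {n : ℕ} (L : List E) (h : L.length = n + 1) :
    listOp l L = l n fun i => L.get (i.cast h.symm) := by
  cases L with
  | nil => simp at h
  | cons x t =>
    obtain rfl : t.length = n := by simpa using h
    rfl

theorem listOp_ofFn (l : Brackets k E) {n : ℕ} (x : Fin (n + 1) → E) :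
    listOp l (List.ofFn x) = l n x := by
  rw [listOp_eq l _ (List.length_ofFn (f := x))]
  congr 1
  funext i
  rw [List.get_eq_getElem, List.getElem_ofFn]
  rfl

theorem ofFn_update {X : Type*} {n : ℕ} (y : Fin n → X) (L₁ L₂ : List X) (a b : X) (i : Fin n)
    (hi : (i : ℕ) = L₁.length) (h : L₁ ++ a :: L₂ = List.ofFn y) :
    L₁ ++ b :: L₂ = List.ofFn (Function.update y i b) := by
  have hl : (L₁ ++ a :: L₂).length = n := by rw [h, List.length_ofFn]
  refine List.ext_getElem (by rw [List.length_ofFn, ← hl]; simp) fun j h1 h2 => ?_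
  have hy : ∀ t (ht : t < n), (L₁ ++ a :: L₂)[t]'(by omega) = y ⟨t, ht⟩ := by
    intro t ht
    simp only [h, List.getElem_ofFn]
  have hj : j < n := by simpa using h2
  rw [List.getElem_ofFn]
  by_cases e : j = i
  · have e' : (⟨j, hj⟩ : Fin n) = i := Fin.ext e
    rw [e', Function.update_self]
    simp [e, hi]
  · have e' : (⟨j, hj⟩ : Fin n) ≠ i := fun e' => e (congrArg Fin.val e')
    rw [Function.update_of_ne e', ← hy j hj, List.getElem_append, List.getElem_append]
    split_ifs with hlt
    · rfl
    · rw [List.getElem_cons, List.getElem_cons, dif_neg (by omega), dif_neg (by omega)]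

/-- A list with one varying entry is an updated finite sequence, which transfers multilinearity to
`listOp`. -/
theorem exists_update {X : Type*} (L₁ L₂ : List X) (a : X) :
    ∃ (n : ℕ) (y : Fin (n + 1) → X) (i : Fin (n + 1)),
      ∀ b, L₁ ++ b :: L₂ = List.ofFn (Function.update y i b) := by
  have hl : (L₁ ++ a :: L₂).length = (L₁.length + L₂.length) + 1 := by
    simp; omega
  refine ⟨L₁.length + L₂.length, fun i => (L₁ ++ a :: L₂).get (i.cast hl.symm),
    ⟨L₁.length, by omega⟩, fun b => ofFn_update _ L₁ L₂ a b _ rfl ?_⟩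
  refine List.ext_getElem (by rw [List.length_ofFn, hl]) fun j h1 h2 => ?_
  rw [List.getElem_ofFn]
  rfl

theorem listOp_add (l : Brackets k E) (L₁ L₂ : List E) (a b : E) :
    listOp l (L₁ ++ (a + b) :: L₂) = listOp l (L₁ ++ a :: L₂) + listOp l (L₁ ++ b :: L₂) := by
  obtain ⟨n, y, i, h⟩ := exists_update L₁ L₂ a
  simp only [h, listOp_ofFn, MultilinearMap.map_update_add]

theorem listOp_smul (l : Brackets k E) (L₁ L₂ : List E) (c : k) (a : E) :
    listOp l (L₁ ++ (c • a) :: L₂) = c • listOp l (L₁ ++ a :: L₂) := by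
  obtain ⟨n, y, i, h⟩ := exists_update L₁ L₂ a
  simp only [h, listOp_ofFn, MultilinearMap.map_update_smul]

theorem listOp_zero (l : Brackets k E) (L₁ L₂ : List E) : listOp l (L₁ ++ 0 :: L₂) = 0 := by
  have := listOp_smul l L₁ L₂ 0 0
  rwa [zero_smul, zero_smul] at this

theorem listOp_cons_add (l : Brackets k E) (L : List E) (a b : E) :
    listOp l ((a + b) :: L) = listOp l (a :: L) + listOp l (b :: L) := listOp_add l [] L a b

theorem listOp_cons_smul (l : Brackets k E) (L : List E) (c : k) (a : E) :
    listOp l ((c • a) :: L) = c • listOp l (a :: L) := listOp_smul l [] L c a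

theorem listOp_cons_zero (l : Brackets k E) (L : List E) : listOp l (0 :: L) = 0 :=
  listOp_zero l [] L

/-- A list of elements of the given degrees. -/
def HomogeneousList (𝒢 : ℤ → Submodule k E) (L : List (ℤ × E)) : Prop := ∀ a ∈ L, a.2 ∈ 𝒢 a.1

theorem units_smul_eq (u : ℤˣ) (x : E) : u • x = (((u : ℤ) : k)) • x := by
  rw [Units.smul_def, Int.cast_smul_eq_zsmul]

theorem listOp_swap {𝒢 : ℤ → Submodule k E} {l : Brackets k E} (h : GradedSymmetric 𝒢 l)
    (L₁ L₂ : List (ℤ × E)) (a b : ℤ × E) (hL : HomogeneousList 𝒢 (L₁ ++ a :: b :: L₂)) :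
    listOp l ((L₁ ++ a :: b :: L₂).map Prod.snd) =
      sg k (a.1 * b.1) • listOp l ((L₁ ++ b :: a :: L₂).map Prod.snd) := by
  rw [gradedSymmetric_iff_swap] at h
  set n := L₁.length + L₂.length + 1 with hn
  have hl : (L₁ ++ b :: a :: L₂).length = n + 1 := by simp; omega
  have hl' : (L₁ ++ a :: b :: L₂).length = n + 1 := by simp; omega
  set z : Fin (n + 1) → ℤ × E := fun i => (L₁ ++ b :: a :: L₂).get (i.cast hl.symm) with hz
  set i : Fin n := ⟨L₁.length, by omega⟩ with hi
  have e1 : L₁ ++ b :: a :: L₂ = List.ofFn z :=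
    List.ext_getElem (by rw [List.length_ofFn, hl]) fun j h1 h2 => by
      rw [List.getElem_ofFn]; rfl
  have e2 : L₁ ++ a :: b :: L₂ = List.ofFn fun j => z (Equiv.swap i.castSucc i.succ j) := by
    refine List.ext_getElem (by rw [List.length_ofFn, hl']) fun j h1 h2 => ?_
    have hj : j < n + 1 := by simpa using h2
    rw [List.getElem_ofFn, Equiv.swap_apply_def]
    simp only [hz, List.get_eq_getElem, Fin.ext_iff, hi, Fin.val_castSucc, Fin.val_succ]
    split_ifs with h3 h4
    · subst h3; simp
    · subst h4; simp
    · simp only [Fin.val_cast]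
      rw [List.getElem_append, List.getElem_append]
      split_ifs with h5
      · rfl
      · simp only [List.getElem_cons]
        rw [dif_neg (by omega), dif_neg (by omega), dif_neg (by omega), dif_neg (by omega)]
  have hm : ∀ j, (z j).2 ∈ 𝒢 (z j).1 := by
    intro j
    apply hL
    have : z j ∈ L₁ ++ b :: a :: L₂ := by rw [e1]; exact (List.mem_ofFn' z _).2 ⟨j, rfl⟩
    simp only [List.mem_append, List.mem_cons] at this ⊢
    tauto
  have := h n (fun j => (z j).1) (fun j => (z j).2) hm i
  have eb : z i.castSucc = b := by simp [hz, hi]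
  have ea : z i.succ = a := by simp [hz, hi]
  rw [e1, e2, List.map_ofFn, List.map_ofFn, listOp_ofFn, listOp_ofFn]
  rw [eb, ea, units_smul_eq (k := k), mul_comm] at this
  exact this

end GradedSymm

/-! ### The generalised Jacobi identity as a recursive sum over sublists -/

section JacSum

variable {k : Type*} [Field k] {E : Type*} [AddCommGroup E] [Module k E]

/-- The sum of the degrees of a list of homogeneous elements. -/
def degSum (O : List (ℤ × E)) : ℤ := (O.map Prod.fst).sum

@[simp] theorem degSum_nil : degSum ([] : List (ℤ × E)) = 0 := rfl

@[simp] theorem degSum_append (O O' : List (ℤ × E)) : degSum (O ++ O') = degSum O + degSum O' := by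
  simp [degSum]

@[simp] theorem degSum_cons (a : ℤ × E) (O : List (ℤ × E)) : degSum (a :: O) = a.1 + degSum O := by
  simp [degSum]

/-- The signed sum of all terms `l(l(I, …), O, …)` over the distributions of the entries of the third
list to the inner and the outer operation. -/
def jacSum (l : Brackets k E) : List (ℤ × E) → List (ℤ × E) → List (ℤ × E) → E
  | I, O, [] => listOp l (listOp l (I.map Prod.snd) :: O.map Prod.snd)
  | I, O, x :: xs => sg k (x.1 * degSum O) • jacSum l (I ++ [x]) O xs + jacSum l I (O ++ [x]) xs

/-- The entries of a finite sequence selected by `c`. -/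
def select {X : Type*} {n : ℕ} (c : Fin n → Bool) (z : Fin n → X) : List X :=
  ((List.finRange n).filter c).map z

theorem select_cons {X : Type*} {n : ℕ} (b : Bool) (c : Fin n → Bool) (z : Fin (n + 1) → X) :
    select (Fin.cons (α := fun _ => Bool) b c) z =
      (if b then [z 0] else []) ++ select c fun i => z i.succ := by
  have : ((List.finRange n).map Fin.succ).filter (Fin.cons (α := fun _ => Bool) b c) =
      ((List.finRange n).filter c).map Fin.succ := by
    rw [List.filter_map]
    congr 1
  simp only [select, List.finRange_succ, List.filter_cons, this, Fin.cons_zero]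
  cases b <;> simp

variable (k) in
/-- The sign of the distribution `c`, after an outer list of total degree `o`. -/
def selectSign (o : ℤ) {n : ℕ} (c : Fin n → Bool) (d : Fin n → ℤ) : k :=
  (∏ b, if c b = true then sg k (d b * o) else 1) *
    ∏ a, ∏ b, if a < b ∧ c a = false ∧ c b = true then sg k (d a * d b) else 1

theorem selectSign_cons_true (o : ℤ) {n : ℕ} (c : Fin n → Bool) (d : Fin (n + 1) → ℤ) :
    selectSign k o (Fin.cons (α := fun _ => Bool) true c) d =
      sg k (d 0 * o) * selectSign k o c fun i => d i.succ := by
  simp [selectSign, Fin.prod_univ_succ, mul_assoc]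

theorem selectSign_cons_false (o : ℤ) {n : ℕ} (c : Fin n → Bool) (d : Fin (n + 1) → ℤ) :
    selectSign k o (Fin.cons (α := fun _ => Bool) false c) d =
      selectSign k (o + d 0) c fun i => d i.succ := by
  simp only [selectSign, Fin.prod_univ_succ, Fin.cons_zero, Fin.cons_succ, ← mul_assoc]
  have : ∀ b : Fin n, (if c b = true then sg k (d b.succ * (o + d 0)) else 1) =
      (if c b = true then sg k (d b.succ * o) else 1) *
      (if c b = true then sg k (d 0 * d b.succ) else 1) := by
    intro b
    split_ifs
    · rw [mul_add, sg_add, mul_comm (d 0)]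
    · simp
  simp only [this, Finset.prod_mul_distrib]
  simp

/-- Unfolding the recursion, `c` is true at the entries given to the inner operation. An inner entry
picks up a sign from each outer entry it overtakes, both those already in `O` and those earlier in
the sequence. -/
theorem jacSum_ofFn (l : Brackets k E) {n : ℕ} (z : Fin n → ℤ × E) (I O : List (ℤ × E)) :
    jacSum l I O (List.ofFn z) = ∑ c : Fin n → Bool,
      selectSign k (degSum O) c (fun i => (z i).1) •
        listOp l (listOp l ((I ++ select c z).map Prod.snd) ::
          (O ++ select (fun i => !c i) z).map Prod.snd) := by
  induction n generalizing I O with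
  | zero =>
    simp [jacSum, select, selectSign]
  | succ n ih =>
    rw [List.ofFn_succ, jacSum, ih, ih,
      ← (Fin.consEquiv (fun _ : Fin (n + 1) => Bool)).sum_comp, Fintype.sum_prod_type,
      Fintype.sum_bool]
    have hn : ∀ (b : Bool) (c : Fin n → Bool),
        (fun i => !(Fin.cons (α := fun _ => Bool) b c : Fin (n + 1) → Bool) i) =
        Fin.cons (α := fun _ => Bool) (!b) fun i => !c i := by
      intro b c
      funext i
      refine Fin.cases ?_ (fun i => ?_) i <;> simp
    have hcons : ∀ (b : Bool) (c : Fin n → Bool), Fin.consEquiv (fun _ : Fin (n + 1) => Bool) (b, c) =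
        Fin.cons (α := fun _ => Bool) b c := fun _ _ => rfl
    simp only [hcons, hn, select_cons, selectSign_cons_true, selectSign_cons_false,
      Finset.smul_sum, smul_smul]
    simp

open Classical in
/-- The distribution belonging to a `(q, n - q)`-shuffle. -/
def shuffleSelect {n : ℕ} (q : ℕ) (σ : Equiv.Perm (Fin n)) : Fin n → Bool :=
  fun i => decide ((σ.symm i : ℕ) < q)

theorem filter_shuffleSelect {n : ℕ} {q : ℕ} (hq : q ≤ n) {σ : Equiv.Perm (Fin n)}
    (h : IsShuffle q σ) :
    (List.finRange n).filter (shuffleSelect q σ) =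
      List.ofFn fun a : Fin q => σ ⟨a, by omega⟩ := by
  refine List.Perm.eq_of_pairwise' (r := (· < ·)) ?_ ?_ ?_
  · exact (List.pairwise_lt_finRange n).filter _
  · rw [List.pairwise_ofFn]
    intro a b hab
    exact h.1 _ _ hab b.2
  · rw [List.perm_ext_iff_of_nodup ((List.nodup_finRange n).filter _)]
    · intro i
      rw [List.mem_filter, List.mem_ofFn']
      simp only [List.mem_finRange, true_and, shuffleSelect, decide_eq_true_eq, Set.mem_range]
      constructor
      · intro hi
        exact ⟨⟨σ.symm i, hi⟩, by simp⟩
      · rintro ⟨a, rfl⟩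
        simp
    · rw [List.nodup_ofFn]
      intro a b hab
      have := σ.injective hab
      exact Fin.ext (by simpa using congrArg Fin.val this)

theorem filter_not_shuffleSelect {n : ℕ} {q r : ℕ} (hq : q + r = n) {σ : Equiv.Perm (Fin n)}
    (h : IsShuffle q σ) :
    (List.finRange n).filter (fun i => !shuffleSelect q σ i) =
      List.ofFn fun a : Fin r => σ ⟨q + a, by omega⟩ := by
  refine List.Perm.eq_of_pairwise' (r := (· < ·)) ?_ ?_ ?_
  · exact (List.pairwise_lt_finRange n).filter _
  · rw [List.pairwise_ofFn]
    intro a b hab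
    refine h.2 _ _ ?_ ?_
    · have : (a : ℕ) < b := hab
      rw [Fin.lt_def]; simp only; omega
    · simp
  · rw [List.perm_ext_iff_of_nodup ((List.nodup_finRange n).filter _)]
    · intro i
      rw [List.mem_filter, List.mem_ofFn']
      simp only [List.mem_finRange, true_and, shuffleSelect, Bool.not_eq_true', decide_eq_false_iff_not,
        Set.mem_range, not_lt]
      constructor
      · intro hi
        refine ⟨⟨(σ.symm i : ℕ) - q, by omega⟩, ?_⟩
        have : (⟨q + ((σ.symm i : ℕ) - q), by omega⟩ : Fin n) = σ.symm i :=
          Fin.ext (by simp only; omega)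
        simp [this]
      · rintro ⟨a, rfl⟩
        simp
    · rw [List.nodup_ofFn]
      intro a b hab
      have := σ.injective hab
      exact Fin.ext (by simpa using congrArg Fin.val this)

theorem shuffle_ext {n q : ℕ} (hq : q ≤ n) {σ τ : Equiv.Perm (Fin n)} (hσ : IsShuffle q σ)
    (hτ : IsShuffle q τ) (h : shuffleSelect q σ = shuffleSelect q τ) : σ = τ := by
  obtain ⟨r, rfl⟩ := Nat.exists_eq_add_of_le hq
  have h1 := filter_shuffleSelect hq hσ
  rw [h, filter_shuffleSelect hq hτ] at h1
  have h2 := filter_not_shuffleSelect rfl hσ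
  rw [h, filter_not_shuffleSelect rfl hτ] at h2
  have h1 := List.ofFn_injective h1
  have h2 := List.ofFn_injective h2
  ext i : 1
  by_cases hi : (i : ℕ) < q
  · exact (congrFun h1 ⟨i, hi⟩).symm
  · have e : (⟨q + ((i : ℕ) - q), by omega⟩ : Fin (q + r)) = i := Fin.ext (by simp only; omega)
    have := congrFun h2 ⟨(i : ℕ) - q, by omega⟩
    simp only [e] at this
    exact this.symm

/-- Listing the selected indices in increasing order and then the others in increasing order is the
required shuffle. -/
theorem exists_shuffle {n : ℕ} (c : Fin n → Bool) :
    ∃ σ : Equiv.Perm (Fin n), IsShuffle ((List.finRange n).filter c).length σ ∧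
      shuffleSelect ((List.finRange n).filter c).length σ = c := by
  set L₁ := (List.finRange n).filter c with hL₁
  set L₂ := (List.finRange n).filter fun i => !c i with hL₂
  have hlen : (L₁ ++ L₂).length = n := by
    rw [(List.filter_append_perm c (List.finRange n)).length_eq, List.length_finRange]
  have hnd : (L₁ ++ L₂).Nodup :=
    (List.filter_append_perm c (List.finRange n)).nodup_iff.2 (List.nodup_finRange n)
  have hp1 : L₁.Pairwise (· < ·) := (List.pairwise_lt_finRange n).filter _
  have hp2 : L₂.Pairwise (· < ·) := (List.pairwise_lt_finRange n).filter _
  let f : Fin n → Fin n := fun i => (L₁ ++ L₂).get (i.cast hlen.symm)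
  have hf : Function.Injective f := by
    intro a b hab
    have := List.nodup_iff_injective_get.1 hnd hab
    exact Fin.cast_injective _ this
  let σ := Equiv.ofBijective f (Finite.injective_iff_bijective.1 hf)
  have h1 : ∀ (i : Fin n) (hi : (i : ℕ) < L₁.length), σ i = L₁[i] := fun i hi =>
    List.getElem_append_left hi
  have h2 : ∀ (i : Fin n) (hi : L₁.length ≤ (i : ℕ)), σ i = L₂[(i : ℕ) - L₁.length]'(by
      have := i.2; rw [List.length_append] at hlen; omega) := fun i hi =>
    List.getElem_append_right hi
  refine ⟨σ, ⟨?_, ?_⟩, ?_⟩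
  · intro a b hab hb
    have hab' : (a : ℕ) < b := hab
    rw [h1 a (by omega), h1 b hb]
    exact List.pairwise_iff_getElem.1 hp1 _ _ _ _ hab'
  · intro a b hab ha
    have hab' : (a : ℕ) < b := hab
    rw [h2 a ha, h2 b (by omega)]
    exact List.pairwise_iff_getElem.1 hp2 _ _ _ _ (by omega)
  · funext i
    obtain ⟨j, rfl⟩ := σ.surjective i
    simp only [shuffleSelect, Equiv.symm_apply_apply]
    by_cases hj : (j : ℕ) < L₁.length
    · have : σ j ∈ L₁ := by rw [h1 j hj]; exact List.getElem_mem _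
      rw [hL₁, List.mem_filter] at this
      rw [this.2]; simpa using hj
    · have : σ j ∈ L₂ := by rw [h2 j (by omega)]; exact List.getElem_mem _
      rw [hL₂, List.mem_filter] at this
      have := this.2
      simp only [Bool.not_eq_true'] at this
      rw [this]; simpa using hj

/-- A shuffle is increasing on both of its blocks, so its inversions are exactly the pairs of an
outer entry followed by an inner one. -/
theorem koszulSign_shuffle {n q : ℕ} {σ : Equiv.Perm (Fin n)} (hσ : IsShuffle q σ) (d : Fin n → ℤ) :
    (((koszulSign σ d : ℤˣ) : ℤ) : k) = selectSign k 0 (shuffleSelect q σ) d := by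
  have e : ∀ a b : Fin n, (a < b ∧ σ.symm b < σ.symm a) ↔
      (a < b ∧ shuffleSelect q σ a = false ∧ shuffleSelect q σ b = true) := by
    intro a b
    simp only [shuffleSelect, decide_eq_true_eq, decide_eq_false_iff_not, not_lt]
    refine and_congr_right fun hab => ⟨fun h => ?_, fun h => ?_⟩
    · have h' : (σ.symm b : ℕ) < σ.symm a := h
      by_contra hc
      by_cases hq : (σ.symm a : ℕ) < q
      · have := hσ.1 _ _ h hq
        simp only [Equiv.apply_symm_apply] at this
        exact this.not_gt hab
      · have := hσ.2 _ _ h (by omega)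
        simp only [Equiv.apply_symm_apply] at this
        exact this.not_gt hab
    · rw [Fin.lt_def]; omega
  rw [koszulSign_eq]
  simp only [e, selectSign, mul_zero, sg_zero, ite_self, Finset.prod_const_one, one_mul]
  rw [Units.coe_prod, Int.cast_prod]
  refine Finset.prod_congr rfl fun a _ => ?_
  rw [Units.coe_prod, Int.cast_prod]
  refine Finset.prod_congr rfl fun b _ => ?_
  split_ifs
  · rfl
  · simp

theorem shuffleSelect_zero_length {n : ℕ} {q : ℕ} (hq : q ≤ n) {σ : Equiv.Perm (Fin n)}
    (h : IsShuffle q σ) : ((List.finRange n).filter (shuffleSelect q σ)).length = q := by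
  rw [filter_shuffleSelect hq h, List.length_ofFn]

/-- Shuffles with a nonempty first block correspond to nonempty sets of inner entries. The recursive
form makes induction on the argument list available. -/
theorem jacobiator_eq_jacSum (l : Brackets k E) (n : ℕ) (d : Fin (n + 1) → ℤ)
    (x : Fin (n + 1) → E) :
    jacobiator l n d x = jacSum l [] [] (List.ofFn fun i => (d i, x i)) := by
  classical
  rw [jacSum_ofFn, jacobiator]
  set T : (Fin (n + 1) → Bool) → E := fun c => selectSign k 0 c d •
    listOp l (listOp l (select c x) :: select (fun i => !c i) x) with hT
  have hsel : ∀ c : Fin (n + 1) → Bool, (select c fun i => (d i, x i)).map Prod.snd = select c x := by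
    intro c; simp [select]
  have hR : ∀ c : Fin (n + 1) → Bool, selectSign k (degSum ([] : List (ℤ × E))) c
      (fun i => ((d i, x i) : ℤ × E).1) •
        listOp l (listOp l (([] ++ select c fun i => (d i, x i)).map Prod.snd) ::
          ([] ++ select (fun i => !c i) fun i => (d i, x i)).map Prod.snd) = T c := by
    intro c
    simp only [List.nil_append, hsel, hT, degSum_nil]
  rw [Finset.sum_congr rfl fun c _ => hR c]
  have hterm : ∀ (p : Fin (n + 1)) (σ : Equiv.Perm (Fin (n + 1))), IsShuffle ((p : ℕ) + 1) σ →
      koszulSign σ d •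
        l (n - p) (Fin.cons (α := fun _ => E)
          (l p (fun a : Fin ((p : ℕ) + 1) => x (σ ⟨a, by omega⟩)))
          (fun b : Fin (n - p) => x (σ ⟨(p : ℕ) + 1 + b, by omega⟩))) =
      T (shuffleSelect ((p : ℕ) + 1) σ) := by
    intro p σ hσ
    rw [units_smul_eq (k := k), koszulSign_shuffle hσ, hT]
    simp only
    rw [← listOp_ofFn, ← listOp_ofFn, List.ofFn_cons, select, select,
      filter_shuffleSelect (by omega) hσ,
      filter_not_shuffleSelect (r := n - p) (by omega) hσ, List.map_ofFn, List.map_ofFn]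
    rfl
  have hsum : ∀ p : Fin (n + 1), (∑ σ : Equiv.Perm (Fin (n + 1)),
      if IsShuffle ((p : ℕ) + 1) σ then koszulSign σ d •
        l (n - p) (Fin.cons (α := fun _ => E)
          (l p (fun a : Fin ((p : ℕ) + 1) => x (σ ⟨a, by omega⟩)))
          (fun b : Fin (n - p) => x (σ ⟨(p : ℕ) + 1 + b, by omega⟩))) else 0) =
      ∑ σ ∈ Finset.univ.filter (IsShuffle ((p : ℕ) + 1)), T (shuffleSelect ((p : ℕ) + 1) σ) := by
    intro p
    rw [Finset.sum_filter]
    refine Finset.sum_congr rfl fun σ _ => ?_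
    split_ifs with hσ
    · exact hterm p σ hσ
    · rfl
  rw [Finset.sum_congr rfl fun p _ => hsum p, Finset.sum_sigma']
  refine Finset.sum_of_injOn (fun a => shuffleSelect ((a.1 : ℕ) + 1) a.2) ?_ ?_ ?_ ?_
  · rintro ⟨p, σ⟩ hσ ⟨p', σ'⟩ hσ' h
    have hσ : IsShuffle ((p : ℕ) + 1) σ := by simpa using hσ
    have hσ' : IsShuffle ((p' : ℕ) + 1) σ' := by simpa using hσ'
    simp only at h
    have h1 := shuffleSelect_zero_length (by omega) hσ
    rw [h, shuffleSelect_zero_length (by omega) hσ'] at h1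
    obtain rfl : p = p' := Fin.ext (by omega)
    rw [shuffle_ext (by omega) hσ hσ' h]
  · intro a _
    simp
  -- The only distribution that comes from no admissible shuffle has no inner entry; its term is
  -- zero because `listOp` is zero on the empty list.
  · intro c _ hc
    have : (List.finRange (n + 1)).filter c = [] := by
      by_contra hne
      obtain ⟨σ, hσ, e⟩ := exists_shuffle c
      have hle := List.length_filter_le c (List.finRange (n + 1))
      rw [List.length_finRange] at hle
      have hpos := List.length_pos_iff.2 hne
      refine hc ⟨⟨⟨((List.finRange (n + 1)).filter c).length - 1, by omega⟩, σ⟩, ?_, ?_⟩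
      · simpa [Nat.sub_add_cancel hpos] using hσ
      · simpa [Nat.sub_add_cancel hpos] using e
    have h0 : select c x = [] := by rw [select, this, List.map_nil]
    simp only [h0, listOp_nil, listOp_cons_zero, smul_zero]
  · rintro ⟨p, σ⟩ hσ
    rfl

end JacSum

/-! ### Additivity and symmetry of the Jacobi sum -/

section JacSumProps

variable {k : Type*} [Field k] {E : Type*} [AddCommGroup E] [Module k E]

theorem jacSum_add_inner (l : Brackets k E) (d : ℤ) (a b : E) (I₁ I₂ O xs : List (ℤ × E)) :
    jacSum l (I₁ ++ (d, a + b) :: I₂) O xs =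
      jacSum l (I₁ ++ (d, a) :: I₂) O xs + jacSum l (I₁ ++ (d, b) :: I₂) O xs := by
  induction xs generalizing I₂ O with
  | nil =>
    simp only [jacSum, List.map_append, List.map_cons, listOp_add, listOp_cons_add]
  | cons x xs ih =>
    simp only [jacSum, List.append_assoc, List.cons_append, ih, smul_add]
    abel

theorem jacSum_add_outer (l : Brackets k E) (d : ℤ) (a b : E) (I O₁ O₂ xs : List (ℤ × E)) :
    jacSum l I (O₁ ++ (d, a + b) :: O₂) xs =
      jacSum l I (O₁ ++ (d, a) :: O₂) xs + jacSum l I (O₁ ++ (d, b) :: O₂) xs := by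
  induction xs generalizing I O₂ with
  | nil =>
    simp only [jacSum, List.map_append, List.map_cons]
    exact listOp_add l (_ :: _) _ a b
  | cons x xs ih =>
    simp only [jacSum, List.append_assoc, List.cons_append, ih, smul_add, degSum_append,
      degSum_cons]
    abel

theorem jacSum_add (l : Brackets k E) (d : ℤ) (a b : E) (I O pre post : List (ℤ × E)) :
    jacSum l I O (pre ++ (d, a + b) :: post) =
      jacSum l I O (pre ++ (d, a) :: post) + jacSum l I O (pre ++ (d, b) :: post) := by
  induction pre generalizing I O with
  | nil =>
    simp only [jacSum, List.nil_append]
    rw [jacSum_add_inner, jacSum_add_outer, smul_add]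
    abel
  | cons x xs ih =>
    simp only [jacSum, List.cons_append, ih, smul_add]
    abel

theorem homogeneousList_append {𝒢 : ℤ → Submodule k E} {L₁ L₂ : List (ℤ × E)} :
    HomogeneousList 𝒢 (L₁ ++ L₂) ↔ HomogeneousList 𝒢 L₁ ∧ HomogeneousList 𝒢 L₂ := by
  simp only [HomogeneousList, List.mem_append, or_imp, forall_and]

theorem homogeneousList_cons {𝒢 : ℤ → Submodule k E} {x : ℤ × E} {L : List (ℤ × E)} :
    HomogeneousList 𝒢 (x :: L) ↔ x.2 ∈ 𝒢 x.1 ∧ HomogeneousList 𝒢 L := by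
  simp only [HomogeneousList, List.forall_mem_cons]

theorem homogeneousList_nil {𝒢 : ℤ → Submodule k E} : HomogeneousList 𝒢 [] := by
  simp [HomogeneousList]

/-- A property of lists of homogeneous elements that is additive in every entry holds if it holds
for lists whose entries satisfy `p`. -/
theorem homogeneousList_induction {𝒢 : ℤ → Submodule k E} {p : E → Prop} {Q : List (ℤ × E) → Prop}
    (hp : ∀ d, ∀ x ∈ 𝒢 d, ∃ a b, x = a + b ∧ a ∈ 𝒢 d ∧ b ∈ 𝒢 d ∧ p a ∧ p b)
    (hQ : ∀ L₁ L₂ d a b, Q (L₁ ++ (d, a) :: L₂) → Q (L₁ ++ (d, b) :: L₂) →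
      Q (L₁ ++ (d, a + b) :: L₂))
    (h : ∀ L, HomogeneousList 𝒢 L → (∀ x ∈ L, p x.2) → Q L) (L : List (ℤ × E))
    (hL : HomogeneousList 𝒢 L) : Q L := by
  suffices H : ∀ (L pre : List (ℤ × E)), HomogeneousList 𝒢 (pre ++ L) → (∀ x ∈ pre, p x.2) →
      Q (pre ++ L) from H L [] hL (by simp)
  intro L
  induction L with
  | nil =>
    intro pre h1 h2
    exact h _ h1 (by simpa using h2)
  | cons x L ih =>
    intro pre h1 h2
    obtain ⟨d, x⟩ := x
    rw [homogeneousList_append, homogeneousList_cons] at h1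
    obtain ⟨a, b, rfl, ha, hb, pa, pb⟩ := hp d x h1.2.1
    have key : ∀ c, c ∈ 𝒢 d → p c → Q (pre ++ (d, c) :: L) := by
      intro c hc pc
      have := ih (pre ++ [(d, c)]) (by
        rw [List.append_assoc, homogeneousList_append, List.singleton_append, homogeneousList_cons]
        exact ⟨h1.1, hc, h1.2.2⟩) (by
        intro y hy
        rw [List.mem_append, List.mem_singleton] at hy
        rcases hy with hy | rfl
        · exact h2 y hy
        · exact pc)
      rwa [List.append_assoc, List.singleton_append] at this
    exact hQ _ _ _ _ _ (key a ha pa) (key b hb pb)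

/-- The scalar is chosen before the family `l`. Two graded symmetric families thus reorder by the
same factor, which uniqueness needs; its value is irrelevant. -/
theorem listOp_perm {𝒢 : ℤ → Submodule k E} {xs ys : List (ℤ × E)} (h : xs.Perm ys)
    (hx : HomogeneousList 𝒢 xs) :
    ∃ u : k, ∀ l : Brackets k E, GradedSymmetric 𝒢 l → ∀ pre, HomogeneousList 𝒢 pre →
      listOp l ((pre ++ xs).map Prod.snd) = u • listOp l ((pre ++ ys).map Prod.snd) := by
  induction h with
  | nil => exact ⟨1, fun l _ pre _ => by simp⟩
  | cons x _ ih =>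
    rw [homogeneousList_cons] at hx
    obtain ⟨u, hu⟩ := ih hx.2
    refine ⟨u, fun l hl pre hpre => ?_⟩
    have := hu l hl (pre ++ [x]) (homogeneousList_append.2 ⟨hpre,
      homogeneousList_cons.2 ⟨hx.1, homogeneousList_nil⟩⟩)
    simpa only [List.append_assoc, List.singleton_append] using this
  | swap x y L =>
    exact ⟨_, fun l hl pre hpre => listOp_swap hl pre L y x (homogeneousList_append.2 ⟨hpre, hx⟩)⟩
  | trans h₁ _ ih₁ ih₂ =>
    obtain ⟨u, hu⟩ := ih₁ hx
    obtain ⟨v, hv⟩ := ih₂ fun a ha => hx a (h₁.mem_iff.2 ha)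
    exact ⟨u * v, fun l hl pre hpre => by rw [hu l hl pre hpre, hv l hl pre hpre, smul_smul]⟩

variable {𝒢 : ℤ → Submodule k E} {l : Brackets k E} (hl : GradedSymmetric 𝒢 l)
  (hdeg : ∀ L, HomogeneousList 𝒢 L → listOp l (L.map Prod.snd) ∈ 𝒢 (degSum L + 1))

include hl

theorem jacSum_swap_inner (a b : ℤ × E) (I₁ I₂ O xs : List (ℤ × E))
    (hI : HomogeneousList 𝒢 (I₁ ++ a :: b :: I₂)) (hx : HomogeneousList 𝒢 xs) :
    jacSum l (I₁ ++ a :: b :: I₂) O xs =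
      sg k (a.1 * b.1) • jacSum l (I₁ ++ b :: a :: I₂) O xs := by
  induction xs generalizing I₂ O with
  | nil =>
    simp only [jacSum]
    rw [listOp_swap hl _ _ _ _ hI, listOp_cons_smul]
  | cons x xs ih =>
    rw [homogeneousList_cons] at hx
    simp only [jacSum, List.append_assoc, List.cons_append]
    rw [ih (I₂ ++ [x]) _ _ hx.2, ih I₂ _ hI hx.2, smul_add, smul_comm]
    have : HomogeneousList 𝒢 ((I₁ ++ a :: b :: I₂) ++ [x]) :=
      homogeneousList_append.2 ⟨hI, homogeneousList_cons.2 ⟨hx.1, homogeneousList_nil⟩⟩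
    simpa using this

include hdeg

/-- The inner value stands first among the outer arguments, and graded symmetry applies only to
homogeneous arguments; `hdeg` makes that value homogeneous. -/
theorem jacSum_swap_outer (a b : ℤ × E) (I O₁ O₂ xs : List (ℤ × E))
    (hI : HomogeneousList 𝒢 I)
    (hO : HomogeneousList 𝒢 (O₁ ++ a :: b :: O₂)) (hx : HomogeneousList 𝒢 xs) :
    jacSum l I (O₁ ++ a :: b :: O₂) xs =
      sg k (a.1 * b.1) • jacSum l I (O₁ ++ b :: a :: O₂) xs := by
  induction xs generalizing I O₂ with
  | nil =>
    simp only [jacSum]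
    exact listOp_swap hl ((degSum I + 1, listOp l (I.map Prod.snd)) :: O₁) O₂ a b
      (homogeneousList_cons.2 ⟨hdeg I hI, hO⟩)
  | cons x xs ih =>
    rw [homogeneousList_cons] at hx
    have hx1 : HomogeneousList 𝒢 [x] := homogeneousList_cons.2 ⟨hx.1, homogeneousList_nil⟩
    simp only [jacSum, List.append_assoc, List.cons_append]
    rw [ih I (O₂ ++ [x]) hI _ hx.2, ih (I ++ [x]) O₂ (homogeneousList_append.2 ⟨hI, hx1⟩) hO hx.2,
      smul_add, smul_comm]
    · simp only [degSum_append, degSum_cons, add_left_comm]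
    · have : HomogeneousList 𝒢 ((O₁ ++ a :: b :: O₂) ++ [x]) :=
        homogeneousList_append.2 ⟨hO, hx1⟩
      simpa using this

/-- The terms with `a` and `b` in the same operation are covered by `jacSum_swap_inner` and
`jacSum_swap_outer`. The two kinds of terms that separate them are exchanged, and their signs from
the recursion differ by exactly the Koszul sign. -/
theorem jacSum_swap (a b : ℤ × E) (I O xs : List (ℤ × E))
    (hI : HomogeneousList 𝒢 I) (hO : HomogeneousList 𝒢 O)
    (hx : HomogeneousList 𝒢 (a :: b :: xs)) :
    jacSum l I O (a :: b :: xs) = sg k (a.1 * b.1) • jacSum l I O (b :: a :: xs) := by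
  rw [homogeneousList_cons, homogeneousList_cons] at hx
  have hab : HomogeneousList 𝒢 [a, b] :=
    homogeneousList_cons.2 ⟨hx.1, homogeneousList_cons.2 ⟨hx.2.1, homogeneousList_nil⟩⟩
  have h1 := jacSum_swap_inner hl a b I [] O xs (homogeneousList_append.2 ⟨hI, hab⟩) hx.2.2
  have h2 := jacSum_swap_outer hl hdeg a b I O [] xs hI (homogeneousList_append.2 ⟨hO, hab⟩) hx.2.2
  simp only [jacSum, List.append_assoc, List.singleton_append, degSum_append, degSum_cons,
    degSum_nil, add_zero, h1, h2, smul_add, smul_smul, ← sg_add]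
  have e1 : sg k (a.1 * degSum O + (b.1 * degSum O + a.1 * b.1)) =
    sg k (a.1 * b.1 + (b.1 * degSum O + a.1 * degSum O)) := by congr 1; ring
  have e2 : sg k (b.1 * (degSum O + a.1)) = sg k (a.1 * b.1 + b.1 * degSum O) := by
    congr 1; ring
  have e3 : sg k (a.1 * b.1 + a.1 * (degSum O + b.1)) = sg k (a.1 * degSum O) :=
    sg_congr k ⟨a.1 * b.1, by ring⟩
  rw [e1, e2, e3]
  abel

theorem jacSum_perm {xs ys : List (ℤ × E)} (h : xs.Perm ys) (hx : HomogeneousList 𝒢 xs) :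
    ∃ u : k, ∀ I O, HomogeneousList 𝒢 I → HomogeneousList 𝒢 O →
      jacSum l I O xs = u • jacSum l I O ys := by
  induction h with
  | nil => exact ⟨1, fun I O _ _ => by simp⟩
  | cons x _ ih =>
    rw [homogeneousList_cons] at hx
    have hx1 : HomogeneousList 𝒢 [x] := homogeneousList_cons.2 ⟨hx.1, homogeneousList_nil⟩
    obtain ⟨u, hu⟩ := ih hx.2
    refine ⟨u, fun I O hI hO => ?_⟩
    simp only [jacSum]
    rw [hu _ _ (homogeneousList_append.2 ⟨hI, hx1⟩) hO,
      hu _ _ hI (homogeneousList_append.2 ⟨hO, hx1⟩), smul_add, smul_comm]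
  | swap x y L =>
    exact ⟨_, fun I O hI hO => jacSum_swap hl hdeg y x I O L hI hO hx⟩
  | trans h₁ _ ih₁ ih₂ =>
    obtain ⟨u, hu⟩ := ih₁ hx
    obtain ⟨v, hv⟩ := ih₂ fun a ha => hx a (h₁.mem_iff.2 ha)
    exact ⟨u * v, fun I O hI hO => by rw [hu I O hI hO, hv I O hI hO, smul_smul]⟩

end JacSumProps

/-! ### Derived brackets -/

/-- A graded Lie algebra `L` with an abelian subalgebra `F`, embedded by `ι`, a projection `P` onto
it whose kernel is a subalgebra, and a graded subalgebra `Lp` of the kernel of `P`, such that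
iterated brackets of `f ∈ Lp` of degree `m` with more than `m + 1` elements of `F` project to zero.
The operators `scL c` and `scF c` multiply the homogeneous elements of degree `d` by `c d`. -/
structure DerivedData (k L F : Type*) [Field k] [AddCommGroup L] [Module k L] [AddCommGroup F]
    [Module k F] where
  br : L →ₗ[k] L →ₗ[k] L
  gL : ℤ → Submodule k L
  gF : ℤ → Submodule k F
  ι : F →ₗ[k] L
  P : L →ₗ[k] F
  Lp : Submodule k L
  br_mem : ∀ {p q x y}, x ∈ gL p → y ∈ gL q → br x y ∈ gL (p + q)
  br_symm : ∀ {p q x y}, x ∈ gL p → y ∈ gL q → br x y = -(sg k (p * q) • br y x)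
  br_jacobi : ∀ {p q r x y z}, x ∈ gL p → y ∈ gL q → z ∈ gL r →
    br (br x y) z = br x (br y z) + sg k (q * r) • br (br x z) y
  ι_mem : ∀ {p t}, t ∈ gF p → ι t ∈ gL p
  P_mem : ∀ {p x}, x ∈ gL p → P x ∈ gF p
  br_ι_ι : ∀ s t, br (ι s) (ι t) = 0
  P_br : ∀ x y, P (br x y) = P (br (ι (P x)) y) + P (br x (ι (P y)))
  P_Lp : ∀ {f}, f ∈ Lp → P f = 0
  br_Lp : ∀ {f g}, f ∈ Lp → g ∈ Lp → br f g ∈ Lp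
  P_foldl : ∀ {m f}, f ∈ Lp → f ∈ gL m → ∀ ts : List F, m + 1 < ts.length →
    P (ts.foldl (fun x t => br x (ι t)) f) = 0
  scL : (ℤ → k) → L →ₗ[k] L
  scF : (ℤ → k) → F →ₗ[k] F
  scL_of_mem : ∀ {d x} (c : ℤ → k), x ∈ gL d → scL c x = c d • x
  scF_of_mem : ∀ {d t} (c : ℤ → k), t ∈ gF d → scF c t = c d • t
  scL_Lp : ∀ {f} (c : ℤ → k), f ∈ Lp → scL c f ∈ Lp

namespace DerivedData

variable {k L F : Type*} [Field k] [AddCommGroup L] [Module k L] [AddCommGroup F] [Module k F]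
  (D : DerivedData k L F)

/-- Iterated brackets with elements of the abelian subalgebra. -/
def iterF (f : L) (ts : List F) : L := ts.foldl (fun x t => D.br x (D.ι t)) f

/-- Iterated brackets with elements of the abelian subalgebra that carry a degree. -/
def iter (f : L) (ts : List (ℤ × F)) : L := D.iterF f (ts.map Prod.snd)

@[simp] theorem iter_nil (f : L) : D.iter f [] = f := rfl

@[simp] theorem iter_cons (f : L) (t : ℤ × F) (ts : List (ℤ × F)) :
    D.iter f (t :: ts) = D.iter (D.br f (D.ι t.2)) ts := rfl

theorem iter_append (f : L) (ts ts' : List (ℤ × F)) :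
    D.iter f (ts ++ ts') = D.iter (D.iter f ts) ts' := by
  simp [iter, iterF]

theorem iter_add (f g : L) (ts : List (ℤ × F)) : D.iter (f + g) ts = D.iter f ts + D.iter g ts := by
  induction ts generalizing f g with
  | nil => rfl
  | cons t ts ih => simp [ih]

theorem iter_smul (c : k) (f : L) (ts : List (ℤ × F)) : D.iter (c • f) ts = c • D.iter f ts := by
  induction ts generalizing f with
  | nil => rfl
  | cons t ts ih => simp [ih]

theorem iter_zero (ts : List (ℤ × F)) : D.iter 0 ts = 0 := by
  simpa using D.iter_smul 0 0 ts

theorem iter_mem {m : ℤ} {f : L} (hf : f ∈ D.gL m) {ts : List (ℤ × F)}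
    (hts : HomogeneousList D.gF ts) : D.iter f ts ∈ D.gL (m + degSum ts) := by
  induction ts generalizing f m with
  | nil => simpa using hf
  | cons t ts ih =>
    rw [homogeneousList_cons] at hts
    rw [iter_cons, degSum_cons, ← add_assoc]
    exact ih (D.br_mem hf (D.ι_mem hts.1)) hts.2

theorem br_ι_comm {p q r : ℤ} {x : L} {s t : F} (hx : x ∈ D.gL p) (hs : s ∈ D.gF q)
    (ht : t ∈ D.gF r) :
    D.br (D.br x (D.ι s)) (D.ι t) = sg k (q * r) • D.br (D.br x (D.ι t)) (D.ι s) := by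
  rw [D.br_jacobi hx (D.ι_mem hs) (D.ι_mem ht), D.br_ι_ι, map_zero, zero_add]

/-- Since `F` is abelian, brackets with its elements commute up to sign, so the first bracket can be
made the last. -/
theorem iter_br_ι {p q : ℤ} {x : L} {s : F} (hx : x ∈ D.gL p) (hs : s ∈ D.gF q)
    {ts : List (ℤ × F)} (hts : HomogeneousList D.gF ts) :
    D.iter (D.br x (D.ι s)) ts = sg k (q * degSum ts) • D.br (D.iter x ts) (D.ι s) := by
  induction ts generalizing p x with
  | nil => simp
  | cons t ts ih =>
    rw [homogeneousList_cons] at hts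
    rw [iter_cons, iter_cons, D.br_ι_comm hx hs hts.1, iter_smul,
      ih (D.br_mem hx (D.ι_mem hts.1)) hts.2, smul_smul, ← sg_add, degSum_cons, mul_add]

theorem P_iter_eq_zero {m : ℤ} {f : L} (hf : f ∈ D.Lp) (hm : f ∈ D.gL m) (ts : List (ℤ × F))
    (h : m + 1 < ts.length) : D.P (D.iter f ts) = 0 :=
  D.P_foldl hf hm _ (by simpa using h)

/-- The underlying space `s⁻¹ Lp ⊕ F`. -/
abbrev Tot := D.Lp × F

/-- The grading of `s⁻¹ Lp ⊕ F`. -/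
def grading (d : ℤ) : Submodule k D.Tot where
  carrier := {x | (x.1 : L) ∈ D.gL (d + 1) ∧ x.2 ∈ D.gF d}
  zero_mem' := ⟨(D.gL _).zero_mem, (D.gF _).zero_mem⟩
  add_mem' := fun hx hy => ⟨(D.gL _).add_mem hx.1 hy.1, (D.gF _).add_mem hx.2 hy.2⟩
  smul_mem' := fun c _ hx => ⟨(D.gL _).smul_mem c hx.1, (D.gF _).smul_mem c hx.2⟩

/-- The bracket on `Lp`. -/
def brLp (f g : D.Lp) : D.Lp := ⟨D.br f g, D.br_Lp f.2 g.2⟩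

/-- An element of `s⁻¹ Lp` of degree `a - 1`, where `a` is its degree in `L`. -/
def ofL (a : ℤ) (f : D.Lp) : ℤ × D.Tot := (a - 1, (f, 0))

/-- An element of `F` as an element of `s⁻¹ Lp ⊕ F`. -/
def ofF (t : ℤ × F) : ℤ × D.Tot := (t.1, (0, t.2))

/-- The operations are the modified derived brackets. -/
structure IsModified (lam : k) (l : Brackets k D.Tot) : Prop where
  symm : GradedSymmetric D.grading l
  one : ∀ x, listOp l [x] = 0
  two : ∀ (a : ℤ) (f g : D.Lp), (f : L) ∈ D.gL a →
    listOp l [(f, 0), (g, 0)] = sg k a • (D.brLp f g, 0)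
  mixed : ∀ (a : ℤ) (f : D.Lp) (ts : List (ℤ × F)), (f : L) ∈ D.gL a → ts ≠ [] →
    listOp l ((f, 0) :: ts.map fun t => (0, t.2)) =
      (0, lam ^ (a + 1 - ts.length) • D.P (D.iter f ts))
  vanish_zero : ∀ ts : List F, listOp l (ts.map fun t => (0, t)) = 0
  vanish_two : ∀ (f g : D.Lp) (L : List D.Tot), L ≠ [] → (∀ x ∈ L, x.1 = 0 ∨ x.2 = 0) →
    listOp l ((f, 0) :: (g, 0) :: L) = 0

/-- The element of `s⁻¹ Lp ⊕ F` given by a tagged homogeneous element of a summand. -/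
def toTot : (ℤ × D.Lp) ⊕ (ℤ × F) → ℤ × D.Tot := Sum.elim (fun a => D.ofL a.1 a.2) D.ofF

theorem exists_tagged (L : List (ℤ × D.Tot)) (hL : ∀ x ∈ L, x.2.1 = 0 ∨ x.2.2 = 0) :
    ∃ T : List ((ℤ × D.Lp) ⊕ (ℤ × F)), L = T.map D.toTot := by
  induction L with
  | nil => exact ⟨[], rfl⟩
  | cons x L ih =>
    rw [List.forall_mem_cons] at hL
    obtain ⟨T, rfl⟩ := ih hL.2
    obtain ⟨d, f, t⟩ := x
    rcases hL.1 with h | h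
    · simp only at h
      subst h
      exact ⟨Sum.inr (d, t) :: T, rfl⟩
    · simp only at h
      subst h
      -- Tags record the degree in `L`, which exceeds the degree in `s⁻¹ Lp` by one.
      refine ⟨Sum.inl (d + 1, f) :: T, ?_⟩
      simp [toTot, ofL]

/-- The number of factors from `s⁻¹ Lp`. -/
def numL (T : List ((ℤ × D.Lp) ⊕ (ℤ × F))) : ℕ := T.countP Sum.isLeft

theorem tagged_perm (T : List ((ℤ × D.Lp) ⊕ (ℤ × F))) :
    ∃ (fs : List (ℤ × D.Lp)) (ts : List (ℤ × F)),
      T.Perm (fs.map Sum.inl ++ ts.map Sum.inr) ∧ D.numL T = fs.length ∧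
        T.length = fs.length + ts.length := by
  induction T with
  | nil => exact ⟨[], [], by simp, rfl, rfl⟩
  | cons x T ih =>
    obtain ⟨fs, ts, h, h', h''⟩ := ih
    rcases x with f | t
    · refine ⟨f :: fs, ts, ?_, ?_, ?_⟩
      · simpa using h
      · simpa [numL, List.countP_cons] using h'
      · simp [h'']; omega
    · refine ⟨fs, t :: ts, ?_, ?_, ?_⟩
      · simpa using (h.cons (Sum.inr t)).trans List.perm_middle.symm
      · simpa [numL, List.countP_cons] using h'
      · simp [h'']; omega

theorem ofL_mem {a : ℤ} {f : D.Lp} (hf : (f : L) ∈ D.gL a) :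
    (D.ofL a f).2 ∈ D.grading (D.ofL a f).1 := by
  refine ⟨?_, (D.gF _).zero_mem⟩
  simpa [ofL] using hf

theorem mem_of_ofL_mem {a : ℤ} {f : D.Lp} (h : (D.ofL a f).2 ∈ D.grading (D.ofL a f).1) :
    (f : L) ∈ D.gL a := by
  simpa [ofL] using h.1

theorem ofF_mem {t : ℤ × F} : (D.ofF t).2 ∈ D.grading (D.ofF t).1 ↔ t.2 ∈ D.gF t.1 :=
  ⟨fun h => h.2, fun h => ⟨(D.gL _).zero_mem, h⟩⟩

theorem homogeneous_map_ofF {ts : List (ℤ × F)} :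
    HomogeneousList D.grading (ts.map D.ofF) ↔ HomogeneousList D.gF ts := by
  simp only [HomogeneousList, List.forall_mem_map, ofF_mem]

@[simp] theorem degSum_map_ofF (ts : List (ℤ × F)) : degSum (ts.map D.ofF) = degSum ts := by
  simp only [degSum, List.map_map]; rfl

/-- The value of the modified brackets on elements of `s⁻¹ Lp` followed by elements of `F`. -/
def sortedValue (lam : k) : List (ℤ × D.Lp) → List (ℤ × F) → D.Tot
  | [], _ => 0
  | [_], [] => 0
  | [f], (t :: ts) => (0, lam ^ (f.1 + 1 - (t :: ts).length) • D.P (D.iter f.2 (t :: ts)))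
  | [f, g], [] => sg k f.1 • (D.brLp f.2 g.2, 0)
  | _, _ => 0

variable {D} {lam : k} {l : Brackets k D.Tot} (hl : D.IsModified lam l)

include hl

/-- The value of the operation on a list of elements of `s⁻¹ Lp` followed by elements of `F`. -/
theorem IsModified.sorted {fs : List (ℤ × D.Lp)} {ts : List (ℤ × F)}
    (h : HomogeneousList D.grading ((fs.map Sum.inl ++ ts.map Sum.inr).map D.toTot)) :
    listOp l (((fs.map Sum.inl ++ ts.map Sum.inr).map D.toTot).map Prod.snd) =
      D.sortedValue lam fs ts := by
  have hts : ∀ ts : List (ℤ × F), ((ts.map Sum.inr).map D.toTot).map Prod.snd =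
      ts.map fun t => ((0 : D.Lp), t.2) := by
    intro ts; simp only [List.map_map]; rfl
  rcases fs with _ | ⟨f, _ | ⟨g, fs⟩⟩
  · rw [List.map_nil, List.nil_append, hts]
    have := hl.vanish_zero (ts.map Prod.snd)
    rw [List.map_map] at this
    exact this
  · rcases ts with _ | ⟨t, ts⟩
    · exact hl.one _
    · have hf : (f.2 : L) ∈ D.gL f.1 := D.mem_of_ofL_mem (h (D.ofL f.1 f.2) (by simp [toTot]))
      have := hl.mixed f.1 f.2 (t :: ts) hf (by simp)
      rw [← hts] at this
      exact this
  · have hf : (f.2 : L) ∈ D.gL f.1 := D.mem_of_ofL_mem (h (D.ofL f.1 f.2) (by simp [toTot]))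
    by_cases hne : fs = [] ∧ ts = []
    · obtain ⟨rfl, rfl⟩ := hne
      exact hl.two f.1 f.2 g.2 hf
    · have : listOp l ((f.2, 0) :: (g.2, 0) ::
          ((fs.map Sum.inl ++ ts.map Sum.inr).map D.toTot).map Prod.snd) = 0 := by
        apply hl.vanish_two
        · simp only [ne_eq, List.map_eq_nil_iff, List.append_eq_nil_iff]
          exact hne
        · intro x hx
          simp only [List.mem_map] at hx
          obtain ⟨_, ⟨a, -, rfl⟩, rfl⟩ := hx
          rcases a with a | a
          · exact Or.inr rfl
          · exact Or.inl rfl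
      rcases fs with _ | ⟨f', fs⟩
      · rcases ts with _ | ⟨t, ts⟩
        · simp at hne
        · exact this
      · exact this

/-- What the counting of nested terms needs: the number of factors from `s⁻¹ Lp` determines in which
summand the value lies, or that it is zero. Sorting the factors changes the value only by a scalar,
and on sorted factors it is `sortedValue`. -/
theorem IsModified.tagged (T : List ((ℤ × D.Lp) ⊕ (ℤ × F)))
    (h : HomogeneousList D.grading (T.map D.toTot)) :
    listOp l ((T.map D.toTot).map Prod.snd) ∈ D.grading (degSum (T.map D.toTot) + 1) ∧
    (D.numL T = 0 → listOp l ((T.map D.toTot).map Prod.snd) = 0) ∧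
    (D.numL T = 1 → (listOp l ((T.map D.toTot).map Prod.snd)).1 = 0) ∧
    (D.numL T = 2 → T.length = 2 → (listOp l ((T.map D.toTot).map Prod.snd)).2 = 0) ∧
    (2 ≤ D.numL T → 3 ≤ T.length → listOp l ((T.map D.toTot).map Prod.snd) = 0) := by
  obtain ⟨fs, ts, hp, h1, h2⟩ := D.tagged_perm T
  have hp' := hp.map D.toTot
  obtain ⟨u, hu⟩ := listOp_perm (k := k) hp' h
  have hu := hu l hl.symm [] homogeneousList_nil
  simp only [List.nil_append] at hu
  have h' : HomogeneousList D.grading ((fs.map Sum.inl ++ ts.map Sum.inr).map D.toTot) :=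
    fun a ha => h a (hp'.mem_iff.2 ha)
  have hd : degSum (T.map D.toTot) = degSum ((fs.map Sum.inl ++ ts.map Sum.inr).map D.toTot) := by
    simp only [degSum]
    exact (hp'.map Prod.fst).sum_eq
  rw [hu, hd, hl.sorted h', h1, h2]
  rcases fs with _ | ⟨f, _ | ⟨g, fs⟩⟩
  · simp [sortedValue]
  · rcases ts with _ | ⟨t, ts⟩
    · simp [sortedValue]
    · have hf : (f.2 : L) ∈ D.gL f.1 := D.mem_of_ofL_mem (h' (D.ofL f.1 f.2) (by simp [toTot]))
      have ht : HomogeneousList D.gF (t :: ts) := by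
        intro a ha
        exact D.ofF_mem.1 (h' (D.ofF a) (List.mem_map.2 ⟨Sum.inr a,
          List.mem_append_right _ (List.mem_map_of_mem ha), rfl⟩))
      refine ⟨(D.grading _).smul_mem _ ⟨(D.gL _).zero_mem, (D.gF _).smul_mem _ ?_⟩, by simp,
        by simp [sortedValue], by simp, by simp⟩
      have := D.P_mem (D.iter_mem hf ht)
      convert this using 2
      have e : ((t :: ts).map Sum.inr).map D.toTot = (t :: ts).map D.ofF := by
        rw [List.map_map]; rfl
      rw [List.map_append, degSum_append, e, degSum_map_ofF]
      simp [toTot, ofL]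
      ring
  · have hf : (f.2 : L) ∈ D.gL f.1 := D.mem_of_ofL_mem (h' (D.ofL f.1 f.2) (by simp [toTot]))
    have hg : (g.2 : L) ∈ D.gL g.1 := D.mem_of_ofL_mem (h' (D.ofL g.1 g.2) (by simp [toTot]))
    rcases fs with _ | ⟨f', fs⟩
    · rcases ts with _ | ⟨t, ts⟩
      · refine ⟨(D.grading _).smul_mem _ ((D.grading _).smul_mem _ ⟨?_, (D.gF _).zero_mem⟩),
          by simp, by simp, by simp [sortedValue], by simp⟩
        have := D.br_mem hf hg
        convert this using 2
        · simp [toTot, ofL]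
          ring
        · rfl
      · simp [sortedValue]
    · simp [sortedValue]

theorem IsModified.degree (T : List (ℤ × D.Tot)) (hT : HomogeneousList D.grading T) :
    listOp l (T.map Prod.snd) ∈ D.grading (degSum T + 1) := by
  refine homogeneousList_induction (p := fun x : D.Tot => x.1 = 0 ∨ x.2 = 0)
    (Q := fun T => listOp l (T.map Prod.snd) ∈ D.grading (degSum T + 1)) ?_ ?_ ?_ T hT
  · rintro d ⟨f, t⟩ hx
    exact ⟨(f, 0), (0, t), by simp, ⟨hx.1, (D.gF _).zero_mem⟩, ⟨(D.gL _).zero_mem, hx.2⟩,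
      Or.inr rfl, Or.inl rfl⟩
  · intro L₁ L₂ d a b ha hb
    simp only [List.map_append, List.map_cons, listOp_add, degSum_append, degSum_cons] at *
    exact (D.grading _).add_mem ha hb
  · intro T hT hp
    obtain ⟨T, rfl⟩ := D.exists_tagged T hp
    exact (hl.tagged T hT).1

end DerivedData

/-! ### The generalised Jacobi identity for modified derived brackets. -/

namespace DerivedData

variable {k L F : Type*} [Field k] [AddCommGroup L] [Module k L] [AddCommGroup F] [Module k F]
  {D : DerivedData k L F}

/-- For `lam = 0` the law fails for exponents of opposite sign, for instance `1` and `-1`; hence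
both hypotheses. -/
theorem zpow_add_of_nonneg (lam : k) {a b : ℤ} (ha : 0 ≤ a) (hb : 0 ≤ b) :
    lam ^ a * lam ^ b = lam ^ (a + b) := by
  lift a to ℕ using ha
  lift b to ℕ using hb
  rw [← Nat.cast_add, zpow_natCast, zpow_natCast, zpow_natCast, pow_add]

section Vanishing

variable {E : Type*} [AddCommGroup E] [Module k E]

/-- The Jacobi sum vanishes if all its terms do. -/
theorem jacSum_map_eq_zero {X : Type*} (φ : X → ℤ × E) (l : Brackets k E) (I O xs : List X)
    (h : ∀ I' O' : List X, (I' ++ O').Perm (I ++ O ++ xs) →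
      listOp l (listOp l ((I'.map φ).map Prod.snd) :: (O'.map φ).map Prod.snd) = 0) :
    jacSum l (I.map φ) (O.map φ) (xs.map φ) = 0 := by
  induction xs generalizing I O with
  | nil => exact h I O (by simp)
  | cons x xs ih =>
    have h1 := ih (I ++ [x]) O fun I' O' hp => h I' O' (hp.trans (by
      simp only [List.append_assoc, List.singleton_append]
      exact List.Perm.append_left _ (List.perm_middle (l₁ := O) (a := x) (l₂ := xs)).symm))
    have h2 := ih I (O ++ [x]) fun I' O' hp => h I' O' (by simpa using hp)
    rw [List.map_append, List.map_singleton] at h1 h2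
    rw [List.map_cons, jacSum, h1, h2, smul_zero, add_zero]

end Vanishing

variable {lam : k} {l : Brackets k D.Tot} (hl : D.IsModified lam l)

theorem numL_append (T T' : List ((ℤ × D.Lp) ⊕ (ℤ × F))) :
    D.numL (T ++ T') = D.numL T + D.numL T' := List.countP_append

theorem numL_le (T : List ((ℤ × D.Lp) ⊕ (ℤ × F))) : D.numL T ≤ T.length := List.countP_le_length

include hl

/-- An inner operation with one factor from `s⁻¹ Lp` yields an element of `F`, and one with two
yields an element of `s⁻¹ Lp`. In either case a nonzero result has one such factor fewer. The outer
operation then vanishes unless one factor remains, or two remain and nothing else; these are the two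
excluded situations. -/
theorem IsModified.nested_eq_zero (I O : List ((ℤ × D.Lp) ⊕ (ℤ × F)))
    (h : HomogeneousList D.grading ((I ++ O).map D.toTot)) (h2 : D.numL (I ++ O) ≠ 2)
    (h3 : D.numL (I ++ O) = 3 → 3 < (I ++ O).length) :
    listOp l (listOp l ((I.map D.toTot).map Prod.snd) :: (O.map D.toTot).map Prod.snd) = 0 := by
  rw [List.map_append, homogeneousList_append] at h
  rw [numL_append] at h2 h3
  rw [List.length_append] at h3
  obtain ⟨hI, hO⟩ := h
  obtain ⟨hdeg, i0, i1, i2, i3⟩ := hl.tagged I hI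
  have hIl := numL_le I
  have hOl := numL_le O
  by_cases e0 : D.numL I = 0
  · rw [i0 e0, listOp_cons_zero]
  by_cases e1 : D.numL I = 1
  · have e : listOp l ((I.map D.toTot).map Prod.snd) =
        (D.toTot (Sum.inr (degSum (I.map D.toTot) + 1, (listOp l ((I.map D.toTot).map Prod.snd)).2))).2 :=
      Prod.ext (i1 e1) rfl
    have hc : HomogeneousList D.grading ((Sum.inr (degSum (I.map D.toTot) + 1,
        (listOp l ((I.map D.toTot).map Prod.snd)).2) :: O).map D.toTot) := by
      rw [List.map_cons, homogeneousList_cons]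
      refine ⟨?_, hO⟩
      rw [← e]
      exact hdeg
    obtain ⟨-, o0, -, -, o3⟩ := hl.tagged _ hc
    have hn : D.numL (Sum.inr (degSum (I.map D.toTot) + 1,
        (listOp l ((I.map D.toTot).map Prod.snd)).2) :: O) = D.numL O := by
      simp [numL]
    rw [hn] at o0 o3
    rw [e]
    by_cases c0 : D.numL O = 0
    · exact o0 c0
    · exact o3 (by omega) (by simp only [List.length_cons]; omega)
  by_cases e2 : D.numL I = 2 ∧ I.length = 2
  · have e : listOp l ((I.map D.toTot).map Prod.snd) =
        (D.toTot (Sum.inl (degSum (I.map D.toTot) + 1 + 1,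
          (listOp l ((I.map D.toTot).map Prod.snd)).1))).2 :=
      Prod.ext rfl (i2 e2.1 e2.2)
    have hc : HomogeneousList D.grading ((Sum.inl (degSum (I.map D.toTot) + 1 + 1,
        (listOp l ((I.map D.toTot).map Prod.snd)).1) :: O).map D.toTot) := by
      rw [List.map_cons, homogeneousList_cons]
      refine ⟨?_, hO⟩
      rw [← e]
      simpa [toTot, ofL] using hdeg
    obtain ⟨-, -, -, -, o3⟩ := hl.tagged _ hc
    have hn : D.numL (Sum.inl (degSum (I.map D.toTot) + 1 + 1,
        (listOp l ((I.map D.toTot).map Prod.snd)).1) :: O) = D.numL O + 1 := by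
      simp [numL, List.countP_cons]
    rw [hn] at o3
    rw [e]
    exact o3 (by omega) (by simp only [List.length_cons]; omega)
  · rw [i3 (by omega) (by omega), listOp_cons_zero]

/-- Disposes of the terms in which both factors from `s⁻¹ Lp` are outer. -/
theorem IsModified.inner_ofF (I : List (ℤ × F)) (O ts : List (ℤ × D.Tot))
    (h : HomogeneousList D.gF I) (ts' : List (ℤ × F)) (hts : ts = ts'.map D.ofF)
    (h' : HomogeneousList D.gF ts') :
    jacSum l (I.map D.ofF) O ts = 0 := by
  induction ts' generalizing I O ts with
  | nil =>
    subst hts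
    have := hl.vanish_zero (I.map Prod.snd)
    rw [List.map_map] at this
    simp only [List.map_nil, jacSum, List.map_map]
    have e : (Prod.snd ∘ D.ofF) = ((fun t => ((0 : D.Lp), t)) ∘ (Prod.snd : ℤ × F → F)) := rfl
    rw [e, this, listOp_cons_zero]
  | cons t ts' ih =>
    subst hts
    rw [homogeneousList_cons] at h'
    rw [List.map_cons, jacSum]
    have := ih (I ++ [t]) O _ (homogeneousList_append.2 ⟨h, homogeneousList_cons.2
      ⟨h'.1, homogeneousList_nil⟩⟩) rfl h'.2
    rw [List.map_append, List.map_singleton] at this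
    rw [this, ih I _ _ h rfl h'.2, smul_zero, add_zero]

theorem IsModified.inner_two_more (f g : D.Lp) (a b : ℤ) (I O xs : List (ℤ × D.Tot)) (hI : I ≠ [])
    (h : ∀ x ∈ I, x.2.1 = 0 ∨ x.2.2 = 0) (h' : ∀ x ∈ xs, x.2.1 = 0 ∨ x.2.2 = 0) :
    jacSum l (D.ofL a f :: D.ofL b g :: I) O xs = 0 := by
  induction xs generalizing I O with
  | nil =>
    simp only [jacSum, List.map_cons]
    have := hl.vanish_two f g (I.map Prod.snd) (by simpa using hI) (by
      intro x hx
      obtain ⟨y, hy, rfl⟩ := List.mem_map.1 hx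
      exact h y hy)
    rw [show (D.ofL a f).2 = (f, 0) from rfl, show (D.ofL b g).2 = (g, 0) from rfl, this,
      listOp_cons_zero]
  | cons x xs ih =>
    rw [List.forall_mem_cons] at h'
    have := ih (I ++ [x]) O (by simp) (by
      intro y hy
      rw [List.mem_append, List.mem_singleton] at hy
      rcases hy with hy | rfl
      · exact h y hy
      · exact h'.1) h'.2
    simp only [jacSum, List.cons_append]
    rw [this, ih I _ hI h h'.2, smul_zero, add_zero]

/-- Once both factors from `s⁻¹ Lp` are inner, any further inner argument kills the term, so only
one distribution survives. -/
theorem IsModified.inner_two (f g : D.Lp) (a b : ℤ) (O xs : List (ℤ × D.Tot))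
    (h' : ∀ x ∈ xs, x.2.1 = 0 ∨ x.2.2 = 0) :
    jacSum l [D.ofL a f, D.ofL b g] O xs =
      listOp l (listOp l [(f, 0), (g, 0)] :: (O ++ xs).map Prod.snd) := by
  induction xs generalizing O with
  | nil =>
    simp only [jacSum, List.map_cons, List.append_nil]
    rfl
  | cons x xs ih =>
    rw [List.forall_mem_cons] at h'
    simp only [jacSum, List.cons_append, List.nil_append]
    rw [hl.inner_two_more f g a b [x] O xs (by simp) (by simpa using h'.1) h'.2, ih _ h'.2, smul_zero,
      zero_add, List.append_assoc, List.singleton_append]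

/-- The term with inner arguments `f, I` and outer arguments `g, O`. -/
theorem IsModified.nested_two {f g : D.Lp} {a b : ℤ} (hf : (f : L) ∈ D.gL a) (hg : (g : L) ∈ D.gL b)
    {I O : List (ℤ × F)} (hI : HomogeneousList D.gF I) (hO : HomogeneousList D.gF O) :
    listOp l (listOp l ((D.ofL a f :: I.map D.ofF).map Prod.snd) ::
        (D.ofL b g :: O.map D.ofF).map Prod.snd) =
      -((sg k (a + degSum I) * lam ^ (a + b + 1 - I.length - O.length)) •
        ((0, D.P (D.br (D.ι (D.P (D.iter f I))) (D.iter g O))) : D.Tot)) := by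
  have hmap : ∀ ts : List (ℤ × F), (ts.map D.ofF).map Prod.snd =
      ts.map fun t => ((0 : D.Lp), t.2) := by
    intro ts; rw [List.map_map]; rfl
  have hF := D.iter_mem hf hI
  have hG := D.iter_mem hg hO
  rcases I with _ | ⟨t, I⟩
  -- Without inner arguments from `F` the left side contains `l'_1 = 0`, and on the right `P f = 0`.
  · have : listOp l ((D.ofL a f :: ([] : List (ℤ × F)).map D.ofF).map Prod.snd) = 0 := hl.one _
    rw [this, List.map_cons, listOp_cons_zero, iter_nil, D.P_Lp f.2]
    simp only [map_zero, LinearMap.zero_apply, Prod.mk_zero_zero, smul_zero, neg_zero]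
  set F' := D.iter f (t :: I) with hF'
  set w := D.P F' with hw
  have hin : listOp l ((D.ofL a f :: (t :: I).map D.ofF).map Prod.snd) =
      lam ^ (a + 1 - (t :: I).length) • ((0, w) : D.Tot) := by
    have := hl.mixed a f (t :: I) hf (by simp)
    rw [List.map_cons, hmap, show (D.ofL a f).2 = (f, 0) from rfl, this]
    simp [hw, hF']
  have hwm : w ∈ D.gF (a + degSum (t :: I)) := D.P_mem hF
  have hw' : ((0, w) : D.Tot) ∈ D.grading (a + degSum (t :: I)) := ⟨(D.gL _).zero_mem, hwm⟩
  -- The inner value `w` is moved behind `g`, so that the formula for mixed products applies to `g,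
  -- w, O`.
  have hsw := listOp_swap hl.symm [] (O.map D.ofF) (a + degSum (t :: I), ((0, w) : D.Tot)) (D.ofL b g)
    (homogeneousList_cons.2 ⟨hw', homogeneousList_cons.2 ⟨D.ofL_mem hg, D.homogeneous_map_ofF.2 hO⟩⟩)
  simp only [List.nil_append, List.map_cons] at hsw
  have hout := hl.mixed b g ((a + degSum (t :: I), w) :: O) hg (by simp)
  rw [List.map_cons, ← hmap] at hout
  rw [hin, listOp_cons_smul, List.map_cons, hsw, show (D.ofL b g).2 = (g, 0) from rfl]
  rw [hout, iter_cons, D.iter_br_ι hg hwm hO, D.br_symm hG (D.ι_mem hwm)]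
  -- The powers of `lam` may be combined only if both exponents are nonnegative. A negative exponent
  -- means that more elements of `F` are bracketed in than the degree allows, and then the whole
  -- term is zero.
  have hPz : ∀ c : k, D.P (D.br (D.ι w) (D.iter g O)) = 0 ∨ (0 ≤ a + 1 - ((t :: I).length : ℤ) ∧
      0 ≤ b + 1 - (((a + degSum (t :: I), w) :: O).length : ℤ)) := by
    intro c
    by_cases h1 : 0 ≤ a + 1 - ((t :: I).length : ℤ)
    · by_cases h2 : 0 ≤ b + 1 - (((a + degSum (t :: I), w) :: O).length : ℤ)
      · exact Or.inr ⟨h1, h2⟩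
      · left
        -- This concerns the wanted element only up to a sign; multiplying by the same sign once
        -- more removes it.
        have := D.P_iter_eq_zero g.2 hg ((a + degSum (t :: I), w) :: O) (by omega)
        rw [iter_cons, D.iter_br_ι hg hwm hO, D.br_symm hG (D.ι_mem hwm)] at this
        simp only [map_neg, map_smul, smul_neg, smul_smul, ← sg_add, neg_eq_zero] at this
        have h3 := congrArg (fun z => sg k ((a + degSum (t :: I)) * degSum O +
          (b + degSum O) * (a + degSum (t :: I))) • z) this
        simpa only [smul_smul, sg_mul_self, one_smul, smul_zero] using h3
    · left
      rw [hw, hF', D.P_iter_eq_zero f.2 hf _ (by omega)]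
      simp
  rcases hPz 1 with h | ⟨h1, h2⟩
  · simp [h]
  · have hexp : a + b + 1 - ((t :: I).length : ℤ) - O.length = (a + 1 - ((t :: I).length : ℤ)) +
        (b + 1 - (((a + degSum (t :: I), w) :: O).length : ℤ)) := by
      simp only [List.length_cons]; push_cast; ring
    rw [hexp, ← zpow_add_of_nonneg lam h1 h2]
    have hs : sg k (a + degSum (t :: I)) = sg k ((a + degSum (t :: I)) * (b - 1)) *
        (sg k ((a + degSum (t :: I)) * degSum O) *
          sg k ((b + degSum O) * (a + degSum (t :: I)))) := by
      rw [← sg_add, ← sg_add]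
      exact sg_congr k ⟨(a + degSum (t :: I)) * (1 - b - degSum O), by ring⟩
    rw [hs]
    refine Prod.ext ?_ ?_
    · simp [ofL]
    · simp only [ofL, Prod.snd_neg, Prod.smul_mk, map_neg, map_smul]
      module

/-- The Jacobi identity for two elements of `s⁻¹ Lp`, in terms of iterated brackets. -/
theorem IsModified.jacSum_two_sub {f g : D.Lp} {a b : ℤ} (hf : (f : L) ∈ D.gL a)
    (hg : (g : L) ∈ D.gL b) {I O ts : List (ℤ × F)} (hI : HomogeneousList D.gF I)
    (hO : HomogeneousList D.gF O) (hts : HomogeneousList D.gF ts) {dF dG e : ℤ}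
    (hdF : dF = a + degSum I) (hdG : dG = b + degSum O)
    (he : e = a + b + 1 - I.length - O.length - ts.length) :
    jacSum l (D.ofL a f :: I.map D.ofF) (D.ofL b g :: O.map D.ofF) (ts.map D.ofF) -
        sg k (dF + dG + dF * dG) •
          jacSum l (D.ofL b g :: O.map D.ofF) (D.ofL a f :: I.map D.ofF) (ts.map D.ofF) =
      -((sg k dF * lam ^ e) •
        ((0, D.P (D.iter (D.br (D.iter f I) (D.iter g O)) ts)) : D.Tot)) := by
  induction ts generalizing I O dF dG with
  -- With all arguments distributed, write `F` and `G` for the iterated brackets. The two nested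
  -- terms are multiples of `P[PF, G]` and `P[PG, F]`, and `P_br` together with antisymmetry
  -- combines them into `P[F, G]`.
  | nil =>
    have hF := D.iter_mem hf hI
    have hG := D.iter_mem hg hO
    rw [← hdF] at hF
    rw [← hdG] at hG
    simp only [List.map_nil, jacSum, iter_nil]
    rw [hl.nested_two hf hg hI hO, hl.nested_two hg hf hO hI, ← hdF, ← hdG,
      D.P_br (D.iter f I) (D.iter g O), D.br_symm (D.ι_mem (D.P_mem hG)) hF]
    have e1 : e = a + b + 1 - I.length - O.length := by simp [he]
    have e2 : e = b + a + 1 - O.length - I.length := by rw [e1]; ring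
    rw [← e1, ← e2]
    have hs : sg k dF = sg k (dF + dG + dF * dG) * (sg k dG * sg k (dG * dF)) := by
      rw [← sg_add, ← sg_add]
      exact sg_congr k ⟨- dG - dG * dF, by ring⟩
    refine Prod.ext ?_ ?_
    · simp
    · simp only [Prod.smul_snd, Prod.snd_neg, Prod.smul_mk, map_neg, map_smul, Prod.snd_sub]
      linear_combination (norm := module) (lam ^ e • hs) • (D.P (D.br (D.iter f I) (D.ι (D.P (D.iter g O)))))
  -- Bracketing with `t` is a graded derivation of `[F, G]`. Its two summands correspond to giving
  -- `t` to `f` or to `g`, that is, to the two branches of `jacSum`.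
  | cons t ts ih =>
    rw [homogeneousList_cons] at hts
    have ht : HomogeneousList D.gF [t] := homogeneousList_cons.2 ⟨hts.1, homogeneousList_nil⟩
    have hF := D.iter_mem hf hI
    have hG := D.iter_mem hg hO
    rw [← hdF] at hF
    rw [← hdG] at hG
    have h1 := ih (I := I ++ [t]) (O := O) (dF := dF + t.1) (dG := dG)
      (homogeneousList_append.2 ⟨hI, ht⟩) hO hts.2 (by simp [hdF]; ring) hdG (by simp [he]; ring)
    have h2 := ih (I := I) (O := O ++ [t]) (dF := dF) (dG := dG + t.1)
      hI (homogeneousList_append.2 ⟨hO, ht⟩) hts.2 hdF (by simp [hdG]; ring) (by simp [he]; ring)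
    simp only [List.map_append, List.map_singleton, iter_append, iter_cons, iter_nil] at h1 h2
    simp only [List.map_cons, jacSum, List.cons_append, degSum_cons, degSum_map_ofF, iter_cons]
    rw [D.br_jacobi hF hG (D.ι_mem hts.1), iter_add, iter_smul, map_add, map_smul]
    have d1 : (D.ofF t).1 * ((D.ofL b g).1 + degSum O) = t.1 * (dG - 1) := by
      simp only [ofL, ofF, hdG]; ring
    have d2 : (D.ofF t).1 * ((D.ofL a f).1 + degSum I) = t.1 * (dF - 1) := by
      simp only [ofL, ofF, hdF]; ring
    rw [d1, d2]
    have s1 : sg k (t.1 * (dG - 1)) * sg k (dF + t.1 + dG + (dF + t.1) * dG) =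
        sg k (dF + dG + dF * dG) := by
      rw [← sg_add]
      exact sg_congr k ⟨t.1 * dG, by ring⟩
    have s2 : sg k (dF + (dG + t.1) + dF * (dG + t.1)) =
        sg k (dF + dG + dF * dG) * sg k (t.1 * (dF - 1)) := by
      rw [← sg_add]
      exact sg_congr k ⟨t.1, by ring⟩
    have s3 : sg k (t.1 * (dG - 1)) * sg k (dF + t.1) = sg k dF * sg k (dG * t.1) := by
      rw [← sg_add, ← sg_add]
      exact sg_congr k ⟨0, by ring⟩
    have h1' := congrArg (fun z => sg k (t.1 * (dG - 1)) • z) h1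
    simp only [smul_sub, smul_neg, smul_smul] at h1'
    rw [s1, ← mul_assoc, s3] at h1'
    rw [s2] at h2
    have hsplit : ∀ (c : k) (u v : F), ((0, u + c • v) : D.Tot) = (0, u) + c • (0, v) := by
      intro c u v; simp
    rw [hsplit]
    linear_combination (norm := module) h1' + h2

/-- With both `f` and `g` outer nothing remains; with both inner there is the single term `l'(l'(f,
g), ts)`. By `jacSum_two_sub` the terms that separate `f` from `g` add up to its negative. -/
theorem IsModified.jacSum_two {f g : D.Lp} {a b : ℤ} (hf : (f : L) ∈ D.gL a)
    (hg : (g : L) ∈ D.gL b) {ts : List (ℤ × F)} (hts : HomogeneousList D.gF ts) :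
    jacSum l [] [] (D.ofL a f :: D.ofL b g :: ts.map D.ofF) = 0 := by
  have hp : ∀ x ∈ ts.map D.ofF, x.2.1 = 0 ∨ x.2.2 = 0 := by
    intro x hx
    obtain ⟨t, -, rfl⟩ := List.mem_map.1 hx
    exact Or.inl rfl
  have h0 := hl.inner_ofF [] [D.ofL a f, D.ofL b g] _ homogeneousList_nil ts rfl hts
  have h1 := hl.inner_two f g a b [] (ts.map D.ofF) hp
  have h2 := hl.jacSum_two_sub hf hg (I := []) (O := []) homogeneousList_nil homogeneousList_nil hts
    rfl rfl rfl
  simp only [List.map_nil, degSum_nil, add_zero, iter_nil, List.length_nil, Nat.cast_zero,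
    sub_zero] at h2
  simp only [List.map_nil] at h0
  have h3 : listOp l (listOp l [(f, 0), (g, 0)] :: ([] ++ ts.map D.ofF).map Prod.snd) =
      (sg k a * lam ^ (a + b + 1 - ts.length)) • ((0, D.P (D.iter (D.br f g) ts)) : D.Tot) := by
    rw [hl.two a f g hf, listOp_cons_smul, List.nil_append, mul_smul]
    congr 1
    -- The formula for mixed products needs at least one element of `F`. Without any, both sides
    -- vanish, since `l'_1 = 0` and `[f, g]` lies in the kernel of `P`.
    rcases ts with _ | ⟨t, ts⟩
    · rw [iter_nil, D.P_Lp (D.br_Lp f.2 g.2)]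
      rw [Prod.mk_zero_zero, smul_zero]
      exact hl.one (D.brLp f g, 0)
    · have := hl.mixed (a + b) (D.brLp f g) (t :: ts) (D.br_mem hf hg) (by simp)
      rw [List.map_map, Prod.smul_mk, smul_zero]
      exact this
  simp only [jacSum, List.nil_append, List.singleton_append, degSum_nil, degSum_cons, mul_zero,
    sg_zero, one_smul, add_zero, h0]
  rw [h1, h3]
  have s1 : sg k ((D.ofL b g).1 * (D.ofL a f).1) = - sg k (a + b + a * b) := by
    rw [neg_eq_sg_add_one]
    exact sg_congr k ⟨-a - b, by simp only [ofL]; ring⟩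
  rw [s1]
  linear_combination (norm := module) h2

/-- Only the three terms `l'_2(l'_2(·, ·), ·)` survive; the sign `(-1)^{|f|}` and the degree shift
turn their sum into the graded Jacobi identity of `Lp`. -/
theorem IsModified.jacSum_three {f g h : D.Lp} {a b c : ℤ} (hf : (f : L) ∈ D.gL a)
    (hg : (g : L) ∈ D.gL b) (hh : (h : L) ∈ D.gL c) :
    jacSum l [] [] [D.ofL a f, D.ofL b g, D.ofL c h] = 0 := by
  have h3 : listOp l [((f, 0) : D.Tot), (g, 0), (h, 0)] = 0 :=
    hl.vanish_two f g [(h, 0)] (by simp) (by simp)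
  have nested : ∀ {f g h : D.Lp} {a b : ℤ}, (f : L) ∈ D.gL a → (g : L) ∈ D.gL b →
      listOp l [listOp l [(f, 0), (g, 0)], (h, 0)] = sg k b • (D.brLp (D.brLp f g) h, 0) := by
    intro f g h a b hf hg
    rw [hl.two a f g hf, listOp_cons_smul, hl.two (a + b) _ _ (D.br_mem hf hg), smul_smul, ← sg_add]
    congr 1
    exact sg_congr k ⟨a, by ring⟩
  have e : ∀ (x : D.Lp) (n : ℤ), (D.ofL n x).2 = (x, 0) := fun _ _ => rfl
  simp only [jacSum, List.nil_append, List.cons_append, List.map_cons, List.map_nil, e, hl.one,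
    listOp_nil, listOp_cons_zero, h3, smul_zero, zero_add, add_zero, nested hf hg, nested hf hh,
    nested hg hh]
  have hj : D.brLp (D.brLp f g) h = -(sg k (a * (b + c)) • D.brLp (D.brLp g h) f) +
      sg k (b * c) • D.brLp (D.brLp f h) g := by
    refine Subtype.ext ?_
    have h1 := D.br_jacobi hf hg hh
    rw [D.br_symm hf (D.br_mem hg hh)] at h1
    simpa [brLp] using h1
  rw [hj]
  simp only [degSum_nil, degSum_cons, mul_zero, sg_zero, one_smul, add_zero, smul_smul, ← sg_add,
    ofL]
  refine Prod.ext ?_ ?_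
  · simp only [Prod.fst_add, Prod.smul_fst, smul_add, smul_neg, smul_smul, Prod.fst_zero]
    have s1 : sg k ((c - 1) * (b - 1) + c) = - (sg k b * sg k (b * c)) := by
      rw [← sg_add, neg_eq_sg_add_one]
      exact sg_congr k ⟨-b, by ring⟩
    have s2 : sg k ((b - 1) * (a - 1) + ((c - 1) * (a - 1) + c)) =
        sg k b * sg k (a * (b + c)) := by
      rw [← sg_add]
      exact sg_congr k ⟨1 - a - b, by ring⟩
    rw [s1, s2]
    module
  · simp

/-- The modified brackets satisfy the generalised Jacobi identity. -/
theorem IsModified.jacobi (xs : List (ℤ × D.Tot)) (hx : HomogeneousList D.grading xs) :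
    jacSum l [] [] xs = 0 := by
  refine homogeneousList_induction (p := fun x : D.Tot => x.1 = 0 ∨ x.2 = 0)
    (Q := fun T => jacSum l [] [] T = 0) ?_ ?_ ?_ xs hx
  · rintro d ⟨f, t⟩ hx
    exact ⟨(f, 0), (0, t), by simp, ⟨hx.1, (D.gF _).zero_mem⟩, ⟨(D.gL _).zero_mem, hx.2⟩,
      Or.inr rfl, Or.inl rfl⟩
  · intro L₁ L₂ d a b ha hb
    rw [jacSum_add, ha, hb, add_zero]
  -- Now every entry lies in one of the two summands; sorting the entries costs only a scalar.
  intro T hT hp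
  obtain ⟨T, rfl⟩ := D.exists_tagged T hp
  obtain ⟨fs, ts, hperm, -, -⟩ := D.tagged_perm T
  have hperm' := hperm.map D.toTot
  obtain ⟨u, hu⟩ := jacSum_perm hl.symm hl.degree hperm' hT
  rw [hu [] [] homogeneousList_nil homogeneousList_nil]
  have h' : HomogeneousList D.grading ((fs.map Sum.inl ++ ts.map Sum.inr).map D.toTot) :=
    fun a ha => hT a (hperm'.mem_iff.2 ha)
  clear hu hperm hperm' hT hp T hx
  have hts : HomogeneousList D.gF ts := by
    intro a ha
    exact D.ofF_mem.1 (h' (D.ofF a) (List.mem_map.2 ⟨Sum.inr a,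
      List.mem_append_right _ (List.mem_map_of_mem ha), rfl⟩))
  have hfs : ∀ f ∈ fs, (f.2 : L) ∈ D.gL f.1 := by
    intro f hf
    exact D.mem_of_ofL_mem (h' (D.ofL f.1 f.2) (List.mem_map.2 ⟨Sum.inl f,
      List.mem_append_left _ (List.mem_map_of_mem hf), rfl⟩))
  have hnum : D.numL (fs.map Sum.inl ++ ts.map Sum.inr) = fs.length := by
    simp [numL, List.countP_map, Function.comp_def]
  suffices H : jacSum l [] [] ((fs.map Sum.inl ++ ts.map Sum.inr).map D.toTot) = 0 by
    rw [H, smul_zero]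
  by_cases h2 : fs.length = 2
  · obtain ⟨f, g, rfl⟩ := List.length_eq_two.1 h2
    have := hl.jacSum_two (hfs f (by simp)) (hfs g (by simp)) hts
    have e : (List.map Sum.inl [f, g] ++ ts.map Sum.inr).map D.toTot =
        D.ofL f.1 f.2 :: D.ofL g.1 g.2 :: ts.map D.ofF := by
      simp [toTot, Function.comp_def]
    rw [e, this]
  by_cases h3 : fs.length = 3 ∧ ts = []
  · obtain ⟨h3, rfl⟩ := h3
    obtain ⟨f, g, h, rfl⟩ := List.length_eq_three.1 h3
    exact hl.jacSum_three (hfs f (by simp)) (hfs g (by simp)) (hfs h (by simp))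
  -- For any other numbers of factors each nested term vanishes by itself.
  · refine jacSum_map_eq_zero D.toTot l [] [] _ fun I O hp => ?_
    rw [List.nil_append, List.nil_append] at hp
    have hnum' : D.numL (I ++ O) = fs.length := by rw [← hnum]; exact hp.countP_eq _
    refine hl.nested_eq_zero I O (fun a ha => h' a ((hp.map D.toTot).mem_iff.1 ha))
      (by omega) fun h => ?_
    have hlen := hp.length_eq
    rw [List.length_append (as := fs.map Sum.inl), List.length_map, List.length_map] at hlen
    have : 0 < ts.length := List.length_pos_iff.2 fun e => h3 ⟨by omega, e⟩
    omega

end DerivedData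

/-! ### Construction of multilinear operations from operations on lists -/

section OfList

variable {k : Type*} [Field k] {E : Type*} [AddCommGroup E] [Module k E]

theorem ofFn_eq_append {X : Type*} {n : ℕ} (x : Fin n → X) (i : Fin n) :
    ∃ L₁ L₂ : List X, ∀ b, List.ofFn (Function.update x i b) = L₁ ++ b :: L₂ := by
  have h : List.ofFn x = (List.ofFn x).take i ++ x i :: (List.ofFn x).drop (i + 1) := by
    have hi : (i : ℕ) < (List.ofFn x).length := by simp
    have := List.take_append_drop i (List.ofFn x)
    rw [List.drop_eq_getElem_cons hi] at this
    simpa using this.symm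
  refine ⟨_, _, fun b => (ofFn_update x _ _ (x i) b i ?_ h.symm).symm⟩
  simp

/-- The multilinear operations given by an operation on lists that is linear in every entry. -/
def bracketsOfList (o : List E → E)
    (ho : ∀ (L₁ L₂ : List E) (c : k) (a b : E),
      o (L₁ ++ (c • a + b) :: L₂) = c • o (L₁ ++ a :: L₂) + o (L₁ ++ b :: L₂)) : Brackets k E :=
  fun n =>
  { toFun := fun x => o (List.ofFn x)
    map_update_add' := by
      intro hdec x i a b
      have hd : hdec = instDecidableEqFin _ := Subsingleton.elim _ _
      subst hd
      obtain ⟨L₁, L₂, h⟩ := ofFn_eq_append x i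
      have := ho L₁ L₂ 1 a b
      rw [one_smul, one_smul] at this
      rw [h, h, h, this]
    map_update_smul' := by
      intro hdec x i c a
      have hd : hdec = instDecidableEqFin _ := Subsingleton.elim _ _
      subst hd
      obtain ⟨L₁, L₂, h⟩ := ofFn_eq_append x i
      -- Additivity at `0 + 0` shows that a zero entry gives zero, so homogeneity follows by taking
      -- `b = 0`.
      have h0 := ho L₁ L₂ 1 0 0
      rw [one_smul, one_smul, add_zero, left_eq_add] at h0
      have := ho L₁ L₂ c a 0
      rw [add_zero, h0, add_zero] at this
      rw [h, h, this] }

theorem bracketsOfList_apply (o : List E → E)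
    (ho : ∀ (L₁ L₂ : List E) (c : k) (a b : E),
      o (L₁ ++ (c • a + b) :: L₂) = c • o (L₁ ++ a :: L₂) + o (L₁ ++ b :: L₂)) (n : ℕ)
    (x : Fin (n + 1) → E) : bracketsOfList o ho n x = o (List.ofFn x) := rfl

theorem ofFn_comp_swap {X : Type*} {n : ℕ} (z : Fin (n + 1) → X) (i : Fin n) :
    ∃ L₁ L₂ : List X, List.ofFn z = L₁ ++ z i.castSucc :: z i.succ :: L₂ ∧
      List.ofFn (fun j => z (Equiv.swap i.castSucc i.succ j)) =
        L₁ ++ z i.succ :: z i.castSucc :: L₂ := by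
  have h1 : (i : ℕ) < (List.ofFn z).length := by rw [List.length_ofFn]; omega
  have h2 : (i : ℕ) + 1 < (List.ofFn z).length := by rw [List.length_ofFn]; omega
  have h : List.ofFn z = (List.ofFn z).take i ++ z i.castSucc :: z i.succ ::
      (List.ofFn z).drop (i + 1 + 1) := by
    have := List.take_append_drop i (List.ofFn z)
    rw [List.drop_eq_getElem_cons h1, List.drop_eq_getElem_cons h2, List.getElem_ofFn,
      List.getElem_ofFn] at this
    exact this.symm
  have hu : (fun j => z (Equiv.swap i.castSucc i.succ j)) =
      Function.update (Function.update z i.castSucc (z i.succ)) i.succ (z i.castSucc) := by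
    funext j
    rw [Equiv.swap_apply_def]
    by_cases h1 : j = i.succ
    · subst h1
      rw [Function.update_self, if_neg (Fin.castSucc_lt_succ (i := i)).ne', if_pos rfl]
    · rw [Function.update_of_ne h1]
      by_cases h2 : j = i.castSucc
      · subst h2; rw [Function.update_self, if_pos rfl]
      · rw [Function.update_of_ne h2, if_neg h2, if_neg h1]
  have hlen : ((List.ofFn z).take i).length = i := by
    rw [List.length_take, List.length_ofFn]; omega
  refine ⟨_, _, h, ?_⟩
  have e1 := ofFn_update z _ _ _ (z i.succ) i.castSucc (by rw [hlen]; simp) h.symm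
  have e2 := ofFn_update _ ((List.ofFn z).take i ++ [z i.succ]) ((List.ofFn z).drop (i + 1 + 1))
    (z i.succ) (z i.castSucc) i.succ (by rw [List.length_append, hlen]; rfl)
    (by rw [List.append_assoc, List.singleton_append]; exact e1)
  rw [hu, ← e2, List.append_assoc, List.singleton_append]

theorem gradedSymmetric_bracketsOfList {𝒢 : ℤ → Submodule k E} (o : List E → E)
    (ho : ∀ (L₁ L₂ : List E) (c : k) (a b : E),
      o (L₁ ++ (c • a + b) :: L₂) = c • o (L₁ ++ a :: L₂) + o (L₁ ++ b :: L₂))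
    (h : ∀ (L₁ L₂ : List (ℤ × E)) (a b : ℤ × E), HomogeneousList 𝒢 (L₁ ++ a :: b :: L₂) →
      o ((L₁ ++ a :: b :: L₂).map Prod.snd) =
        sg k (a.1 * b.1) • o ((L₁ ++ b :: a :: L₂).map Prod.snd)) :
    GradedSymmetric 𝒢 (bracketsOfList o ho) := by
  rw [gradedSymmetric_iff_swap]
  intro n d x hx i
  obtain ⟨L₁, L₂, h1, h2⟩ := ofFn_comp_swap (fun j => (d j, x j)) i
  have hL : HomogeneousList 𝒢 (L₁ ++ (d i.succ, x i.succ) :: (d i.castSucc, x i.castSucc) :: L₂) := by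
    rw [← h2]
    intro a ha
    obtain ⟨j, rfl⟩ := (List.mem_ofFn' _ _).1 ha
    exact hx _
  have := h _ _ _ _ hL
  rw [← h1, ← h2, List.map_ofFn, List.map_ofFn] at this
  rw [bracketsOfList_apply, bracketsOfList_apply, units_smul_eq (k := k), mul_comm]
  exact this

end OfList

/-! ### Explicit construction of the modified brackets. -/

namespace DerivedData

variable {k L F : Type*} [Field k] [AddCommGroup L] [Module k L] [AddCommGroup F] [Module k F]
  (D : DerivedData k L F)

@[simp] theorem iterF_cons (f : L) (t : F) (ts : List F) :
    D.iterF f (t :: ts) = D.iterF (D.br f (D.ι t)) ts := rfl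

theorem iterF_append (f : L) (ts ts' : List F) :
    D.iterF f (ts ++ ts') = D.iterF (D.iterF f ts) ts' := by
  simp [iterF]

theorem iterF_lin (c : k) (f g : L) (ts : List F) :
    D.iterF (c • f + g) ts = c • D.iterF f ts + D.iterF g ts := by
  induction ts generalizing f g with
  | nil => rfl
  | cons t ts ih => simp [ih]

theorem iterF_smul (c : k) (f : L) (ts : List F) : D.iterF (c • f) ts = c • D.iterF f ts := by
  induction ts generalizing f with
  | nil => rfl
  | cons t ts ih => simp [ih]

theorem iterF_zero (ts : List F) : D.iterF 0 ts = 0 := by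
  simpa using D.iterF_smul 0 0 ts

theorem iterF_lin_mid (c : k) (f : L) (s t : F) (A B : List F) :
    D.iterF f (A ++ (c • s + t) :: B) = c • D.iterF f (A ++ s :: B) + D.iterF f (A ++ t :: B) := by
  simp only [iterF_append, iterF_cons, map_add, map_smul, iterF_lin]

theorem iterF_eq_zero_of_mem (f : L) (ts : List F) (h : (0 : F) ∈ ts) : D.iterF f ts = 0 := by
  obtain ⟨A, B, rfl⟩ := List.append_of_mem h
  rw [iterF_append, iterF_cons, map_zero, map_zero, iterF_zero]

/-- The weight of the operation with `n` arguments from `F`, restricted to elements of even or odd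
degree. -/
def weight (lam : k) (even : Bool) (n : ℕ) (a : ℤ) : k :=
  if decide (Even a) = even then lam ^ (a + 1 - n) else 0

/-- The contribution of `x` to the mixed operation, where `pre` precedes and `post` follows `x`. -/
def mixedTerm (lam : k) (pre : List F) (f : L) (post : List F) : F :=
  D.P (D.iterF (D.scL (weight lam true (pre.length + post.length)) f)
      (pre.map (D.scF (sg k)) ++ post)) +
    D.P (D.iterF (D.scL (weight lam false (pre.length + post.length)) f) (pre ++ post))

/-- The mixed operation. -/
def mixedOp (lam : k) : List F → List D.Tot → F
  | _, [] => 0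
  | pre, x :: xs => D.mixedTerm lam pre x.1 (xs.map Prod.snd) + mixedOp lam (pre ++ [x.2]) xs

theorem mixedTerm_lin (lam : k) (pre post : List F) (c : k) (f g : L) :
    D.mixedTerm lam pre (c • f + g) post =
      c • D.mixedTerm lam pre f post + D.mixedTerm lam pre g post := by
  simp only [mixedTerm, map_add, map_smul, iterF_lin, smul_add]
  abel

theorem mixedTerm_lin_pre (lam : k) (A B post : List F) (c : k) (f : L) (s t : F) :
    D.mixedTerm lam (A ++ (c • s + t) :: B) f post =
      c • D.mixedTerm lam (A ++ s :: B) f post + D.mixedTerm lam (A ++ t :: B) f post := by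
  simp only [mixedTerm, List.map_append, List.map_cons, map_add, map_smul, List.append_assoc,
    List.cons_append, iterF_lin_mid, smul_add, List.length_append, List.length_cons]
  abel

theorem mixedTerm_lin_post (lam : k) (A B pre : List F) (c : k) (f : L) (s t : F) :
    D.mixedTerm lam pre f (A ++ (c • s + t) :: B) =
      c • D.mixedTerm lam pre f (A ++ s :: B) + D.mixedTerm lam pre f (A ++ t :: B) := by
  simp only [mixedTerm, ← List.append_assoc, iterF_lin_mid, smul_add, List.length_append,
    List.length_cons, map_add, map_smul]
  abel

theorem mixedTerm_zero (lam : k) (pre post : List F) : D.mixedTerm lam pre 0 post = 0 := by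
  simp [mixedTerm, iterF_zero]

theorem mixedTerm_eq_zero (lam : k) (pre post : List F) (f : L) (h : (0 : F) ∈ pre ++ post) :
    D.mixedTerm lam pre f post = 0 := by
  rw [mixedTerm, D.iterF_eq_zero_of_mem _ _ h, D.iterF_eq_zero_of_mem, map_zero, add_zero]
  rw [List.mem_append] at h ⊢
  refine h.imp_left fun h => ?_
  exact List.mem_map.2 ⟨0, h, map_zero _⟩

/-- The sign is that of moving `s⁻¹f`, of degree `a - 1`, past `pre`. It depends on the parity of
`a`, which is not defined for inhomogeneous `f`. Splitting `f` into even and odd parts, and twisting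
`pre` only for the even part, where `a - 1` is odd, makes the formula linear. -/
theorem mixedTerm_of_mem (lam : k) (pre : List (ℤ × F)) (f : L) (post : List F) (a : ℤ)
    (hf : f ∈ D.gL a) (hpre : HomogeneousList D.gF pre) :
    D.mixedTerm lam (pre.map Prod.snd) f post =
      (sg k ((a - 1) * degSum pre) * lam ^ (a + 1 - (pre.length + post.length : ℕ))) •
        D.P (D.iterF f (pre.map Prod.snd ++ post)) := by
  have key : ∀ g, D.iterF g ((pre.map Prod.snd).map (D.scF (sg k)) ++ post) =
      sg k (degSum pre) • D.iterF g (pre.map Prod.snd ++ post) := by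
    intro g
    induction pre generalizing g with
    | nil => simp
    | cons t pre ih =>
      rw [homogeneousList_cons] at hpre
      simp only [List.map_cons, List.cons_append, iterF_cons]
      rw [D.scF_of_mem _ hpre.1, map_smul, map_smul, iterF_smul, ih hpre.2, smul_smul, ← sg_add,
        degSum_cons]
  rw [mixedTerm, key, D.scL_of_mem _ hf, D.scL_of_mem _ hf, List.length_map, iterF_smul, iterF_smul]
  simp only [weight]
  rcases Int.even_or_odd a with ha | ha
  · have hs : sg k ((a - 1) * degSum pre) = sg k (degSum pre) := by
      obtain ⟨c, rfl⟩ := ha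
      exact sg_congr k ⟨(c - 1) * degSum pre, by ring⟩
    simp only [ha, decide_true, if_true, Bool.true_eq_false, if_false, zero_smul, map_zero,
      add_zero, map_smul, smul_smul, hs]
  · have hs : sg k ((a - 1) * degSum pre) = 1 := by
      obtain ⟨c, rfl⟩ := ha
      exact sg_even k ⟨c * degSum pre, by ring⟩
    have ha' : ¬ Even a := by rwa [Int.not_even_iff_odd]
    simp only [ha', decide_false, if_true, Bool.false_eq_true, if_false, zero_smul, map_zero,
      zero_add, map_smul, hs, one_mul, smul_zero]

theorem mixedOp_lin_pre (lam : k) (A B : List F) (xs : List D.Tot) (c : k) (s t : F) :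
    D.mixedOp lam (A ++ (c • s + t) :: B) xs =
      c • D.mixedOp lam (A ++ s :: B) xs + D.mixedOp lam (A ++ t :: B) xs := by
  induction xs generalizing B with
  | nil => simp [mixedOp]
  | cons x xs ih =>
    simp only [mixedOp, mixedTerm_lin_pre, List.append_assoc, List.cons_append, ih, smul_add]
    abel

theorem mixedOp_lin (lam : k) (pre : List F) (L₁ L₂ : List D.Tot) (c : k) (a b : D.Tot) :
    D.mixedOp lam pre (L₁ ++ (c • a + b) :: L₂) =
      c • D.mixedOp lam pre (L₁ ++ a :: L₂) + D.mixedOp lam pre (L₁ ++ b :: L₂) := by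
  induction L₁ generalizing pre with
  | nil =>
    simp only [mixedOp, List.nil_append, Prod.fst_add, Prod.smul_fst, Prod.snd_add, Prod.smul_snd,
      Submodule.coe_add, Submodule.coe_smul, mixedTerm_lin, mixedOp_lin_pre, smul_add]
    abel
  | cons x xs ih =>
    simp only [mixedOp, List.cons_append, List.map_append, List.map_cons, Prod.snd_add,
      Prod.smul_snd, mixedTerm_lin_post, ih, smul_add]
    abel

theorem mixedOp_eq_zero_of_mem (lam : k) (pre : List F) (h : (0 : F) ∈ pre) (xs : List D.Tot) :
    D.mixedOp lam pre xs = 0 := by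
  induction xs generalizing pre with
  | nil => rfl
  | cons x xs ih =>
    rw [mixedOp, ih _ (List.mem_append_left _ h),
      D.mixedTerm_eq_zero _ _ _ _ (List.mem_append_left _ h), add_zero]

/-- In each summand all entries but one contribute their `F`-component. If two entries have none,
every summand contains a zero. -/
theorem mixedOp_eq_zero_of_two (lam : k) (pre : List F) (L₁ L₂ : List D.Tot) (x y : D.Tot)
    (hx : x.2 = 0) (hy : y.2 = 0) (h : y ∈ L₂) : D.mixedOp lam pre (L₁ ++ x :: L₂) = 0 := by
  induction L₁ generalizing pre with
  | nil =>
    rw [List.nil_append, mixedOp, D.mixedOp_eq_zero_of_mem, D.mixedTerm_eq_zero, add_zero]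
    · exact List.mem_append_right _ (List.mem_map.2 ⟨y, h, hy⟩)
    · simp [hx]
  | cons z L₁ ih =>
    rw [List.cons_append, mixedOp, ih, D.mixedTerm_eq_zero, add_zero]
    exact List.mem_append_right _ (List.mem_map.2 ⟨x, by simp, hx⟩)

theorem mixedOp_eq_zero_of_fst (lam : k) (pre : List F) (xs : List D.Tot) (h : ∀ x ∈ xs, x.1 = 0) :
    D.mixedOp lam pre xs = 0 := by
  induction xs generalizing pre with
  | nil => rfl
  | cons x xs ih =>
    rw [List.forall_mem_cons] at h
    rw [mixedOp, ih _ h.2, h.1, Submodule.coe_zero, D.mixedTerm_zero, add_zero]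

theorem iter_swap {m : ℤ} {f : L} (hf : f ∈ D.gL m) (A B : List (ℤ × F)) (s t : ℤ × F)
    (h : HomogeneousList D.gF (A ++ s :: t :: B)) :
    D.iter f (A ++ s :: t :: B) = sg k (s.1 * t.1) • D.iter f (A ++ t :: s :: B) := by
  rw [homogeneousList_append, homogeneousList_cons, homogeneousList_cons] at h
  simp only [iter_append, iter_cons]
  rw [D.br_ι_comm (D.iter_mem hf h.1) h.2.1 h.2.2.1, iter_smul]

/-- The component in `F` of a homogeneous element. -/
def toF (x : ℤ × D.Tot) : ℤ × F := (x.1, x.2.2)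

theorem homogeneous_map_toF {xs : List (ℤ × D.Tot)} (h : HomogeneousList D.grading xs) :
    HomogeneousList D.gF (xs.map D.toF) := by
  intro a ha
  obtain ⟨x, hx, rfl⟩ := List.mem_map.1 ha
  exact (h x hx).2

theorem mixedTerm_of_mem' (lam : k) (pre : List (ℤ × F)) (x : ℤ × D.Tot) (xs : List (ℤ × D.Tot))
    (hx : x.2 ∈ D.grading x.1) (hpre : HomogeneousList D.gF pre) :
    D.mixedTerm lam (pre.map Prod.snd) x.2.1 ((xs.map Prod.snd).map Prod.snd) =
      (sg k (x.1 * degSum pre) * lam ^ (x.1 + 1 + 1 - (pre.length + xs.length : ℕ))) •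
        D.P (D.iter x.2.1 (pre ++ xs.map D.toF)) := by
  rw [D.mixedTerm_of_mem lam pre _ _ _ hx.1 hpre, add_sub_cancel_right]
  simp only [List.length_map, iter, List.map_append, List.map_map]
  rfl

theorem mixedOp_cons_of_mem (lam : k) (pre : List (ℤ × F)) (x : ℤ × D.Tot) (xs : List (ℤ × D.Tot))
    (hx : x.2 ∈ D.grading x.1) (hpre : HomogeneousList D.gF pre) :
    D.mixedOp lam (pre.map Prod.snd) ((x :: xs).map Prod.snd) =
      (sg k (x.1 * degSum pre) * lam ^ (x.1 + 1 + 1 - (pre.length + xs.length : ℕ))) •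
        D.P (D.iter x.2.1 (pre ++ xs.map D.toF)) +
      D.mixedOp lam ((pre ++ [D.toF x]).map Prod.snd) (xs.map Prod.snd) := by
  rw [List.map_cons, mixedOp, D.mixedTerm_of_mem' lam pre x xs hx hpre, List.map_append]
  rfl

theorem mixedOp_swap_pre (lam : k) (A B : List (ℤ × F)) (s t : ℤ × F) (xs : List (ℤ × D.Tot))
    (h : HomogeneousList D.gF (A ++ s :: t :: B)) (hxs : HomogeneousList D.grading xs) :
    D.mixedOp lam ((A ++ s :: t :: B).map Prod.snd) (xs.map Prod.snd) =
      sg k (s.1 * t.1) • D.mixedOp lam ((A ++ t :: s :: B).map Prod.snd) (xs.map Prod.snd) := by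
  have swap : ∀ {C : List (ℤ × F)}, HomogeneousList D.gF (A ++ s :: t :: C) →
      HomogeneousList D.gF (A ++ t :: s :: C) := by
    intro C h
    simp only [homogeneousList_append, homogeneousList_cons] at h ⊢
    tauto
  induction xs generalizing B with
  | nil => simp [mixedOp]
  | cons x xs ih =>
    rw [homogeneousList_cons] at hxs
    rw [D.mixedOp_cons_of_mem _ _ _ _ hxs.1 h, D.mixedOp_cons_of_mem _ _ _ _ hxs.1 (swap h)]
    have h1 : HomogeneousList D.gF (A ++ s :: t :: (B ++ [D.toF x])) := by
      have : HomogeneousList D.gF ((A ++ s :: t :: B) ++ [D.toF x]) :=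
        homogeneousList_append.2 ⟨h, homogeneousList_cons.2 ⟨hxs.1.2, homogeneousList_nil⟩⟩
      simpa using this
    have h2 := ih (B ++ [D.toF x]) h1 hxs.2
    have h3 := D.iter_swap hxs.1.1 A (B ++ xs.map D.toF) s t (by
      have : HomogeneousList D.gF ((A ++ s :: t :: B) ++ xs.map D.toF) :=
        homogeneousList_append.2 ⟨h, D.homogeneous_map_toF hxs.2⟩
      simpa using this)
    simp only [List.append_assoc, List.cons_append] at h2 h3 ⊢
    rw [h2, h3]
    simp only [degSum_append, degSum_cons, List.length_append, List.length_cons, map_smul, smul_add,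
      add_left_comm]
    module

/-- The summands in which `a` or `b` supplies the element of `Lp` are exchanged with each other. In
all other summands `a` and `b` are adjacent arguments from `F`, whose exchange is `iter_swap`. -/
theorem mixedOp_swap (lam : k) (pre : List (ℤ × F)) (L₁ L₂ : List (ℤ × D.Tot)) (a b : ℤ × D.Tot)
    (hpre : HomogeneousList D.gF pre) (h : HomogeneousList D.grading (L₁ ++ a :: b :: L₂)) :
    D.mixedOp lam (pre.map Prod.snd) ((L₁ ++ a :: b :: L₂).map Prod.snd) =
      sg k (a.1 * b.1) •
        D.mixedOp lam (pre.map Prod.snd) ((L₁ ++ b :: a :: L₂).map Prod.snd) := by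
  induction L₁ generalizing pre with
  | nil =>
    rw [List.nil_append, homogeneousList_cons, homogeneousList_cons] at h
    obtain ⟨ha, hb, hL⟩ := h
    have hpa : HomogeneousList D.gF (pre ++ [D.toF a]) :=
      homogeneousList_append.2 ⟨hpre, homogeneousList_cons.2 ⟨ha.2, homogeneousList_nil⟩⟩
    have hpb : HomogeneousList D.gF (pre ++ [D.toF b]) :=
      homogeneousList_append.2 ⟨hpre, homogeneousList_cons.2 ⟨hb.2, homogeneousList_nil⟩⟩
    -- These are the summands in which the element of `Lp` comes from an entry after `a` and `b`.
    have hsw := D.mixedOp_swap_pre lam pre [] (D.toF a) (D.toF b) L₂ (by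
      simp only [homogeneousList_append, homogeneousList_cons]
      exact ⟨hpre, ha.2, hb.2, homogeneousList_nil⟩) hL
    rw [List.nil_append, List.nil_append, D.mixedOp_cons_of_mem _ _ _ _ ha hpre,
      D.mixedOp_cons_of_mem _ _ _ _ hb hpa, D.mixedOp_cons_of_mem _ _ _ _ hb hpre,
      D.mixedOp_cons_of_mem _ _ _ _ ha hpb]
    simp only [List.append_assoc, List.singleton_append, List.length_append, List.length_cons,
      List.length_nil, List.map_cons, degSum_append, degSum_cons, degSum_nil, add_zero, zero_add]
    rw [hsw]
    have e1 : (D.toF a).1 = a.1 := rfl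
    have e2 : (D.toF b).1 = b.1 := rfl
    rw [e1, e2]
    have s1 : sg k (a.1 * degSum pre) = sg k (a.1 * b.1) * sg k (a.1 * (degSum pre + b.1)) := by
      rw [← sg_add]
      exact sg_congr k ⟨-(a.1 * b.1), by ring⟩
    have s2 : sg k (b.1 * (degSum pre + a.1)) = sg k (a.1 * b.1) * sg k (b.1 * degSum pre) := by
      rw [← sg_add]
      congr 1
      ring
    have n1 : pre.length + (L₂.length + 1) = pre.length + 1 + L₂.length := by ring
    rw [s1, s2, n1]
    module
  | cons x L₁ ih =>
    rw [List.cons_append, homogeneousList_cons] at h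
    have hx : HomogeneousList D.gF (pre ++ [D.toF x]) :=
      homogeneousList_append.2 ⟨hpre, homogeneousList_cons.2 ⟨h.1.2, homogeneousList_nil⟩⟩
    rw [List.cons_append, List.cons_append, D.mixedOp_cons_of_mem _ _ _ _ h.1 hpre,
      D.mixedOp_cons_of_mem _ _ _ _ h.1 hpre, ih _ hx h.2]
    have h3 := D.iter_swap h.1.1 (pre ++ L₁.map D.toF) (L₂.map D.toF) (D.toF a) (D.toF b) (by
      have := D.homogeneous_map_toF h.2
      rw [List.append_assoc, homogeneousList_append]
      exact ⟨hpre, by simpa using this⟩)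
    simp only [List.append_assoc, List.map_append, List.map_cons, List.length_append,
      List.length_cons] at h3 ⊢
    rw [h3, map_smul]
    have e1 : (D.toF a).1 = a.1 := rfl
    have e2 : (D.toF b).1 = b.1 := rfl
    rw [e1, e2]
    module

/-- The binary operation on `s⁻¹ Lp`. -/
def binaryOp : List D.Tot → D.Lp
  | [x, y] => D.brLp ⟨D.scL (sg k) x.1, D.scL_Lp _ x.1.2⟩ y.1
  | _ => 0

theorem binaryOp_lin (L₁ L₂ : List D.Tot) (c : k) (a b : D.Tot) :
    D.binaryOp (L₁ ++ (c • a + b) :: L₂) =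
      c • D.binaryOp (L₁ ++ a :: L₂) + D.binaryOp (L₁ ++ b :: L₂) := by
  rcases L₁ with _ | ⟨x, _ | ⟨y, _ | ⟨z, L₁⟩⟩⟩
  · rcases L₂ with _ | ⟨x, _ | ⟨y, L₂⟩⟩
    · simp [binaryOp]
    · refine Subtype.ext ?_
      simp [binaryOp, brLp]
    · simp [binaryOp]
  · rcases L₂ with _ | ⟨y, L₂⟩
    · refine Subtype.ext ?_
      simp [binaryOp, brLp]
    · simp [binaryOp]
  · simp [binaryOp]
  · simp [binaryOp]

/-- The modified brackets as an operation on lists. -/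
def modifiedOp (lam : k) (xs : List D.Tot) : D.Tot := (D.binaryOp xs, D.mixedOp lam [] xs)

/-- The modified brackets. -/
def modifiedBrackets (lam : k) : Brackets k D.Tot :=
  bracketsOfList (D.modifiedOp lam) fun L₁ L₂ c a b => by
    simp only [modifiedOp, binaryOp_lin, mixedOp_lin]
    rfl

theorem modifiedBrackets_apply (lam : k) (n : ℕ) (x : Fin (n + 1) → D.Tot) :
    D.modifiedBrackets lam n x = (D.binaryOp (List.ofFn x), D.mixedOp lam [] (List.ofFn x)) := rfl

/-- The factor `(-1)^{|f|}` together with the degree shift turns graded antisymmetry of the bracket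
into graded symmetry. -/
theorem binaryOp_swap (L₁ L₂ : List (ℤ × D.Tot)) (a b : ℤ × D.Tot)
    (h : HomogeneousList D.grading (L₁ ++ a :: b :: L₂)) :
    D.binaryOp ((L₁ ++ a :: b :: L₂).map Prod.snd) =
      sg k (a.1 * b.1) • D.binaryOp ((L₁ ++ b :: a :: L₂).map Prod.snd) := by
  rcases L₁ with _ | ⟨x, _ | ⟨y, L₁⟩⟩
  · rcases L₂ with _ | ⟨x, L₂⟩
    · rw [List.nil_append, homogeneousList_cons, homogeneousList_cons] at h
      refine Subtype.ext ?_
      simp only [List.nil_append, List.map_cons, List.map_nil, binaryOp, brLp, Submodule.coe_smul]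
      rw [D.scL_of_mem _ h.1.1, D.scL_of_mem _ h.2.1.1, map_smul, map_smul, LinearMap.smul_apply,
        LinearMap.smul_apply, D.br_symm h.1.1 h.2.1.1, smul_neg, smul_smul, smul_smul, ← neg_smul]
      congr 1
      rw [← sg_add, ← sg_add, neg_eq_sg_add_one]
      exact sg_congr k ⟨a.1 + 1, by ring⟩
    · simp [binaryOp]
  · simp [binaryOp]
  · simp [binaryOp]

theorem modifiedBrackets_symm (lam : k) : GradedSymmetric D.grading (D.modifiedBrackets lam) := by
  refine gradedSymmetric_bracketsOfList _ _ fun L₁ L₂ a b h => ?_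
  have h1 := D.binaryOp_swap L₁ L₂ a b h
  have h2 := D.mixedOp_swap lam [] L₁ L₂ a b homogeneousList_nil h
  rw [List.map_nil] at h2
  rw [modifiedOp, h1, h2]
  rfl

/-- With no argument from `F` the mixed formula gives multiples of `P f`, which is zero on `Lp`;
arity one thus needs no exception in the definition. -/
theorem modifiedBrackets_one (lam : k) : D.modifiedBrackets lam 0 = 0 := by
  ext x : 1
  have e : List.ofFn x = [x 0] := by simp
  rw [modifiedBrackets_apply, e]
  simp only [binaryOp, mixedOp, mixedTerm, List.map_nil, List.append_nil, iterF, List.foldl_nil]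
  rw [D.P_Lp (D.scL_Lp _ (x 0).1.2), D.P_Lp (D.scL_Lp _ (x 0).1.2)]
  simp

theorem modifiedBrackets_two (lam : k) {a : ℤ} {f : D.Lp} (hf : (f : L) ∈ D.gL a) (g : D.Lp) :
    D.modifiedBrackets lam 1 ![(f, 0), (g, 0)] = sg k a • (D.brLp f g, 0) := by
  have e : List.ofFn ![((f, 0) : D.Tot), (g, 0)] = [(f, 0), (g, 0)] := by simp
  have hm : D.mixedOp lam [] [(f, 0), (g, 0)] = 0 :=
    D.mixedOp_eq_zero_of_two lam [] [] [(g, 0)] (f, 0) (g, 0) rfl rfl (by simp)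
  rw [modifiedBrackets_apply, e, hm]
  refine Prod.ext (Subtype.ext ?_) (by simp)
  simp [binaryOp, brLp, D.scL_of_mem _ hf]

theorem modifiedBrackets_mixed (lam : k) {a : ℤ} {f : D.Lp} (hf : (f : L) ∈ D.gL a) (n : ℕ)
    (t : Fin n → F) :
    D.modifiedBrackets lam n (Fin.cons (α := fun _ => D.Tot) (f, 0) fun j => (0, t j)) =
      (0, lam ^ (a + 1 - n) • D.P (D.iterF f (List.ofFn t))) := by
  rw [modifiedBrackets_apply, List.ofFn_cons]
  refine Prod.ext ?_ ?_
  · simp only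
    rcases n with _ | _ | n
    · simp [binaryOp]
    · refine Subtype.ext ?_
      simp [binaryOp, brLp]
    · simp [binaryOp]
  · simp only [mixedOp]
    rw [D.mixedOp_eq_zero_of_fst, add_zero]
    · have := D.mixedTerm_of_mem lam [] f (List.map Prod.snd (List.ofFn fun j => ((0, t j) : D.Tot)))
        a hf homogeneousList_nil
      rw [List.map_nil] at this
      rw [this, List.map_ofFn]
      simp [Function.comp_def]
    · intro x hx
      obtain ⟨j, rfl⟩ := (List.mem_ofFn' _ _).1 hx
      rfl

theorem modifiedBrackets_vanish (lam : k) (n : ℕ) (x : Fin (n + 1) → D.Tot)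
    (S : Finset (Fin (n + 1))) (h1 : ∀ j ∈ S, (x j).2 = 0) (h2 : ∀ j ∉ S, (x j).1 = 0)
    (h3 : S.card ≠ 1) (h4 : ¬ (S.card = 2 ∧ n = 1)) : D.modifiedBrackets lam n x = 0 := by
  rw [modifiedBrackets_apply]
  by_cases h0 : S.card = 0
  · rw [Finset.card_eq_zero] at h0
    subst h0
    have hx : ∀ y ∈ List.ofFn x, y.1 = 0 := by
      intro y hy
      obtain ⟨j, rfl⟩ := (List.mem_ofFn' _ _).1 hy
      exact h2 j (by simp)
    rw [D.mixedOp_eq_zero_of_fst _ _ _ hx]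
    refine Prod.ext ?_ rfl
    simp only
    generalize List.ofFn x = T at hx
    rcases T with _ | ⟨y, _ | ⟨z, _ | ⟨w, T⟩⟩⟩
    · rfl
    · rfl
    · refine Subtype.ext ?_
      simp [binaryOp, brLp, hx z (by simp)]
    · rfl
  -- Two positions without `F`-component kill the mixed part, and the arity is not two, so the
  -- binary part vanishes as well.
  · obtain ⟨i, hi, j, hj, hij⟩ := Finset.one_lt_card.1 (show 1 < S.card by omega)
    have hn : n ≠ 1 := by
      rintro rfl
      have := Finset.card_le_univ S
      rw [Fintype.card_fin] at this
      exact h4 ⟨by omega, rfl⟩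
    have hb : D.binaryOp (List.ofFn x) = 0 := by
      have hl : (List.ofFn x).length = n + 1 := List.length_ofFn
      generalize List.ofFn x = T at hl
      rcases T with _ | ⟨y, _ | ⟨z, _ | ⟨w, T⟩⟩⟩
      · rfl
      · rfl
      · simp at hl; omega
      · rfl
    have hm : ∀ i j : Fin (n + 1), i < j → i ∈ S → j ∈ S → D.mixedOp lam [] (List.ofFn x) = 0 := by
      intro i j hij hi hj
      have hi' : (i : ℕ) < (List.ofFn x).length := by rw [List.length_ofFn]; exact i.2
      have e := List.take_append_drop i (List.ofFn x)
      rw [List.drop_eq_getElem_cons hi', List.getElem_ofFn] at e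
      rw [← e]
      refine D.mixedOp_eq_zero_of_two lam _ _ _ _ (x j) (h1 i hi) (h1 j hj) ?_
      have hij' : (i : ℕ) < j := hij
      rw [List.mem_drop_iff_getElem]
      refine ⟨(j : ℕ) - (i + 1), by simp only [List.length_ofFn]; omega, ?_⟩
      rw [List.getElem_ofFn]
      congr 1
      exact Fin.ext (by simp only; omega)
    rw [hb]
    rcases lt_or_gt_of_ne hij with h | h
    · rw [hm i j h hi hj]; rfl
    · rw [hm j i h hj hi]; rfl

end DerivedData

/-! ### Uniqueness of the modified brackets and the grading -/

namespace DerivedData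

variable {k L F : Type*} [Field k] [AddCommGroup L] [Module k L] [AddCommGroup F] [Module k F]
  (D : DerivedData k L F)

theorem IsModified.listOp_unique {D : DerivedData k L F} {lam : k} {l l' : Brackets k D.Tot}
    (hl : D.IsModified lam l) (hl' : D.IsModified lam l') (T : List (ℤ × D.Tot))
    (hT : HomogeneousList D.grading T) :
    listOp l (T.map Prod.snd) = listOp l' (T.map Prod.snd) := by
  refine homogeneousList_induction (p := fun x : D.Tot => x.1 = 0 ∨ x.2 = 0)
    (Q := fun T => listOp l (T.map Prod.snd) = listOp l' (T.map Prod.snd)) ?_ ?_ ?_ T hT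
  · rintro d ⟨f, t⟩ hx
    exact ⟨(f, 0), (0, t), by simp, ⟨hx.1, (D.gF _).zero_mem⟩, ⟨(D.gL _).zero_mem, hx.2⟩,
      Or.inr rfl, Or.inl rfl⟩
  · intro L₁ L₂ d a b ha hb
    simp only [List.map_append, List.map_cons, listOp_add] at *
    rw [ha, hb]
  · intro T hT hp
    obtain ⟨T, rfl⟩ := D.exists_tagged T hp
    obtain ⟨fs, ts, hperm, -, -⟩ := D.tagged_perm T
    have hp' := hperm.map D.toTot
    obtain ⟨u, hu⟩ := listOp_perm (k := k) hp' hT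
    have h' : HomogeneousList D.grading ((fs.map Sum.inl ++ ts.map Sum.inr).map D.toTot) :=
      fun a ha => hT a (hp'.mem_iff.2 ha)
    have h1 := hu l hl.symm [] homogeneousList_nil
    have h2 := hu l' hl'.symm [] homogeneousList_nil
    simp only [List.nil_append] at h1 h2
    rw [h1, h2, hl.sorted h', hl'.sorted h']

/-- The defining formulas determine the values on homogeneous arguments, and a multilinear map is
determined on a spanning set. -/
theorem IsModified.unique {D : DerivedData k L F} {lam : k} {l l' : Brackets k D.Tot}
    (hl : D.IsModified lam l) (hl' : D.IsModified lam l') (htop : ⨆ d, D.grading d = ⊤) :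
    l = l' := by
  funext n
  refine MultilinearMap.ext_of_span_eq_top
    (g := fun _ (x : Σ d, D.grading d) => (x.2 : D.Tot)) (fun _ => ?_) fun x => ?_
  · rw [eq_top_iff, ← htop, iSup_le_iff]
    intro d x hx
    exact Submodule.subset_span ⟨⟨d, x, hx⟩, rfl⟩
  · have := hl.listOp_unique hl' (List.ofFn fun i => ((x i).1, ((x i).2 : D.Tot))) (by
      intro a ha
      obtain ⟨j, rfl⟩ := (List.mem_ofFn' _ _).1 ha
      exact (x j).2.2)
    simpa only [List.map_ofFn, listOp_ofFn, Function.comp_def] using this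

/-- The operator on `s⁻¹ Lp ⊕ F` that multiplies the elements of degree `d` by `c d`. -/
def scale (c : ℤ → k) : D.Tot →ₗ[k] D.Tot :=
  LinearMap.prodMap ((D.scL fun e => c (e - 1)).restrict fun _ h => D.scL_Lp _ h) (D.scF c)

theorem scale_of_mem (c : ℤ → k) {d : ℤ} {x : D.Tot} (hx : x ∈ D.grading d) :
    D.scale c x = c d • x := by
  refine Prod.ext (Subtype.ext ?_) (D.scF_of_mem c hx.2)
  have := D.scL_of_mem (fun e => c (e - 1)) hx.1
  rw [add_sub_cancel_right] at this
  exact this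

/-- Scaling by the indicator function of `d` is the identity in degree `d` and zero on the span of
all other degrees. -/
theorem iSupIndep_grading : iSupIndep D.grading := by
  classical
  intro d
  rw [Submodule.disjoint_def]
  intro x hx hx'
  set c : ℤ → k := fun e => if e = d then 1 else 0 with hc
  have h1 : D.scale c x = x := by rw [D.scale_of_mem c hx]; simp [hc]
  have h2 : ⨆ j, ⨆ (_ : j ≠ d), D.grading j ≤ LinearMap.ker (D.scale c) := by
    refine iSup_le fun j => iSup_le fun hj y hy => ?_
    rw [LinearMap.mem_ker, D.scale_of_mem c hy]
    simp [hc, hj]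
  rw [← h1]
  exact h2 hx'

theorem IsModified.isLInftyOneAlgebra {D : DerivedData k L F} {lam : k} {l : Brackets k D.Tot}
    (hl : D.IsModified lam l) (htop : ⨆ d, D.grading d = ⊤) : IsLInftyOneAlgebra D.grading l := by
  have hhom : ∀ (n : ℕ) (d : Fin (n + 1) → ℤ) (x : Fin (n + 1) → D.Tot),
      (∀ i, x i ∈ D.grading (d i)) → HomogeneousList D.grading (List.ofFn fun i => (d i, x i)) := by
    intro n d x hx a ha
    obtain ⟨j, rfl⟩ := (List.mem_ofFn' _ _).1 ha
    exact hx j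
  refine ⟨?_, fun n d x hx => ?_, hl.symm, fun n d x hx => ?_⟩
  · exact (DirectSum.isInternal_submodule_iff_iSupIndep_and_iSup_eq_top _).2
      ⟨D.iSupIndep_grading, htop⟩
  · have h := hl.degree _ (hhom n d x hx)
    rw [List.map_ofFn, degSum, List.map_ofFn, List.sum_ofFn] at h
    rw [← listOp_ofFn]
    exact h
  · rw [jacobiator_eq_jacSum]
    exact hl.jacobi _ (hhom n d x hx)

end DerivedData

/-! ### The derived bracket data of the `Ω`-Gerstenhaber bracket -/

section Concrete

variable (k Ω A V : Type*) [Field k] [Semigroup Ω] [AddCommGroup A] [Module k A]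
  [AddCommGroup V] [Module k V]

/-- The `Ω`-Gerstenhaber bracket, the subalgebras `𝔞` and `𝔏'` and the projection onto `𝔞`. -/
abbrev omegaData : DerivedData k (BigL k Ω A V) (Frak k Ω A V) where
  br := gerstenhaber k Ω (A × V)
  gL := cochainsOfDegree k Ω (A × V)
  gF := homogeneous k (fun n => HomOmega k Ω (n + 1) V A)
  ι := inclA k Ω A V
  P := projA k Ω A V
  Lp := LPrime k Ω A V
  br_mem := gerstenhaber_mem_homogeneous
  br_symm := gerstenhaber_symm
  br_jacobi := gerstenhaber_jacobi
  ι_mem := inclA_mem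
  P_mem := projA_mem
  br_ι_ι := gerstenhaber_inclA_inclA
  P_br := projA_gerstenhaber
  P_Lp := projA_LPrime
  br_Lp := gerstenhaber_mem_LPrime
  P_foldl := fun hf hm ts h => by
    have := iterBr_eq_zero hf hm ts h
    rw [iterBr] at this
    rw [this, map_zero]
  scL := scaleSum
  scF := scaleSum
  scL_of_mem := fun c hx => scaleSum_of_mem c hx
  scF_of_mem := fun c hx => scaleSum_of_mem c hx
  scL_Lp := fun c hf n => by
    rw [scaleSum_apply]
    exact Submodule.smul_mem _ _ (hf n)

theorem omegaData_grading : (omegaData k Ω A V).grading = totalGrading k Ω A V := by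
  funext d
  ext x
  refine and_congr (forall_congr' fun n => ?_) Iff.rfl
  rw [show (n : ℤ) ≠ d + 1 ↔ (n : ℤ) - 1 ≠ d by omega]

theorem iSup_totalGrading : ⨆ d, totalGrading k Ω A V d = ⊤ := by
  set N := ⨆ d, totalGrading k Ω A V d with hN
  have h1 : ∀ f : LPrime k Ω A V, (f, 0) ∈ N := by
    intro f
    have h := componentwise_induction (S := fun n => LPrimeHom k Ω A V (n + 1))
      ((N.comap (LinearMap.inl k (LPrime k Ω A V) (Frak k Ω A V))).map (LPrime k Ω A V).subtype)
      (fun n g hg => ⟨⟨_, lof_mem_componentwise hg⟩, ?_, rfl⟩) (x := (f : BigL k Ω A V)) f.2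
    · obtain ⟨g, hg, e⟩ := h
      obtain rfl : g = f := Subtype.ext e
      exact hg
    · refine Submodule.mem_iSup_of_mem ((n : ℤ) - 1) ⟨fun j hj => ?_, fun _ _ => rfl⟩
      exact lof_mem_homogeneous (M := fun n => HomOmega k Ω (n + 1) (A × V) (A × V)) n g j
        (fun e => hj (by rw [e]))
  have h2 : ∀ θ : Frak k Ω A V, (0, θ) ∈ N := by
    intro θ
    refine componentwise_induction (k := k) (M := fun n => HomOmega k Ω (n + 1) V A)
      (S := fun _ => ⊤)
      (N.comap (LinearMap.inr k (LPrime k Ω A V) (Frak k Ω A V)))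
      (fun n g _ => ?_) (x := θ) (fun _ => Submodule.mem_top)
    refine Submodule.mem_iSup_of_mem (n : ℤ) ⟨fun _ _ => rfl, fun j hj => ?_⟩
    exact lof_mem_homogeneous (k := k) (M := fun n => HomOmega k Ω (n + 1) V A) n g j hj
  rw [eq_top_iff]
  rintro ⟨f, θ⟩ -
  have := N.add_mem (h1 f) (h2 θ)
  simpa using this

variable {k Ω A V}

theorem mem_cochainsOfDegree_natCast {m : ℕ} {f : BigL k Ω A V} :
    f ∈ cochainsOfDegree k Ω (A × V) m ↔ ∀ j, j ≠ m → f j = 0 :=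
  forall_congr' fun j => by rw [ne_eq, Nat.cast_inj]

theorem eq_zero_or_natCast {a : ℤ} {f : BigL k Ω A V} (hf : f ∈ cochainsOfDegree k Ω (A × V) a) :
    f = 0 ∨ ∃ m : ℕ, a = m := by
  rcases mem_homogeneous_iff hf with rfl | ⟨m, -, h, -⟩
  · exact Or.inl rfl
  · exact Or.inr ⟨m, h.symm⟩

theorem IsModifiedBrackets.isModified {lam : k} {l : Brackets k (Total k Ω A V)}
    (hl : IsModifiedBrackets lam l) : (omegaData k Ω A V).IsModified lam l where
  symm := omegaData_grading k Ω A V ▸ hl.symm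
  one := fun x => by
    have e : listOp l [x] = l 0 ![x] := by rw [← listOp_ofFn]; simp
    rw [e, hl.one, zero_apply]
  two := fun a f g hf => by
    -- Degrees in `DerivedData` are arbitrary integers; one that is not a natural number forces `f =
    -- 0`.
    rcases eq_zero_or_natCast hf with h | ⟨m, rfl⟩
    · obtain rfl : f = 0 := Subtype.ext h
      have h0 := listOp_cons_zero l [((g, 0) : Total k Ω A V)]
      refine h0.trans ?_
      refine Prod.ext (Subtype.ext ?_) (by simp)
      simp [DerivedData.brLp]
    · have e : listOp l [(f, 0), (g, 0)] = l 1 ![(f, 0), (g, 0)] := by rw [← listOp_ofFn]; simp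
      obtain ⟨h1, h2⟩ := hl.two m f g (mem_cochainsOfDegree_natCast.1 hf)
      rw [e]
      refine Prod.ext (Subtype.ext ?_) ?_
      · rw [h1, sg_natCast]; rfl
      · rw [h2]; simp
  mixed := fun a f ts hf hts => by
    rcases eq_zero_or_natCast hf with h | ⟨m, rfl⟩
    · obtain rfl : f = 0 := Subtype.ext h
      refine (listOp_cons_zero l _).trans ?_
      have := (omegaData k Ω A V).iter_zero ts
      rw [ZeroMemClass.coe_zero, this]
      simp only [map_zero, smul_zero]
      rfl
    · have h := hl.mixed m ts.length f (fun i => (ts.get i).2)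
        (List.length_pos_iff.2 hts) (mem_cochainsOfDegree_natCast.1 hf)
      rw [← listOp_ofFn, List.ofFn_cons] at h
      have e1 : (List.ofFn fun i => ((0 : LPrime k Ω A V), (ts.get i).2)) =
          ts.map fun t => (0, t.2) := by
        conv_rhs => rw [← List.ofFn_get ts, List.map_ofFn]
        rfl
      have e2 : (List.ofFn fun i => (ts.get i).2) = ts.map Prod.snd := by
        conv_rhs => rw [← List.ofFn_get ts, List.map_ofFn]
        rfl
      rw [e1, iteratedBracket, e2] at h
      rw [h]
      push_cast
      rfl
  vanish_zero := fun ts => by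
    rcases ts with _ | ⟨t, ts⟩
    · rfl
    · rw [listOp_eq l (n := ts.length) _ (by simp)]
      refine hl.vanish _ _ ∅ (by simp) (fun j _ => ?_) (by simp) (by simp)
      obtain ⟨s, -, h⟩ := List.mem_map.1 (List.get_mem ((t :: ts).map fun t =>
        ((0, t) : Total k Ω A V)) (j.cast (by simp)))
      exact (congrArg Prod.fst h).symm
  vanish_two := fun f g L hL hx => by
    classical
    rw [listOp_eq l (n := L.length + 1) _ (by simp)]
    set x : Fin (L.length + 1 + 1) → Total k Ω A V := fun i =>
      ((f, 0) :: (g, 0) :: L).get (i.cast (by simp)) with hxdef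
    have hL' := List.length_pos_iff.2 hL
    have hmem : ∀ j, (x j).1 = 0 ∨ (x j).2 = 0 := by
      intro j
      have : x j ∈ (f, 0) :: (g, 0) :: L := List.get_mem _ _
      rw [List.mem_cons, List.mem_cons] at this
      rcases this with h | h | h
      · exact Or.inr (by rw [h])
      · exact Or.inr (by rw [h])
      · exact hx _ h
    -- The positions with zero component in `𝔞` include the first two. Since `L` is nonempty the
    -- arity is at least three, so the vanishing rule applies to this set of positions.
    have hcard : 1 < (Finset.univ.filter fun j => (x j).2 = 0).card :=
      Finset.one_lt_card.2 ⟨0, by simp [hxdef], 1, by simp [hxdef], by simp⟩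
    refine hl.vanish _ x (Finset.univ.filter fun j => (x j).2 = 0) (fun j hj => ?_) (fun j hj => ?_)
      hcard.ne' (fun h => by omega)
    · simpa using hj
    · exact (hmem j).resolve_right (by simpa using hj)

theorem isModifiedBrackets_modifiedBrackets (lam : k) :
    IsModifiedBrackets lam ((omegaData k Ω A V).modifiedBrackets lam) where
  symm := omegaData_grading k Ω A V ▸ (omegaData k Ω A V).modifiedBrackets_symm lam
  one := (omegaData k Ω A V).modifiedBrackets_one lam
  two := fun m f g hf => by
    have h := (omegaData k Ω A V).modifiedBrackets_two lam (mem_cochainsOfDegree_natCast.2 hf) g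
    rw [sg_natCast] at h
    rw [h]
    exact ⟨rfl, smul_zero _⟩
  mixed := fun m n f θ _ hf => by
    have h := (omegaData k Ω A V).modifiedBrackets_mixed lam
      (mem_cochainsOfDegree_natCast.2 hf) n θ
    rw [h]
    push_cast
    rfl
  vanish := (omegaData k Ω A V).modifiedBrackets_vanish lam

end Concrete

end OmegaRB

end

theorem mainTheorem1 (k : Type*) [Field k] [CharZero k] (Ω : Type*) [Semigroup Ω]
    (A V : Type*) [AddCommGroup A] [Module k A] [AddCommGroup V] [Module k V] (lam : k) :
    ∃ l : OmegaRB.Brackets k (OmegaRB.Total k Ω A V),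
      OmegaRB.IsModifiedBrackets lam l ∧
      (∀ l' : OmegaRB.Brackets k (OmegaRB.Total k Ω A V),
        OmegaRB.IsModifiedBrackets lam l' → l' = l) ∧
      OmegaRB.IsLInftyOneAlgebra (OmegaRB.totalGrading k Ω A V) l := by
  have h := OmegaRB.isModifiedBrackets_modifiedBrackets (Ω := Ω) (A := A) (V := V) lam
  have htop : ⨆ d, (OmegaRB.omegaData k Ω A V).grading d = ⊤ := by
    rw [OmegaRB.omegaData_grading, OmegaRB.iSup_totalGrading]
  refine ⟨_, h, fun l' h' => h'.isModified.unique h.isModified htop, ?_⟩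
  have hL := h.isModified.isLInftyOneAlgebra htop
  rwa [OmegaRB.omegaData_grading] at hL
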